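/- Let $n\ge 2$ and let $g(y,\eta)$ and $\tilde g(x,y,\eta)$ ($x\ge 0$, $y,\eta\in\mathbb R^{n-1}$) be smooth functions which are homogeneous polynomials of degree $2$ in $\eta$. Put $g_\epsilon(r,y,\eta)=g(y,\eta)+\epsilon e^{-r}\tilde g(e^{-r},y,\eta)$ and assume that for some $C_0>0$ one has $C_0^{-1}|\eta|^2\le g_\epsilon(r,y,\eta)\le C_0|\eta|^2$ for all $r\in\mathbb R$, $y,\eta\in\mathbb R^{n-1}$, $\epsilon\in[0,1]$, and that for all $k,\alpha,\beta$ there is $C_{k,\alpha,\beta}$ with $$|\partial_x^k\partial_y^\alpha\partial_\eta^\beta\tilde g(x,y,\eta)|+|\partial_y^\alpha\partial_\eta^\beta g(y,\eta)|\le C_{k,\alpha,\beta}|\eta|^{2-|\beta|},\qquad x\in[0,1],\ y,\eta\in\mathbb R^{n-1}.$$ Let $p_\epsilon(r,y,\rho,\eta)=\rho^2+e^{-2r}g_\epsilon(r,y,\eta)$ on $\mathbb R\times\mathbb R^{n-1}\times\mathbb R\times\mathbb R^{n-1}$. For $R,\varepsilon>0$, $0<w<1/2$ and open $\Omega\subset\mathbb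 R^{n-1}$ let $$\Gamma^\pm(R,\varepsilon,w,\Omega)=\{(r,y,\rho,\eta)\ :\ p_0(r,y,\rho,\eta)\in(1-w,1+w),\ r>R,\ \pm\rho>0,\ y\in\Omega,\ e^{-2r}g(y,\eta)<\varepsilon\}.$$ Let $\Omega_0,\Omega_1\subset\mathbb R^{n-1}$ be bounded, connected, open sets with $\overline{\Omega_1}\subset\Omega_0$. Then for every $\epsilon\in[0,1]$ the Hamiltonian flow $(r^t_\epsilon,y^t_\epsilon,\rho^t_\epsilon,\eta^t_\epsilon)$ of $p_\epsilon$ is defined for all $t\in\mathbb R$. Write $\Phi^t_\epsilon(r,y,\rho,\eta)=(r,y,\rho^t_\epsilon,\eta^t_\epsilon)$. There exist $R_0,R_1>0$, $w_0,w_1\in(0,1/2)$ and $\varepsilon_0,\varepsilon_1>0$ such that, for each choice of the sign $\pm$, with $\Gamma_0^\pm=\Gamma^\pm(R_0,\varepsilon_0,w_0,\Omega_0)$ and $\Gamma_1^\pm=\Gamma^\pm(R_1,\varepsilon_1,w_1,\Omega_1)$, the following hold. 1. For all $\epsilon\in[0,1]$ and $\pm t\ge 0$, $\Phi^t_\epsilon$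 is a diffeomorphism from $\Gamma_0^\pm$ onto its (open) range, and $\Gamma_1^\pm\subset\Phi^t_\epsilon(\Gamma_0^\pm)$. Write the inverse map as $(r,y,\rho,\eta)\mapsto(r,y,\tilde\rho^t_\epsilon,\tilde\eta^t_\epsilon)$. For each fixed $t$ with $\pm t\ge0$, the functions $\tilde\rho^t_\epsilon,\tilde\eta^t_\epsilon$ are smooth in $(r,y,\rho,\eta,\epsilon)\in\Gamma_1^\pm\times[0,1]$, and for every $\partial^\gamma=\partial_r^k\partial_y^\alpha\partial_\rho^l\partial_\eta^\beta\partial_\epsilon^j$ there is $C_\gamma$, independent of $\epsilon\in[0,1]$, of $\pm t\ge0$ and of $(r,y,\rho,\eta)\in\Gamma_1^\pm$, with $$|\partial^\gamma(\tilde\rho^t_\epsilon-\rho)|+|\partial^\gamma(\tilde\eta^t_\epsilon-\eta)|\le C_\gamma e^{-(j+1)r}m_\beta(r,\eta),$$ where $m_\beta(r,\eta)=|\eta|$ if $|\beta|\le1$ and $m_\beta(r,\eta)=|\eta|+e^{-r}$ if $|\beta|\ge2$. 2. There is a function $S^\pm_\epsilon(t,r,y,\rho,\eta)$, smooth in $(t,r,y,\rho,\eta,\epsilon)$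 for $\pm t\ge0$, $(r,y,\rho,\eta)\in\Gamma_1^\pm$, $\epsilon\in[0,1]$, which solves there $$\partial_tS^\pm_\epsilon=p_\epsilon(r,y,\partial_rS^\pm_\epsilon,\partial_yS^\pm_\epsilon),\qquad S^\pm_\epsilon(0,r,y,\rho,\eta)=r\rho+y\cdot\eta ,$$ and which satisfies, for every $\partial^\gamma$ as above and with $C_\gamma$ independent of $\epsilon\in[0,1]$, $\pm t\ge0$ and $(r,y,\rho,\eta)\in\Gamma_1^\pm$, $$|\partial^\gamma(S^\pm_\epsilon-r\rho-y\cdot\eta-t\rho^2)|\le C_\gamma e^{-(j+1)r}m_\beta(r,\eta).$$ (At $x=0$, at $\epsilon=0,1$ and at $t=0$, derivatives in $x$, $\epsilon$ and $t$ are one-sided.) -/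

import Mathlib

open Set
open scoped ContDiff RealInnerProductSpace

noncomputable section

namespace HypEikonal

/-- The space `ℝ^d` (with `d = n - 1`) of the variables `y` and `η`, with its Euclidean norm. -/
abbrev Base (d : ℕ) : Type := EuclideanSpace ℝ (Fin d)

/-- Points `(r, y, ρ, η)` of the phase space `ℝ × ℝ^d × ℝ × ℝ^d`. -/
abbrev Phase (d : ℕ) : Type := ℝ × Base d × ℝ × Base d

/-! ### Coordinate partial derivatives -/

/-- The iterated partial derivative `∂_{e (γ 0)} ⋯ ∂_{e (γ (m - 1))} f` at the point `p`, taken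
within the set `s` (one-sided at boundary points of `s`). -/
def pderivWithin {ι V F : Type*} [NormedAddCommGroup V] [NormedSpace ℝ V]
    [NormedAddCommGroup F] [NormedSpace ℝ F] (e : ι → V) {m : ℕ} (γ : Fin m → ι)
    (f : V → F) (s : Set V) (p : V) : F :=
  iteratedFDerivWithin ℝ m f s p (fun i => e (γ i))

/-- The coordinates of `(x, y, η) ∈ ℝ × ℝ^d × ℝ^d`. -/
inductive MetricCoord (d : ℕ) : Type
  | x : MetricCoord d
  | y : Fin d → MetricCoord d
  | eta : Fin d → MetricCoord d

/-- The unit vector of a coordinate of `(x, y, η)`. -/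
def MetricCoord.vec {d : ℕ} : MetricCoord d → ℝ × Base d × Base d
  | .x => (1, 0, 0)
  | .y i => (0, EuclideanSpace.single i 1, 0)
  | .eta i => (0, 0, EuclideanSpace.single i 1)

/-- `1` for the coordinates `η_i`, `0` for the others. -/
def MetricCoord.etaDeg {d : ℕ} : MetricCoord d → ℕ
  | .eta _ => 1
  | _ => 0

/-- The coordinates of `((r, y, ρ, η), ε) ∈ ℝ^{2n} × ℝ`. -/
inductive Coord (d : ℕ) : Type
  | r : Coord d
  | y : Fin d → Coord d
  | rho : Coord d
  | eta : Fin d → Coord d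
  | eps : Coord d

/-- The unit vector of a coordinate of `((r, y, ρ, η), ε)`. -/
def Coord.vec {d : ℕ} : Coord d → Phase d × ℝ
  | .r => ((1, 0, 0, 0), 0)
  | .y i => ((0, EuclideanSpace.single i 1, 0, 0), 0)
  | .rho => ((0, 0, 1, 0), 0)
  | .eta i => ((0, 0, 0, EuclideanSpace.single i 1), 0)
  | .eps => ((0, 0, 0, 0), 1)

/-- `1` for the coordinates `η_i`, `0` for the others. -/
def Coord.etaDeg {d : ℕ} : Coord d → ℕ
  | .eta _ => 1
  | _ => 0

/-- `1` for the coordinate `ε`, `0` for the others. -/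
def Coord.epsDeg {d : ℕ} : Coord d → ℕ
  | .eps => 1
  | _ => 0

/-! ### The metrics and the Hamiltonian -/

/-- A family `h(x, y, ·)` of quadratic forms in `η`, smooth in `x ≥ 0` and `y`, such that
`|∂_x^k ∂_y^α ∂_η^β h(x, y, η)| ≤ C_{k,α,β} |η|^{2 - |β|}` for `x ∈ [0, 1]` and all `y, η`. -/
structure SymbolBounds {d : ℕ} (h : ℝ → Base d → QuadraticForm ℝ (Base d)) : Prop where
  smooth : ContDiffOn ℝ ∞ (fun q : ℝ × Base d × Base d => h q.1 q.2.1 q.2.2) (Ici 0 ×ˢ univ)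
  bound : ∀ (m : ℕ) (γ : Fin m → MetricCoord d), ∃ C : ℝ, ∀ x ∈ Icc (0 : ℝ) 1, ∀ y η : Base d,
    |pderivWithin MetricCoord.vec γ (fun q : ℝ × Base d × Base d => h q.1 q.2.1 q.2.2)
        (Ici 0 ×ˢ univ) (x, y, η)|
      ≤ C * ‖η‖ ^ ((2 : ℤ) - ((∑ i, (γ i).etaDeg : ℕ) : ℤ))

/-- `g_ε(r, y, η) = g(y, η) + ε e^{-r} g̃(e^{-r}, y, η)`. -/
def gEps {d : ℕ} (g : Base d → QuadraticForm ℝ (Base d))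
    (gt : ℝ → Base d → QuadraticForm ℝ (Base d)) (ε r : ℝ) (y η : Base d) : ℝ :=
  g y η + ε * Real.exp (-r) * gt (Real.exp (-r)) y η

/-- The assumptions on `g` and `g̃`: both satisfy the symbol bounds (`g` does not depend on `x`),
and the forms `g_ε(r, y, ·)`, `ε ∈ [0, 1]`, are uniformly equivalent to `|η|²`. -/
structure Admissible {d : ℕ} (g : Base d → QuadraticForm ℝ (Base d))
    (gt : ℝ → Base d → QuadraticForm ℝ (Base d)) : Prop where
  bounds_g : SymbolBounds (fun _ => g)
  bounds_gt : SymbolBounds gt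
  elliptic : ∃ C₀ : ℝ, 0 < C₀ ∧ ∀ ε ∈ Icc (0 : ℝ) 1, ∀ (r : ℝ) (y η : Base d),
    C₀⁻¹ * ‖η‖ ^ 2 ≤ gEps g gt ε r y η ∧ gEps g gt ε r y η ≤ C₀ * ‖η‖ ^ 2

/-- `p_ε(r, y, ρ, η) = ρ² + e^{-2r} g_ε(r, y, η)`. -/
def ham {d : ℕ} (g : Base d → QuadraticForm ℝ (Base d))
    (gt : ℝ → Base d → QuadraticForm ℝ (Base d)) (ε r : ℝ) (y : Base d) (ρ : ℝ) (η : Base d) : ℝ :=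
  ρ ^ 2 + Real.exp (-2 * r) * gEps g gt ε r y η

/-- The Hamiltonian vector field `(∂_ρ p_ε, ∂_η p_ε, -∂_r p_ε, -∂_y p_ε)`. -/
def hamField {d : ℕ} (g : Base d → QuadraticForm ℝ (Base d))
    (gt : ℝ → Base d → QuadraticForm ℝ (Base d)) (ε : ℝ) : Phase d → Phase d :=
  fun (r, y, ρ, η) =>
    (deriv (fun ρ' => ham g gt ε r y ρ' η) ρ,
      gradient (fun η' => ham g gt ε r y ρ η') η,
      -deriv (fun r' => ham g gt ε r' y ρ η) r,
      -gradient (fun y' => ham g gt ε r y' ρ η) y)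

/-- `φ ε t` is, for every `ε ∈ [0, 1]`, the Hamiltonian flow of `p_ε`, defined for all times. -/
def IsHamFlow {d : ℕ} (g : Base d → QuadraticForm ℝ (Base d))
    (gt : ℝ → Base d → QuadraticForm ℝ (Base d)) (φ : ℝ → ℝ → Phase d → Phase d) : Prop :=
  ∀ ε ∈ Icc (0 : ℝ) 1, ∀ z : Phase d, φ ε 0 z = z ∧
    ∀ t : ℝ, HasDerivAt (fun s => φ ε s z) (hamField g gt ε (φ ε t z)) t

/-- The map `Φ_ε^t : (r, y, ρ, η) ↦ (r, y, ρ_ε^t, η_ε^t)`. -/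
def momentumMap {d : ℕ} (φ : ℝ → ℝ → Phase d → Phase d) (ε t : ℝ) : Phase d → Phase d :=
  fun z => (z.1, z.2.1, (φ ε t z).2.2.1, (φ ε t z).2.2.2)

/-- The region `Γ^±(R, κ, w, Ω)`; the sign `±` is `σ = ±1`. -/
def region {d : ℕ} (g : Base d → QuadraticForm ℝ (Base d))
    (gt : ℝ → Base d → QuadraticForm ℝ (Base d)) (σ R κ w : ℝ) (Ω : Set (Base d)) :
    Set (Phase d) :=
  {(r, y, ρ, η) : Phase d | ham g gt 0 r y ρ η ∈ Ioo (1 - w) (1 + w) ∧ R < r ∧ 0 < σ * ρ ∧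
    y ∈ Ω ∧ Real.exp (-2 * r) * g y η < κ}

/-- `f` is a smooth diffeomorphism from `U` onto its (open) range `f '' U`, with inverse `k`. -/
structure IsDiffeoOntoRange {V : Type*} [NormedAddCommGroup V] [NormedSpace ℝ V]
    (f k : V → V) (U : Set V) : Prop where
  isOpen_source : IsOpen U
  isOpen_range : IsOpen (f '' U)
  leftInv : ∀ z ∈ U, k (f z) = z
  smooth : ContDiffOn ℝ ∞ f U
  smooth_inv : ContDiffOn ℝ ∞ k (f '' U)

/-! ### The estimates -/

/-- The functions `F t` of `((r, y, ρ, η), ε)` are smooth on `D × [0, 1]` when `σ t ≥ 0` and, for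
every `∂^γ = ∂_r^k ∂_y^α ∂_ρ^l ∂_η^β ∂_ε^j`, there is a constant `C`, independent of `t`, `ε` and
of the point, with `|∂^γ F| ≤ C e^{-(j+1)r} |η|` if `|β| ≤ 1` and
`|∂^γ F| ≤ C e^{-(j+1)r} (|η| + e^{-r})` if `|β| ≥ 2`. -/
def ExpEstimates {d : ℕ} {V : Type*} [NormedAddCommGroup V] [NormedSpace ℝ V] (σ : ℝ)
    (D : Set (Phase d)) (F : ℝ → Phase d × ℝ → V) : Prop :=
  (∀ t : ℝ, 0 ≤ σ * t → ContDiffOn ℝ ∞ (F t) (D ×ˢ Icc 0 1)) ∧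
  ∀ (m : ℕ) (γ : Fin m → Coord d), ∃ C : ℝ, ∀ t : ℝ, 0 ≤ σ * t → ∀ ε ∈ Icc (0 : ℝ) 1,
    ∀ (r : ℝ) (y : Base d) (ρ : ℝ) (η : Base d), (r, y, ρ, η) ∈ D →
      ‖pderivWithin Coord.vec γ (F t) (D ×ˢ Icc 0 1) ((r, y, ρ, η), ε)‖
        ≤ C * Real.exp (-((∑ i, (γ i).epsDeg : ℕ) + 1 : ℝ) * r) *
          (if ∑ i, (γ i).etaDeg ≤ 1 then ‖η‖ else ‖η‖ + Real.exp (-r))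

/-- `S(t, (r, y, ρ, η), ε)` is a smooth solution, for `σ t ≥ 0`, `(r, y, ρ, η) ∈ D` and
`ε ∈ [0, 1]`, of `∂_t S = p_ε(r, y, ∂_r S, ∂_y S)`, `S(0) = r ρ + y · η`. -/
structure IsEikonalSolution {d : ℕ} (g : Base d → QuadraticForm ℝ (Base d))
    (gt : ℝ → Base d → QuadraticForm ℝ (Base d)) (σ : ℝ) (D : Set (Phase d))
    (S : ℝ → Phase d × ℝ → ℝ) : Prop where
  smooth : ContDiffOn ℝ ∞ (fun q : ℝ × Phase d × ℝ => S q.1 q.2)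
    ({t : ℝ | 0 ≤ σ * t} ×ˢ D ×ˢ Icc 0 1)
  eq : ∀ t : ℝ, 0 ≤ σ * t → ∀ ε ∈ Icc (0 : ℝ) 1,
    ∀ (r : ℝ) (y : Base d) (ρ : ℝ) (η : Base d), (r, y, ρ, η) ∈ D →
      HasDerivWithinAt (fun τ => S τ ((r, y, ρ, η), ε))
        (ham g gt ε r y (deriv (fun r' => S t ((r', y, ρ, η), ε)) r)
          (gradient (fun y' => S t ((r, y', ρ, η), ε)) y))
        {τ : ℝ | 0 ≤ σ * τ} t
  init : ∀ ε ∈ Icc (0 : ℝ) 1,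
    ∀ (r : ℝ) (y : Base d) (ρ : ℝ) (η : Base d), (r, y, ρ, η) ∈ D →
      S 0 ((r, y, ρ, η), ε) = r * ρ + ⟪y, η⟫

end HypEikonal

end

/-! Fix the sign σ, put s = σ t, and use at the starting point of a trajectory the scaled variables
x = e^{-r}, μ = ε e^{-r}, σρ and ξ = σ e^{-r} η. With u = e^{-(r_s - r)} the Hamiltonian becomes ρ²
+ u² G, where G = g(y, ξ) + μ u g̃(x u, y, ξ) is quadratic in ξ and bounded with all its
derivatives. As long as σρ stays near 1, r_s grows like 2s and u² decays like e^{-4s}, so the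
interaction is integrable along the trajectory.

The unknown is therefore the displacement from free motion, in the compactified time τ = 1 - e^{-s}
∈ [0, 1). Its equation has the weights e^s u² and s e^s u², which still decay exponentially, and so
its right hand side is bounded with all derivatives, uniformly in τ. Smooth dependence on parameters
over this bounded interval (`unifSmooth_of_ode`) bounds all derivatives of the displacement
uniformly for all s ≥ 0. The number ε enters only through μ, which is treated as an independent
parameter in (-1, 1).

Because G is quadratic in ξ, the displacements of r, ρ, η are O(|ξ|²), and that of y, measured in
units of x, is O(|ξ|) (`exists_isScaledFlow`). In scaled variables the momentum map is the identity
plus a term vanishing to second order at ξ = 0. Its derivative is small for small ξ, so it can be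
inverted with uniformly smooth inverse (`exists_unifSmooth_inverse`, `exists_isMomentumInverse`).

All quantities to be estimated thus have the form H_s(x, μ, y, σρ, ξ) with H_s uniformly smooth and
vanishing to second order at ξ = 0. A derivative in ε or in η produces a factor e^{-r}; a derivative
in η lowers the order of vanishing by one, the others preserve it. Together with |ξ| = e^{-r}|η|
this is exactly the claimed estimate (`exists_deriv_symbol`, `expEstimates_of_scaled`).

For the eikonal equation let Z_t be the flow and let z̃ be the point over (r, y) whose final momenta
are (ρ, η). Since p_ε is homogeneous of degree 2 in the momenta, the form ρ dr + η dy pulled back by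
Z_t equals itself plus t dp_ε (`pairing_fderiv_flow`). Hence S = ρ r_t + η · y_t - t p_ε(z̃) has
∂_{(r,y)} S equal to the momenta of z̃ and ∂_t S = p_ε(z̃). Inserting the formulas for Z_t, S minus
rρ + y·η + tρ² is again a function of the above kind (`pairing_flowFormula_sub`). Global existence
of the flow follows from conservation of energy and ellipticity. -/

namespace HypEikonal

/-! ### Uniformly bounded families of smooth functions -/

section UnifSmooth

variable {ι κ E F G H : Type*} [NormedAddCommGroup E] [NormedSpace ℝ E]
  [NormedAddCommGroup F] [NormedSpace ℝ F] [NormedAddCommGroup G] [NormedSpace ℝ G]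
  [NormedAddCommGroup H] [NormedSpace ℝ H]

/-- The functions `f i` are `C^n` on the open sets `U i`, and their derivatives up to the order `n`
are bounded uniformly in `i`. -/
structure UnifSmooth (n : ℕ) (U : ι → Set E) (f : ι → E → F) : Prop where
  isOpen : ∀ i, IsOpen (U i)
  contDiffOn : ∀ i, ContDiffOn ℝ n (f i) (U i)
  bound : ∀ k ≤ n, ∃ C, ∀ i, ∀ x ∈ U i, ‖iteratedFDeriv ℝ k (f i) x‖ ≤ C

namespace UnifSmooth

variable {n : ℕ} {U : ι → Set E} {f g : ι → E → F}

theorem exists_bound (h : UnifSmooth n U f) :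
    ∃ C, 0 ≤ C ∧ ∀ k ≤ n, ∀ i, ∀ x ∈ U i, ‖iteratedFDeriv ℝ k (f i) x‖ ≤ C := by
  choose! C hC using h.bound
  refine ⟨∑ k ∈ Finset.range (n + 1), |C k|, by positivity, fun k hk i x hx => ?_⟩
  calc ‖iteratedFDeriv ℝ k (f i) x‖ ≤ |C k| := (hC k hk i x hx).trans (le_abs_self _)
    _ ≤ ∑ k ∈ Finset.range (n + 1), |C k| :=
      Finset.single_le_sum (f := fun k => |C k|) (fun _ _ => abs_nonneg _)
        (Finset.mem_range.2 (Nat.lt_succ_of_le hk))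

theorem norm_le (h : UnifSmooth n U f) : ∃ C, 0 ≤ C ∧ ∀ i, ∀ x ∈ U i, ‖f i x‖ ≤ C := by
  obtain ⟨C, h0, hC⟩ := h.exists_bound
  exact ⟨C, h0, fun i x hx => by simpa using hC 0 (Nat.zero_le _) i x hx⟩

theorem norm_fderiv_le (h : UnifSmooth (n + 1) U f) :
    ∃ C, 0 ≤ C ∧ ∀ i, ∀ x ∈ U i, ‖fderiv ℝ (f i) x‖ ≤ C := by
  obtain ⟨C, h0, hC⟩ := h.exists_bound
  refine ⟨C, h0, fun i x hx => ?_⟩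
  have := hC 1 (by omega) i x hx
  rwa [← norm_iteratedFDeriv_fderiv, norm_iteratedFDeriv_zero] at this

theorem mono_n {m : ℕ} (h : UnifSmooth n U f) (hm : m ≤ n) : UnifSmooth m U f :=
  ⟨h.isOpen, fun i => (h.contDiffOn i).of_le (by exact_mod_cast hm),
    fun k hk => h.bound k (hk.trans hm)⟩

theorem mono {V : ι → Set E} (h : UnifSmooth n U f) (hV : ∀ i, IsOpen (V i))
    (hVU : ∀ i, V i ⊆ U i) : UnifSmooth n V f :=
  ⟨hV, fun i => (h.contDiffOn i).mono (hVU i), fun k hk =>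
    (h.bound k hk).imp fun _ hC i x hx => hC i x (hVU i hx)⟩

theorem reindex (h : UnifSmooth n U f) (e : κ → ι) :
    UnifSmooth n (fun j => U (e j)) (fun j => f (e j)) :=
  ⟨fun _ => h.isOpen _, fun _ => h.contDiffOn _, fun k hk =>
    (h.bound k hk).imp fun _ hC _ x hx => hC _ x hx⟩

theorem differentiableAt (h : UnifSmooth (n + 1) U f) {i : ι} {x : E} (hx : x ∈ U i) :
    DifferentiableAt ℝ (f i) x :=
  ((h.contDiffOn i).contDiffAt ((h.isOpen i).mem_nhds hx)).differentiableAt (by simp)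

theorem congr (h : UnifSmooth n U f) (hfg : ∀ i, ∀ x ∈ U i, g i x = f i x) :
    UnifSmooth n U g := by
  refine ⟨h.isOpen, fun i => (h.contDiffOn i).congr (hfg i), fun k hk => ?_⟩
  refine (h.bound k hk).imp fun C hC i x hx => ?_
  have : g i =ᶠ[nhds x] f i :=
    Filter.eventuallyEq_of_mem ((h.isOpen i).mem_nhds hx) (hfg i)
  rw [Filter.EventuallyEq.eq_of_nhds (this.iteratedFDeriv ℝ k)]
  exact hC i x hx

/-- On open sets both kinds of iterated derivative agree, so estimates for functions that are smooth
only on U i can be made with the derivatives within U i. -/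
theorem of_within (hU : ∀ i, IsOpen (U i)) (hf : ∀ i, ContDiffOn ℝ n (f i) (U i))
    (hb : ∀ k ≤ n, ∃ C, ∀ i, ∀ x ∈ U i, ‖iteratedFDerivWithin ℝ k (f i) (U i) x‖ ≤ C) :
    UnifSmooth n U f :=
  ⟨hU, hf, fun k hk => (hb k hk).imp fun C hC i x hx => by
    rw [← iteratedFDerivWithin_of_isOpen k (hU i) hx]; exact hC i x hx⟩

theorem within_bound (h : UnifSmooth n U f) :
    ∃ C, 0 ≤ C ∧ ∀ k ≤ n, ∀ i, ∀ x ∈ U i, ‖iteratedFDerivWithin ℝ k (f i) (U i) x‖ ≤ C := by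
  obtain ⟨C, h0, hC⟩ := h.exists_bound
  refine ⟨C, h0, fun k hk i x hx => ?_⟩
  rw [iteratedFDerivWithin_of_isOpen k (h.isOpen i) hx]
  exact hC k hk i x hx

theorem succ (hb : ∃ C, ∀ i, ∀ x ∈ U i, ‖f i x‖ ≤ C)
    (hd : ∀ i, ∀ x ∈ U i, DifferentiableAt ℝ (f i) x)
    (h : UnifSmooth n U (fun i => fderiv ℝ (f i))) : UnifSmooth (n + 1) U f := by
  refine ⟨h.isOpen, fun i => ?_, fun k hk => ?_⟩
  · have := (contDiffOn_succ_iff_fderiv_of_isOpen (n := (n : ℕ∞ω)) (h.isOpen i)).2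
      ⟨fun x hx => (hd i x hx).differentiableWithinAt, by simp, h.contDiffOn i⟩
    exact_mod_cast this
  · rcases k with _ | k
    · simpa using hb
    · refine (h.bound k (by omega)).imp fun C hC i x hx => ?_
      rw [← norm_iteratedFDeriv_fderiv]
      exact hC i x hx

theorem fderiv (h : UnifSmooth (n + 1) U f) : UnifSmooth n U (fun i => fderiv ℝ (f i)) := by
  refine ⟨h.isOpen, fun i => (h.contDiffOn i).fderiv_of_isOpen (h.isOpen i) (by simp),
    fun k hk => (h.bound (k + 1) (by omega)).imp fun C hC i x hx => ?_⟩
  rw [norm_iteratedFDeriv_fderiv]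
  exact hC i x hx

theorem const (hU : ∀ i, IsOpen (U i)) (c : F) : UnifSmooth n U (fun _ _ => c) := by
  refine ⟨hU, fun i => contDiffOn_const, fun k _ => ?_⟩
  rcases k with _ | k
  · exact ⟨‖c‖, by simp⟩
  · exact ⟨0, fun i x _ => by rw [iteratedFDeriv_const_of_ne (by omega)]; simp⟩

theorem add (hf : UnifSmooth n U f) (hg : UnifSmooth n U g) :
    UnifSmooth n U (fun i x => f i x + g i x) := by
  refine of_within hf.isOpen (fun i => (hf.contDiffOn i).add (hg.contDiffOn i)) fun k hk => ?_
  obtain ⟨C, -, hC⟩ := hf.within_bound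
  obtain ⟨D, -, hD⟩ := hg.within_bound
  refine ⟨C + D, fun i x hx => ?_⟩
  have hk' : (k : ℕ∞ω) ≤ n := by exact_mod_cast hk
  have := iteratedFDerivWithin_add_apply (i := k) (((hf.contDiffOn i) x hx).of_le hk')
    (((hg.contDiffOn i) x hx).of_le hk') (hf.isOpen i).uniqueDiffOn hx
  rw [show (fun x => f i x + g i x) = f i + g i from rfl, this]
  exact (norm_add_le _ _).trans (add_le_add (hC k hk i x hx) (hD k hk i x hx))

theorem sum {α : Type*} (s : Finset α) {f : α → ι → E → F} (hU : ∀ i, IsOpen (U i))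
    (h : ∀ a ∈ s, UnifSmooth n U (f a)) : UnifSmooth n U (fun i x => ∑ a ∈ s, f a i x) := by
  classical
  induction s using Finset.induction_on with
  | empty => simpa using const hU 0
  | insert a s ha ih =>
    simp only [Finset.sum_insert ha]
    exact (h a (Finset.mem_insert_self _ _)).add
      (ih fun b hb => h b (Finset.mem_insert_of_mem hb))

theorem clm_comp (L : F →L[ℝ] G) (hf : UnifSmooth n U f) :
    UnifSmooth n U (fun i x => L (f i x)) := by
  refine of_within hf.isOpen (fun i => L.contDiff.comp_contDiffOn (hf.contDiffOn i))
    fun k hk => ?_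
  obtain ⟨C, -, hC⟩ := hf.within_bound
  refine ⟨‖L‖ * C, fun i x hx => ?_⟩
  have hk' : (k : ℕ∞ω) ≤ n := by exact_mod_cast hk
  exact (L.norm_iteratedFDerivWithin_comp_left ((hf.contDiffOn i) x hx)
    (hf.isOpen i).uniqueDiffOn hx hk').trans
      (mul_le_mul_of_nonneg_left (hC k hk i x hx) (norm_nonneg _))

theorem neg (hf : UnifSmooth n U f) : UnifSmooth n U (fun i x => -f i x) := by
  simpa using hf.clm_comp (-ContinuousLinearMap.id ℝ F)

theorem sub (hf : UnifSmooth n U f) (hg : UnifSmooth n U g) :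
    UnifSmooth n U (fun i x => f i x - g i x) := by
  simpa only [sub_eq_add_neg] using hf.add hg.neg

theorem prodMk {g : ι → E → G} (hf : UnifSmooth n U f) (hg : UnifSmooth n U g) :
    UnifSmooth n U (fun i x => (f i x, g i x)) := by
  simpa using (hf.clm_comp (ContinuousLinearMap.inl ℝ F G)).add
    (hg.clm_comp (ContinuousLinearMap.inr ℝ F G))

theorem fst {f : ι → E → F × G} (hf : UnifSmooth n U f) : UnifSmooth n U (fun i x => (f i x).1) :=
  hf.clm_comp (ContinuousLinearMap.fst ℝ F G)

theorem snd {f : ι → E → F × G} (hf : UnifSmooth n U f) : UnifSmooth n U (fun i x => (f i x).2) :=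
  hf.clm_comp (ContinuousLinearMap.snd ℝ F G)

theorem bilin (B : F →L[ℝ] G →L[ℝ] H) {g : ι → E → G} (hf : UnifSmooth n U f)
    (hg : UnifSmooth n U g) : UnifSmooth n U (fun i x => B (f i x) (g i x)) := by
  refine of_within hf.isOpen
    (fun i => B.isBoundedBilinearMap.contDiff.comp_contDiffOn
      ((hf.contDiffOn i).prodMk (hg.contDiffOn i))) fun k hk => ?_
  obtain ⟨C, hC0, hC⟩ := hf.within_bound
  obtain ⟨D, hD0, hD⟩ := hg.within_bound
  refine ⟨‖B‖ * ∑ j ∈ Finset.range (k + 1), (k.choose j : ℝ) * C * D, fun i x hx => ?_⟩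
  have hk' : (k : ℕ∞ω) ≤ n := by exact_mod_cast hk
  refine (B.norm_iteratedFDerivWithin_le_of_bilinear (hf.contDiffOn i) (hg.contDiffOn i)
    (hf.isOpen i).uniqueDiffOn hx hk').trans ?_
  gcongr with j hj
  · exact hC j (by have := Finset.mem_range.1 hj; omega) i x hx
  · exact hD (k - j) (by omega) i x hx

theorem mul {f g : ι → E → ℝ} (hf : UnifSmooth n U f) (hg : UnifSmooth n U g) :
    UnifSmooth n U (fun i x => f i x * g i x) :=
  hf.bilin (ContinuousLinearMap.mul ℝ ℝ) hg

theorem smul {c : ι → E → ℝ} (hc : UnifSmooth n U c) (hf : UnifSmooth n U f) :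
    UnifSmooth n U (fun i x => c i x • f i x) :=
  hc.bilin (ContinuousLinearMap.lsmul ℝ ℝ) hf

theorem clm_apply {A : ι → E → F →L[ℝ] G} (hA : UnifSmooth n U A) (hf : UnifSmooth n U f) :
    UnifSmooth n U (fun i x => A i x (f i x)) :=
  hA.bilin (ContinuousLinearMap.id ℝ (F →L[ℝ] G)) hf

theorem clm_comp_clm {A : ι → E → G →L[ℝ] H} {B : ι → E → F →L[ℝ] G} (hA : UnifSmooth n U A)
    (hB : UnifSmooth n U B) : UnifSmooth n U (fun i x => (A i x).comp (B i x)) :=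
  hA.bilin (ContinuousLinearMap.compL ℝ F G H) hB

theorem comp {V : ι → Set F} {g : ι → F → G} (hg : UnifSmooth n V g) (hf : UnifSmooth n U f)
    (hUV : ∀ i, MapsTo (f i) (U i) (V i)) : UnifSmooth n U (fun i x => g i (f i x)) := by
  refine of_within hf.isOpen (fun i => (hg.contDiffOn i).comp (hf.contDiffOn i) (hUV i))
    fun k hk => ?_
  obtain ⟨C, hC0, hC⟩ := hg.within_bound
  obtain ⟨D, hD0, hD⟩ := hf.within_bound
  -- The Faà di Bruno estimate asks for a bound of the form D ^ j on the j-th derivative, which max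
  -- 1 D provides for j ≥ 1.
  refine ⟨k.factorial * C * (max 1 D) ^ k, fun i x hx => ?_⟩
  have hk' : (k : ℕ∞ω) ≤ n := by exact_mod_cast hk
  refine norm_iteratedFDerivWithin_comp_le (hg.contDiffOn i) (hf.contDiffOn i) hk'
    (hg.isOpen i).uniqueDiffOn (hf.isOpen i).uniqueDiffOn (hUV i) hx
    (fun j hj => hC j (hj.trans hk) i _ (hUV i hx)) (fun j hj1 hj => ?_)
  calc _ ≤ max 1 D := (hD j (hj.trans hk) i x hx).trans (le_max_right _ _)
    _ ≤ max 1 D ^ j := le_self_pow₀ (le_max_left _ _) (by omega)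

theorem clm (L : E →L[ℝ] F) (hU : ∀ i, IsOpen (U i)) (hb : ∃ C, ∀ i, ∀ x ∈ U i, ‖L x‖ ≤ C) :
    UnifSmooth n U (fun _ x => L x) := by
  refine mono_n (n := n + 1) (succ hb (fun i x _ => L.differentiableAt) ?_) (Nat.le_succ n)
  exact (const hU L).congr fun i x _ => L.fderiv

/-- In finite dimensions an operator is a fixed linear combination of its values on a basis. Small
vectors suffice by scaling; in the applications v is confined to a ball because parameter domains
are bounded. -/
theorem of_clm_apply [FiniteDimensional ℝ F] {A : ι → E → F →L[ℝ] G} {r : ℝ} (hr : 0 < r)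
    (h : ∀ v : F, ‖v‖ < r → UnifSmooth n U (fun i x => A i x v)) (hU : ∀ i, IsOpen (U i)) :
    UnifSmooth n U A := by
  let b := Module.finBasis ℝ F
  have key : ∀ i x, A i x = ∑ j, (ContinuousLinearMap.smulRightL ℝ F G
      (LinearMap.toContinuousLinearMap (b.coord j))) (A i x (b j)) := by
    intro i x
    ext v
    have := congrArg (A i x) (b.sum_repr v)
    rw [map_sum] at this
    simp only [map_smul] at this
    simpa using this.symm
  have hb : ∀ v : F, UnifSmooth n U (fun i x => A i x v) := by
    intro v
    have hc : 0 < ‖v‖ + 1 := by positivity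
    have hs : ‖(r / (‖v‖ + 1)) • v‖ < r := by
      rw [norm_smul, Real.norm_of_nonneg (by positivity), div_mul_eq_mul_div, div_lt_iff₀ hc]
      nlinarith
    have := (h _ hs).clm_comp (((‖v‖ + 1) / r) • ContinuousLinearMap.id ℝ G)
    refine this.congr fun i x _ => ?_
    simp only [map_smul, smul_apply, ContinuousLinearMap.id_apply, smul_smul]
    rw [div_mul_div_comm, mul_comm, div_self (by positivity), one_smul]
  exact (sum Finset.univ hU fun j _ => (hb (b j)).clm_comp
    (ContinuousLinearMap.smulRightL ℝ F G (LinearMap.toContinuousLinearMap (b.coord j)))).congr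
      fun i x _ => key i x

end UnifSmooth

end UnifSmooth


/-! ### Ordinary differential equations -/

section ODE

universe u v

open Filter Topology

variable {E : Type u} [NormedAddCommGroup E] [NormedSpace ℝ E]
  {P : Type v} [NormedAddCommGroup P] [NormedSpace ℝ P]

/-- Glues solutions on an increasing sequence of intervals; compatibility comes from uniqueness. -/
theorem exists_eqOn_of_monotone {α β : Type*} (I : ℕ → Set α) (f : ℕ → α → β)
    (h : ∀ n m, n ≤ m → EqOn (f n) (f m) (I n)) : ∃ F : α → β, ∀ n, EqOn F (f n) (I n) := by
  classical
  refine ⟨fun x => if hx : ∃ n, x ∈ I n then f (Nat.find hx) x else f 0 x, fun n x hx => ?_⟩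
  have hx' : ∃ n, x ∈ I n := ⟨n, hx⟩
  simp only [hx', dif_pos]
  exact h _ _ (Nat.find_min' hx' hx) (Nat.find_spec hx')

/-- A bounded, Lipschitz vector field has integral curves on every compact interval. -/
theorem exists_integralCurve_of_bounded [CompleteSpace E] {f : ℝ → E → E} {a b t₀ : ℝ}
    (ht : t₀ ∈ Icc a b) (x₀ : E) {K : NNReal} {L : ℝ}
    (hL : ∀ t ∈ Icc a b, LipschitzWith K (f t))
    (hc : ∀ x, ContinuousOn (fun t => f t x) (Icc a b))
    (hb : ∀ t ∈ Icc a b, ∀ x, ‖f t x‖ ≤ L) :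
    ∃ γ : ℝ → E, γ t₀ = x₀ ∧ ∀ t ∈ Icc a b, HasDerivWithinAt γ (f t (γ t)) (Icc a b) t := by
  have hL0 : 0 ≤ L := (norm_nonneg _).trans (hb t₀ ht x₀)
  have hm : 0 ≤ max (b - t₀) (t₀ - a) := le_max_of_le_left (sub_nonneg.2 ht.2)
  have : IsPicardLindelof f (⟨t₀, ht⟩ : Icc a b) x₀
      ⟨L * max (b - t₀) (t₀ - a), mul_nonneg hL0 hm⟩ 0 ⟨L, hL0⟩ K :=
    ⟨fun t ht => (hL t ht).lipschitzOnWith, fun x _ => hc x, fun t ht x _ => hb t ht x,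
      by rw [NNReal.coe_zero, sub_zero]; exact le_rfl⟩
  exact this.exists_eq_forall_mem_Icc_hasDerivWithinAt₀

/-- A Grönwall estimate on `[0, 1)`. -/
theorem norm_le_of_norm_deriv_le {f f' : ℝ → E} {K ε δ : ℝ} (hK : 0 ≤ K) (hε : 0 ≤ ε)
    (hf : ∀ t ∈ Ico (0 : ℝ) 1, HasDerivWithinAt f (f' t) (Ico 0 1) t) (h0 : ‖f 0‖ ≤ δ)
    (bound : ∀ t ∈ Ico (0 : ℝ) 1, ‖f' t‖ ≤ K * ‖f t‖ + ε) :
    ∀ t ∈ Ico (0 : ℝ) 1, ‖f t‖ ≤ (δ + ε) * Real.exp K := by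
  intro t ht
  have hδ : 0 ≤ δ := (norm_nonneg _).trans h0
  have hsub : Icc 0 t ⊆ Ico (0 : ℝ) 1 := fun s hs => ⟨hs.1, hs.2.trans_lt ht.2⟩
  have hsub' : Ico 0 t ⊆ Ico (0 : ℝ) 1 := fun s hs => ⟨hs.1, hs.2.trans ht.2⟩
  have h1 := norm_le_gronwallBound_of_norm_deriv_right_le
    (fun s hs => ((hf s (hsub hs)).continuousWithinAt).mono hsub)
    (fun s hs => (hf s (hsub' hs)).mono_of_mem_nhdsWithin
      (mem_of_superset (Ico_mem_nhdsGE (hs.2.trans ht.2)) (Ico_subset_Ico_left hs.1)))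
    h0 (fun s hs => bound s (hsub' hs)) t ⟨ht.1, le_rfl⟩
  refine h1.trans ?_
  rw [sub_zero]
  have hexp : Real.exp (K * t) ≤ Real.exp K :=
    Real.exp_le_exp.2 (mul_le_of_le_one_right hK ht.2.le)
  rcases hK.eq_or_lt with rfl | hK
  · rw [gronwallBound_K0]
    simp only [Real.exp_zero, mul_one]
    nlinarith [ht.2]
  · rw [gronwallBound_of_K_ne_0 hK.ne']
    -- This cancels the factor 1 / K of the Grönwall bound, so that the final constant does not
    -- degenerate as K tends to 0.
    have h2 : Real.exp (K * t) - 1 ≤ K * Real.exp K := by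
      have h3 : 1 - K * t ≤ Real.exp (-(K * t)) := by
        have := Real.add_one_le_exp (-(K * t)); linarith
      have h4 : Real.exp (K * t) * Real.exp (-(K * t)) = 1 := by
        rw [← Real.exp_add]; simp
      have h5 : Real.exp (K * t) * (1 - K * t) ≤ 1 :=
        (mul_le_mul_of_nonneg_left h3 (Real.exp_pos _).le).trans_eq h4
      have h6 : K * t ≤ K := mul_le_of_le_one_right hK.le ht.2.le
      have h7 : Real.exp (K * t) * (K * t) ≤ Real.exp K * K :=
        mul_le_mul hexp h6 (mul_nonneg hK.le ht.1) (Real.exp_pos _).le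
      linarith
    calc δ * Real.exp (K * t) + ε / K * (Real.exp (K * t) - 1)
        ≤ δ * Real.exp K + ε / K * (K * Real.exp K) := by gcongr
      _ = (δ + ε) * Real.exp K := by field_simp

/-- Grönwall for the difference of two solutions: Lipschitz dependence on the initial value,
uniformly up to the end of the interval. -/
theorem eqOn_of_lipschitz_ode {U : Set E} {Φ : ℝ → E → E} {f g : ℝ → E} {K : ℝ} (hK : 0 ≤ K)
    (hL : ∀ t ∈ Ico (0 : ℝ) 1, ∀ x ∈ U, ∀ y ∈ U, ‖Φ t x - Φ t y‖ ≤ K * ‖x - y‖)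
    (hf : ∀ t ∈ Ico (0 : ℝ) 1, HasDerivWithinAt f (Φ t (f t)) (Ico 0 1) t)
    (hfU : ∀ t ∈ Ico (0 : ℝ) 1, f t ∈ U)
    (hg : ∀ t ∈ Ico (0 : ℝ) 1, HasDerivWithinAt g (Φ t (g t)) (Ico 0 1) t)
    (hgU : ∀ t ∈ Ico (0 : ℝ) 1, g t ∈ U) :
    ∀ t ∈ Ico (0 : ℝ) 1, ‖f t - g t‖ ≤ ‖f 0 - g 0‖ * Real.exp K := by
  intro t ht
  have := norm_le_of_norm_deriv_le (f := fun t => f t - g t) hK le_rfl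
    (fun t ht => (hf t ht).sub (hg t ht)) le_rfl
    (fun t ht => by simpa using hL t ht _ (hfU t ht) _ (hgU t ht)) t ht
  simpa using this

/-- The field is cut off outside a large ball to make it bounded, solved on an exhaustion of [0, 1),
and Grönwall then shows that the cut-off is never active. -/
theorem exists_linear_ode [FiniteDimensional ℝ E] {A : ℝ → E →L[ℝ] E} {K : ℝ}
    (hA : ContinuousOn A (Ico 0 1)) (hK : ∀ t ∈ Ico (0 : ℝ) 1, ‖A t‖ ≤ K) (x₀ : E) :
    ∃ f : ℝ → E, f 0 = x₀ ∧ ∀ t ∈ Ico (0 : ℝ) 1, HasDerivWithinAt f (A t (f t)) (Ico 0 1) t := by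
  have hK0 : 0 ≤ K := (norm_nonneg _).trans (hK 0 ⟨le_rfl, zero_lt_one⟩)
  have hKn : ∀ t ∈ Ico (0 : ℝ) 1, ‖A t‖₊ ≤ K.toNNReal := fun t ht => by
    rw [← NNReal.coe_le_coe, Real.coe_toNNReal _ hK0]; exact hK t ht
  -- Beyond the Grönwall bound for any solution starting at x₀.
  let R : ℝ := ‖x₀‖ * Real.exp K + 1
  have hR : 0 < R := by positivity
  let χ : ContDiffBump (0 : E) := ⟨R, R + 1, hR, by linarith⟩
  let h : E → E := fun x => χ x • x
  have hh : ContDiff ℝ 1 h := χ.contDiff.smul contDiff_id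
  have hcs : HasCompactSupport h := χ.hasCompactSupport.smul_right
  obtain ⟨C, hC⟩ := hh.lipschitzWith_of_hasCompactSupport hcs (by simp)
  obtain ⟨M, hM⟩ := hcs.exists_bound_of_continuous hh.continuous
  have hle : ∀ x, ‖h x‖ ≤ ‖x‖ := fun x => by
    simp only [h, norm_smul, Real.norm_of_nonneg χ.nonneg]
    exact mul_le_of_le_one_left (norm_nonneg _) χ.le_one
  let T : ℕ → ℝ := fun n => 1 - 1 / (n + 2)
  have hT0 : ∀ n, 0 ≤ T n := fun n => by
    have : (1 : ℝ) / (n + 2) ≤ 1 := by rw [div_le_one (by positivity)]; linarith [n.cast_nonneg (α := ℝ)]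
    simp only [T]; linarith
  have hT1 : ∀ n, T n < 1 := fun n => by
    have : (0 : ℝ) < 1 / (n + 2) := by positivity
    simp only [T]; linarith
  have hTm : ∀ n m, n ≤ m → T n ≤ T m := fun n m hnm => by
    have : (n : ℝ) ≤ m := by exact_mod_cast hnm
    simp only [T]; gcongr
  have hsub : ∀ n, Icc 0 (T n) ⊆ Ico 0 1 := fun n s hs => ⟨hs.1, hs.2.trans_lt (hT1 n)⟩
  have hsol : ∀ n : ℕ, ∃ f : ℝ → E, f 0 = x₀ ∧ ∀ t ∈ Icc 0 (T n),
      HasDerivWithinAt f (A t (h (f t))) (Icc 0 (T n)) t := fun n => by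
    refine exists_integralCurve_of_bounded (f := fun t x => A t (h x)) (K := K.toNNReal * C)
      (L := K * M) ⟨le_rfl, hT0 n⟩ x₀ (fun t ht => ?_) (fun x => ?_) (fun t ht x => ?_)
    · refine LipschitzWith.comp (g := h) (f := A t) ?_ hC
      exact (A t).lipschitz.weaken (hKn t (hsub n ht))
    · exact (hA.mono (hsub n)).clm_apply continuousOn_const
    · exact ((A t).le_opNorm _).trans
        (mul_le_mul (hK t (hsub n ht)) (hM x) (norm_nonneg _) hK0)
  choose f hf0 hf using hsol
  have hLip : ∀ t ∈ Ico (0 : ℝ) 1, LipschitzWith (K.toNNReal * C) (fun x => A t (h x)) :=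
    fun t ht => LipschitzWith.comp (g := h) (f := A t) ((A t).lipschitz.weaken (hKn t ht)) hC
  have hright : ∀ n, ∀ t ∈ Ico 0 (T n), HasDerivWithinAt (f n) (A t (h (f n t))) (Ici t) t :=
    fun n t ht => (hf n t ⟨ht.1, ht.2.le⟩).mono_of_mem_nhdsWithin
      (mem_of_superset (Icc_mem_nhdsGE ht.2) (Icc_subset_Icc_left ht.1))
  obtain ⟨F, hF⟩ := exists_eqOn_of_monotone (fun n => Icc 0 (T n)) f fun n m hnm t ht => by
    refine ODE_solution_unique_of_mem_Icc_right (v := fun t x => A t (h x)) (s := fun _ => univ)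
      (a := 0) (b := T n) (K := K.toNNReal * C)
      (fun t ht => (hLip t (hsub n ⟨ht.1, ht.2.le⟩)).lipschitzOnWith)
      (fun t ht => (hf n t ht).continuousWithinAt) (hright n) (fun _ _ => trivial)
      (fun t ht => ((hf m t ⟨ht.1, ht.2.trans (hTm n m hnm)⟩).continuousWithinAt).mono
        (Icc_subset_Icc_right (hTm n m hnm)))
      (fun t ht => hright m t ⟨ht.1, ht.2.trans_le (hTm n m hnm)⟩) (fun _ _ => trivial)
      ((hf0 n).trans (hf0 m).symm) ht
  have hF0 : F 0 = x₀ := (hF 0 ⟨le_rfl, hT0 0⟩).trans (hf0 0)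
  have hFd : ∀ t ∈ Ico (0 : ℝ) 1, HasDerivWithinAt F (A t (h (F t))) (Ico 0 1) t := by
    intro t ht
    obtain ⟨n, hn⟩ : ∃ n : ℕ, t < T n := by
      obtain ⟨n, hn⟩ := exists_nat_one_div_lt (sub_pos.2 ht.2)
      refine ⟨n, ?_⟩
      have : (1 : ℝ) / (n + 2) ≤ 1 / (n + 1) := by gcongr; norm_num
      simp only [T]; linarith
    have h1 := (hf n t ⟨ht.1, hn.le⟩).congr_of_mem (hF n) ⟨ht.1, hn.le⟩
    rw [← hF n ⟨ht.1, hn.le⟩] at h1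
    refine h1.mono_of_mem_nhdsWithin ?_
    rw [mem_nhdsWithin]
    exact ⟨Iio (T n), isOpen_Iio, hn, fun s hs => ⟨hs.2.1, hs.1.le⟩⟩
  refine ⟨F, hF0, fun t ht => ?_⟩
  have hbd := norm_le_of_norm_deriv_le hK0 le_rfl hFd le_rfl (fun t ht => by
    rw [add_zero]
    exact ((A t).le_opNorm _).trans (mul_le_mul (hK t ht) (hle _) (norm_nonneg _) hK0)) t ht
  have : h (F t) = F t := by
    have : χ (F t) = 1 := χ.one_of_mem_closedBall (by
      rw [mem_closedBall_zero_iff]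
      rw [hF0, add_zero] at hbd
      simp only [χ, R]; linarith)
    simp [h, this]
  simpa [this] using hFd t ht

end ODE


/-! ### Smooth dependence on parameters -/

section ODE

universe u v

open Filter Topology

variable {E : Type u} [NormedAddCommGroup E] [NormedSpace ℝ E]
  {P : Type v} [NormedAddCommGroup P] [NormedSpace ℝ P]

theorem norm_sub_le_of_fderiv_le {F : Type*} [NormedAddCommGroup F] [NormedSpace ℝ F]
    {U : Set E} (hU : Convex ℝ U) {f : E → F} {K : ℝ}
    (hf : ∀ x ∈ U, DifferentiableAt ℝ f x) (hK : ∀ x ∈ U, ‖fderiv ℝ f x‖ ≤ K)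
    {x y : E} (hx : x ∈ U) (hy : y ∈ U) : ‖f y - f x‖ ≤ K * ‖y - x‖ :=
  hU.norm_image_sub_le_of_norm_fderiv_le hf hK hx hy

/-- Mean value inequality for f minus its linearisation on the segment from x to y; on it Df differs
from Df(x) by at most K‖y - x‖. -/
theorem norm_taylor_le {F : Type*} [NormedAddCommGroup F] [NormedSpace ℝ F]
    {U : Set E} (hU : Convex ℝ U) {f : E → F} {K : ℝ}
    (hf : ∀ x ∈ U, DifferentiableAt ℝ f x) (hf' : ∀ x ∈ U, DifferentiableAt ℝ (fderiv ℝ f) x)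
    (hK : ∀ x ∈ U, ‖fderiv ℝ (fderiv ℝ f) x‖ ≤ K) {x y : E} (hx : x ∈ U) (hy : y ∈ U) :
    ‖f y - f x - fderiv ℝ f x (y - x)‖ ≤ K * ‖y - x‖ ^ 2 := by
  have hK0 : 0 ≤ K := (norm_nonneg (fderiv ℝ (fderiv ℝ f) x)).trans (hK x hx)
  have hseg : segment ℝ x y ⊆ U := hU.segment_subset hx hy
  have := (convex_segment x y).norm_image_sub_le_of_norm_hasFDerivWithin_le'
    (f := f) (f' := fderiv ℝ f) (φ := fderiv ℝ f x) (C := K * ‖y - x‖)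
    (fun z hz => (hf z (hseg hz)).hasFDerivAt.hasFDerivWithinAt) (fun z hz => ?_)
    (left_mem_segment ℝ x y) (right_mem_segment ℝ x y)
  · rwa [mul_assoc, ← pow_two] at this
  · refine (norm_sub_le_of_fderiv_le hU hf' hK hx (hseg hz)).trans ?_
    gcongr
    obtain ⟨a, ha, rfl⟩ := (segment_eq_image' ℝ x y) ▸ hz
    simp only [add_sub_cancel_left, norm_smul, Real.norm_of_nonneg ha.1]
    exact mul_le_of_le_one_left (norm_nonneg _) ha.2

/-- Differentiable dependence of the solutions of an ordinary differential equation on a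
parameter; the derivative solves the linearised equation. -/
theorem hasFDerivAt_of_ode {U : Set E} (hU : Convex ℝ U) {V : Set P} (hV : IsOpen V)
    {Ψ : ℝ → E → E} {W : ℝ → P → E} {L : ℝ → P →L[ℝ] E} {K M : ℝ}
    (hd : ∀ t ∈ Ico (0 : ℝ) 1, ∀ x ∈ U, DifferentiableAt ℝ (Ψ t) x)
    (hd' : ∀ t ∈ Ico (0 : ℝ) 1, ∀ x ∈ U, DifferentiableAt ℝ (fderiv ℝ (Ψ t)) x)
    (hK : ∀ t ∈ Ico (0 : ℝ) 1, ∀ x ∈ U, ‖fderiv ℝ (Ψ t) x‖ ≤ K)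
    (hM : ∀ t ∈ Ico (0 : ℝ) 1, ∀ x ∈ U, ‖fderiv ℝ (fderiv ℝ (Ψ t)) x‖ ≤ M)
    (hWU : ∀ p ∈ V, ∀ t ∈ Ico (0 : ℝ) 1, W t p ∈ U)
    (hW : ∀ p ∈ V, ∀ t ∈ Ico (0 : ℝ) 1,
      HasDerivWithinAt (fun s => W s p) (Ψ t (W t p)) (Ico 0 1) t)
    {p : P} (hp : p ∈ V) (hL0 : HasFDerivAt (W 0) (L 0) p)
    (hL : ∀ t ∈ Ico (0 : ℝ) 1,
      HasDerivWithinAt L ((fderiv ℝ (Ψ t) (W t p)).comp (L t)) (Ico 0 1) t) :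
    ∀ t ∈ Ico (0 : ℝ) 1, HasFDerivAt (W t) (L t) p := by
  intro t ht
  have h00 : (0 : ℝ) ∈ Ico (0 : ℝ) 1 := ⟨le_rfl, zero_lt_one⟩
  have hK0 : 0 ≤ K := (norm_nonneg _).trans (hK 0 h00 _ (hWU p hp 0 h00))
  have hM0 : 0 ≤ M := (norm_nonneg _).trans (hM 0 h00 _ (hWU p hp 0 h00))
  have hdist : ∀ q ∈ V, ∀ t ∈ Ico (0 : ℝ) 1,
      ‖W t q - W t p‖ ≤ ‖W 0 q - W 0 p‖ * Real.exp K := fun q hq =>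
    eqOn_of_lipschitz_ode hK0
      (fun t ht x hx y hy => norm_sub_le_of_fderiv_le hU (hd t ht) (hK t ht) hy hx)
      (hW q hq) (hWU q hq) (hW p hp) (hWU p hp)
  -- The Taylor remainder of W t satisfies the linearised equation up to an error M‖W t q - W t p‖²,
  -- which is quadratic in the initial difference; Grönwall then bounds it.
  have hrem : ∀ q ∈ V, ‖W t q - W t p - L t (q - p)‖ ≤
      (‖W 0 q - W 0 p - L 0 (q - p)‖ + M * (‖W 0 q - W 0 p‖ * Real.exp K) ^ 2) * Real.exp K := by
    intro q hq
    refine norm_le_of_norm_deriv_le (f := fun t => W t q - W t p - L t (q - p))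
      (f' := fun t => Ψ t (W t q) - Ψ t (W t p) - fderiv ℝ (Ψ t) (W t p) (L t (q - p)))
      hK0 (by positivity) (fun s hs => ?_) le_rfl (fun s hs => ?_) t ht
    · refine ((hW q hq s hs).sub (hW p hp s hs)).sub ?_
      exact (hL s hs).clm_apply (hasDerivWithinAt_const s _ (q - p)) |>.congr_deriv (by simp)
    · have h1 := norm_taylor_le hU (hd s hs) (hd' s hs) (hM s hs) (hWU p hp s hs) (hWU q hq s hs)
      have h2 := ((fderiv ℝ (Ψ s) (W s p)).le_opNorm (W s q - W s p - L s (q - p))).trans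
        (mul_le_mul_of_nonneg_right (hK s hs _ (hWU p hp s hs)) (norm_nonneg _))
      have h3 : M * ‖W s q - W s p‖ ^ 2 ≤ M * (‖W 0 q - W 0 p‖ * Real.exp K) ^ 2 := by
        gcongr; exact hdist q hq s hs
      calc _ = ‖(Ψ s (W s q) - Ψ s (W s p) - fderiv ℝ (Ψ s) (W s p) (W s q - W s p))
            + fderiv ℝ (Ψ s) (W s p) (W s q - W s p - L s (q - p))‖ := by
              congr 1; simp only [map_sub]; abel
        _ ≤ _ := by
              refine (norm_add_le _ _).trans ?_
              linarith
  rw [hasFDerivAt_iff_isLittleO]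
  have hO : (fun q => W 0 q - W 0 p) =O[𝓝 p] fun q => q - p := hL0.isBigO_sub
  have ho : (fun q => W 0 q - W 0 p - L 0 (q - p)) =o[𝓝 p] fun q => q - p :=
    hasFDerivAt_iff_isLittleO.1 hL0
  have hsq : (fun q => M * (‖W 0 q - W 0 p‖ * Real.exp K) ^ 2) =o[𝓝 p] fun q => q - p := by
    have h1 : (fun q => (‖W 0 q - W 0 p‖ * Real.exp K) ^ 2) =O[𝓝 p] fun q => ‖q - p‖ ^ 2 :=
      ((hO.norm_norm.mul (Asymptotics.isBigO_refl (fun _ => Real.exp K) _)).trans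
        (((Asymptotics.isBigO_refl (fun q => ‖q - p‖) _).const_mul_left (Real.exp K)).congr_left
          fun q => mul_comm _ _)).pow 2
    have h2 : (fun q => ‖q - p‖ ^ 2) =o[𝓝 p] fun q => ‖q - p‖ := by
      have h3 : Tendsto (fun q => ‖q - p‖) (𝓝 p) (𝓝 0) := by
        have : Continuous fun q => ‖q - p‖ := by fun_prop
        simpa using this.tendsto p
      exact (Asymptotics.isLittleO_pow_id one_lt_two).comp_tendsto h3
    exact ((h1.const_mul_left M).trans_isLittleO h2).of_norm_right
  have hsum : (fun q => (‖W 0 q - W 0 p - L 0 (q - p)‖ +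
      M * (‖W 0 q - W 0 p‖ * Real.exp K) ^ 2) * Real.exp K) =o[𝓝 p] fun q => q - p := by
    refine ((ho.norm_left.add hsq).const_mul_left (Real.exp K)).congr_left fun q => mul_comm _ _
  refine (Asymptotics.IsBigO.of_bound 1 ?_).trans_isLittleO hsum
  filter_upwards [hV.mem_nhds hp] with q hq
  rw [one_mul]
  exact (hrem q hq).trans (Real.le_norm_self _)

/-- Solutions of an ordinary differential equation on `[0, 1)` whose right hand side is uniformly
bounded with all its derivatives depend smoothly on parameters, with uniform bounds. -/
theorem unifSmooth_of_ode (n : ℕ) : ∀ {E : Type u} [NormedAddCommGroup E] [NormedSpace ℝ E]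
    [FiniteDimensional ℝ E] {P : Type v} [NormedAddCommGroup P] [NormedSpace ℝ P]
    [FiniteDimensional ℝ P] {U : Set E} {V : Set P} {Ψ : ℝ → E → E} {W : ℝ → P → E} {a : ℝ},
    a < 0 → IsOpen U → Convex ℝ U → Bornology.IsBounded U → IsOpen V → Bornology.IsBounded V →
    (∀ m, UnifSmooth m (fun _ : Ico (0 : ℝ) 1 => U) (fun t => Ψ t)) →
    ContDiffOn ℝ ∞ (fun z : ℝ × E => Ψ z.1 z.2) (Ioo a 1 ×ˢ U) →
    (∀ m, UnifSmooth m (fun _ : Unit => V) (fun _ => W 0)) →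
    (∀ p ∈ V, ∀ t ∈ Ico (0 : ℝ) 1, W t p ∈ U) →
    (∀ p ∈ V, ∀ t ∈ Ico (0 : ℝ) 1,
      HasDerivWithinAt (fun s => W s p) (Ψ t (W t p)) (Ico 0 1) t) →
    UnifSmooth n (fun _ : Ico (0 : ℝ) 1 => V) (fun t => W t) := by
  induction n with
  | zero =>
    intro E _ _ _ P _ _ _ U V Ψ W a ha hUo hUc hUb hVo hVb hΨ hΨs hW0 hWU hW
    obtain ⟨K, hK0, hK⟩ := (hΨ 1).norm_fderiv_le
    -- At order zero, continuity of W t follows from that of W 0 through the Lipschitz estimate.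
    have hLip : ∀ p ∈ V, ∀ q ∈ V, ∀ t ∈ Ico (0 : ℝ) 1,
        ‖W t q - W t p‖ ≤ ‖W 0 q - W 0 p‖ * Real.exp K := fun p hp q hq =>
      eqOn_of_lipschitz_ode hK0
        (fun t ht x hx y hy => norm_sub_le_of_fderiv_le hUc
          (fun z hz => (hΨ 1).differentiableAt (i := (⟨t, ht⟩ : Ico (0 : ℝ) 1)) hz)
          (fun z hz => hK ⟨t, ht⟩ z hz) hy hx)
        (hW q hq) (hWU q hq) (hW p hp) (hWU p hp)
    obtain ⟨R, hR⟩ := hUb.exists_norm_le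
    refine ⟨fun _ => hVo, fun t => ?_, fun k hk => ?_⟩
    · simp only [Nat.cast_zero]
      rw [contDiffOn_zero]
      intro p hp
      have hc : ContinuousWithinAt (W 0) V p := ((hW0 0).contDiffOn ()).continuousOn p hp
      rw [ContinuousWithinAt, tendsto_iff_norm_sub_tendsto_zero]
      have h0 : Tendsto (fun q => ‖W 0 q - W 0 p‖ * Real.exp K) (𝓝[V] p) (𝓝 0) := by
        simpa using (tendsto_iff_norm_sub_tendsto_zero.1 hc).mul_const (Real.exp K)
      refine squeeze_zero' (Eventually.of_forall fun _ => norm_nonneg _) ?_ h0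
      filter_upwards [self_mem_nhdsWithin] with q hq
      exact hLip p hp q hq t t.2
    · obtain rfl : k = 0 := by omega
      exact ⟨R, fun t x hx => by simpa using hR _ (hWU x hx t t.2)⟩
  | succ n ih =>
    intro E _ _ _ P _ _ _ U V Ψ W a ha hUo hUc hUb hVo hVb hΨ hΨs hW0 hWU hW
    obtain ⟨K, hK0, hK⟩ := (hΨ 1).norm_fderiv_le
    obtain ⟨M, hM0, hM⟩ := ((hΨ 2).fderiv).norm_fderiv_le
    obtain ⟨C, hC0, hC⟩ := (hW0 1).norm_fderiv_le
    obtain ⟨R, hR⟩ := hUb.exists_norm_le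
    have hd : ∀ t ∈ Ico (0 : ℝ) 1, ∀ x ∈ U, DifferentiableAt ℝ (Ψ t) x := fun t ht x hx =>
      (hΨ 1).differentiableAt (i := (⟨t, ht⟩ : Ico (0 : ℝ) 1)) hx
    have hd' : ∀ t ∈ Ico (0 : ℝ) 1, ∀ x ∈ U, DifferentiableAt ℝ (fderiv ℝ (Ψ t)) x :=
      fun t ht x hx => (hΨ 2).fderiv.differentiableAt (i := (⟨t, ht⟩ : Ico (0 : ℝ) 1)) hx
    have hO : IsOpen (Ioo a 1 ×ˢ U) := isOpen_Ioo.prod hUo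
    have hI : ∀ t ∈ Ico (0 : ℝ) 1, t ∈ Ioo a 1 := fun t ht => ⟨ha.trans_le ht.1, ht.2⟩
    have hpart : ∀ t ∈ Ioo a 1, ∀ x ∈ U, fderiv ℝ (Ψ t) x =
        (fderiv ℝ (fun z : ℝ × E => Ψ z.1 z.2) (t, x)).comp (ContinuousLinearMap.inr ℝ ℝ E) := by
      intro t ht x hx
      have h1 : HasFDerivAt (fun z : ℝ × E => Ψ z.1 z.2)
          (fderiv ℝ (fun z : ℝ × E => Ψ z.1 z.2) (t, x)) (t, x) :=
        ((hΨs.contDiffAt (hO.mem_nhds ⟨ht, hx⟩)).differentiableAt (by simp)).hasFDerivAt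
      exact (h1.comp x (hasFDerivAt_prodMk_right t x)).fderiv
    have hfs : ContDiffOn ℝ ∞ (fderiv ℝ (fun z : ℝ × E => Ψ z.1 z.2)) (Ioo a 1 ×ˢ U) :=
      hΨs.fderiv_of_isOpen hO (by simp)
    -- The candidate for the differential of W t: the solution of the variational equation with
    -- initial value DW 0.
    have hlin : ∀ p : P, ∃ L : ℝ → P →L[ℝ] E, p ∈ V → L 0 = fderiv ℝ (W 0) p ∧
        ∀ t ∈ Ico (0 : ℝ) 1,
          HasDerivWithinAt L ((fderiv ℝ (Ψ t) (W t p)).comp (L t)) (Ico 0 1) t := by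
      intro p
      by_cases hp : p ∈ V
      · obtain ⟨L, hL0, hL⟩ := exists_linear_ode (K := K)
          (A := fun t => ContinuousLinearMap.compL ℝ P E E (fderiv ℝ (Ψ t) (W t p)))
          (by
            refine (ContinuousLinearMap.compL ℝ P E E).continuous.comp_continuousOn ?_
            have hcW : ContinuousOn (fun t => W t p) (Ico 0 1) :=
              fun t ht => (hW p hp t ht).continuousWithinAt
            have h1 : ContinuousOn (fun t : ℝ =>
                (fderiv ℝ (fun z : ℝ × E => Ψ z.1 z.2) (t, W t p)).comp
                  (ContinuousLinearMap.inr ℝ ℝ E)) (Ico 0 1) :=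
              (hfs.continuousOn.comp (continuousOn_id.prodMk hcW)
                fun t ht => ⟨hI t ht, hWU p hp t ht⟩).clm_comp continuousOn_const
            exact h1.congr fun t ht => hpart t (hI t ht) _ (hWU p hp t ht))
          (fun t ht => by
            refine ContinuousLinearMap.opNorm_le_bound _ hK0 fun B => ?_
            exact (ContinuousLinearMap.opNorm_comp_le _ _).trans
              (mul_le_mul_of_nonneg_right (hK ⟨t, ht⟩ _ (hWU p hp t ht)) (norm_nonneg _)))
          (fderiv ℝ (W 0) p)
        exact ⟨L, fun _ => ⟨hL0, hL⟩⟩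
      · exact ⟨0, fun h => absurd h hp⟩
    choose L hL using hlin
    have hLd : ∀ p ∈ V, ∀ t ∈ Ico (0 : ℝ) 1, HasFDerivAt (W t) (L p t) p := fun p hp =>
      hasFDerivAt_of_ode hUc hVo hd hd' (fun t ht => hK ⟨t, ht⟩) (fun t ht => hM ⟨t, ht⟩) hWU hW hp
        ((hL p hp).1 ▸ ((hW0 1).differentiableAt (i := ()) hp).hasFDerivAt) (hL p hp).2
    have hLb : ∀ p ∈ V, ∀ t ∈ Ico (0 : ℝ) 1, ‖L p t‖ ≤ C * Real.exp K := fun p hp t ht => by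
      have := norm_le_of_norm_deriv_le (f := L p) (δ := C) hK0 le_rfl (hL p hp).2
        ((hL p hp).1 ▸ hC () p hp) (fun t ht => by
          rw [add_zero]
          exact (ContinuousLinearMap.opNorm_comp_le _ _).trans
            (mul_le_mul_of_nonneg_right (hK ⟨t, ht⟩ _ (hWU p hp t ht)) (norm_nonneg _))) t ht
      simpa using this
    -- Exceeds the Grönwall bound for the differential, so that DW t v stays in the open ball of
    -- radius B for ‖v‖ < 1.
    let B : ℝ := C * Real.exp K + 1
    have hB : 0 < B := by positivity
    let U' : Set (E × E) := U ×ˢ Metric.ball 0 B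
    let V' : Set (P × P) := V ×ˢ Metric.ball 0 1
    have hU'o : IsOpen U' := hUo.prod Metric.isOpen_ball
    have hV'o : IsOpen V' := hVo.prod Metric.isOpen_ball
    have hfst : ∀ m, UnifSmooth m (fun _ : Ico (0 : ℝ) 1 => U') (fun _ z => z.1) := fun m =>
      UnifSmooth.clm (ContinuousLinearMap.fst ℝ E E) (fun _ => hU'o) ⟨R, fun _ z hz => hR _ hz.1⟩
    have hsnd : ∀ m, UnifSmooth m (fun _ : Ico (0 : ℝ) 1 => U') (fun _ z => z.2) := fun m =>
      UnifSmooth.clm (ContinuousLinearMap.snd ℝ E E) (fun _ => hU'o)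
        ⟨B, fun _ z hz => (mem_ball_zero_iff.1 hz.2).le⟩
    obtain ⟨R', hR'⟩ := hVb.exists_norm_le
    have hfst' : ∀ m, UnifSmooth m (fun _ : Unit => V') (fun _ z => z.1) := fun m =>
      UnifSmooth.clm (ContinuousLinearMap.fst ℝ P P) (fun _ => hV'o) ⟨R', fun _ z hz => hR' _ hz.1⟩
    have hsnd' : ∀ m, UnifSmooth m (fun _ : Unit => V') (fun _ z => z.2) := fun m =>
      UnifSmooth.clm (ContinuousLinearMap.snd ℝ P P) (fun _ => hV'o)
        ⟨1, fun _ z hz => (mem_ball_zero_iff.1 hz.2).le⟩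
    -- The pair (W, DW v) solves the tangent system, which satisfies the same hypotheses on E × E
    -- with parameters in P × P. This is why the induction generalises over the spaces.
    have key := ih (U := U') (V := V') (Ψ := fun t z => (Ψ t z.1, fderiv ℝ (Ψ t) z.1 z.2))
      (W := fun t z => (W t z.1, fderiv ℝ (W t) z.1 z.2)) ha hU'o
      (hUc.prod (convex_ball _ _)) (hUb.prod Metric.isBounded_ball) hV'o
      (hVb.prod Metric.isBounded_ball)
      (fun m => ((hΨ m).comp (hfst m) fun _ z hz => hz.1).prodMk
        (((hΨ (m + 1)).fderiv.comp (hfst m) fun _ z hz => hz.1).clm_apply (hsnd m)))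
      (by
        have hm1 : MapsTo (fun z : ℝ × E × E => (z.1, z.2.1)) (Ioo a 1 ×ˢ U') (Ioo a 1 ×ˢ U) :=
          fun z hz => ⟨hz.1, hz.2.1⟩
        have hc1 : ContDiffOn ℝ ∞ (fun z : ℝ × E × E => (z.1, z.2.1)) (Ioo a 1 ×ˢ U') := by
          fun_prop
        refine (hΨs.comp hc1 hm1).prodMk ?_
        refine ((hfs.comp hc1 hm1).clm_apply
          (g := fun z : ℝ × E × E => ((0 : ℝ), z.2.2)) (by fun_prop)).congr fun z hz => ?_
        simp only [hpart z.1 hz.1 z.2.1 hz.2.1]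
        simp)
      (fun m => ((hW0 m).comp (hfst' m) fun _ z hz => hz.1).prodMk
        (((hW0 (m + 1)).fderiv.comp (hfst' m) fun _ z hz => hz.1).clm_apply (hsnd' m)))
      (fun z hz t ht => ⟨hWU _ hz.1 t ht, by
        rw [(hLd _ hz.1 t ht).fderiv, mem_ball_zero_iff]
        have h1 := (L z.1 t).le_opNorm z.2
        have h2 : ‖L z.1 t‖ * ‖z.2‖ ≤ C * Real.exp K * 1 :=
          mul_le_mul (hLb _ hz.1 t ht) (mem_ball_zero_iff.1 hz.2).le (norm_nonneg _)
            (by positivity)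
        simp only [B]; linarith⟩)
      (fun z hz t ht => by
        refine (hW _ hz.1 t ht).prodMk ?_
        have h1 := ((hL _ hz.1).2 t ht).clm_apply (hasDerivWithinAt_const t (Ico 0 1) z.2)
        simp only [ContinuousLinearMap.comp_apply, map_zero, add_zero] at h1
        rw [(hLd _ hz.1 t ht).fderiv]
        exact h1.congr_of_mem (fun s hs => by rw [(hLd _ hz.1 s hs).fderiv]) ht)
    refine UnifSmooth.succ ⟨R, fun t p hp => hR _ (hWU p hp t t.2)⟩
      (fun t p hp => (hLd p hp t t.2).differentiableAt) ?_
    refine UnifSmooth.of_clm_apply one_pos (fun v hv => ?_) fun _ => hVo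
    refine key.snd.comp (f := fun _ p => (p, v)) ?_ fun _ p hp => ⟨hp, by simpa using hv⟩
    exact (UnifSmooth.clm (ContinuousLinearMap.id ℝ P) (fun _ => hVo)
      ⟨R', fun _ p hp => hR' p hp⟩).prodMk (UnifSmooth.const (fun _ => hVo) v)

end ODE


/-! ### Inversion of perturbations of the identity -/

section Inverse

open Filter Topology

variable {ι E F : Type*} [NormedAddCommGroup E] [NormedSpace ℝ E] [NormedAddCommGroup F]
  [NormedSpace ℝ F] [CompleteSpace F]

/-- The derivative of B = A⁻¹ is -B A' B, so that a bound for B and the bounds for A give all higher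
bounds by induction. -/
theorem UnifSmooth.inverse {n : ℕ} {U : ι → Set E} {A B : ι → E → F →L[ℝ] F}
    (hA : UnifSmooth n U A) (hAB : ∀ i, ∀ x ∈ U i, A i x * B i x = 1)
    (hBA : ∀ i, ∀ x ∈ U i, B i x * A i x = 1) {C : ℝ} (hC : ∀ i, ∀ x ∈ U i, ‖B i x‖ ≤ C) :
    UnifSmooth n U B := by
  let u : ∀ i, ∀ x ∈ U i, (F →L[ℝ] F)ˣ := fun i x hx => ⟨A i x, B i x, hAB i x hx, hBA i x hx⟩
  have hinv : ∀ i, ∀ x ∈ U i, B i x = Ring.inverse (A i x) := fun i x hx =>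
    (Ring.inverse_unit (u i x hx)).symm
  induction n with
  | zero =>
    refine ⟨hA.isOpen, fun i => ?_, fun k hk => ?_⟩
    · simp only [Nat.cast_zero, contDiffOn_zero]
      refine ContinuousOn.congr (f := fun x => Ring.inverse (A i x)) (fun x hx => ?_) (hinv i)
      have h1 : ContinuousAt Ring.inverse (A i x) := NormedRing.inverse_continuousAt (u i x hx)
      exact h1.comp_continuousWithinAt ((hA.contDiffOn i).continuousOn x hx)
    · obtain rfl : k = 0 := by omega
      exact ⟨C, fun i x hx => by simpa using hC i x hx⟩
  | succ n ih =>
    have hd : ∀ i, ∀ x ∈ U i, HasFDerivAt (B i)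
        ((-(ContinuousLinearMap.compL ℝ F F F (B i x)).comp
          ((ContinuousLinearMap.compL ℝ F F F).flip (B i x))).comp
            (_root_.fderiv ℝ (A i) x)) x := by
      intro i x hx
      have h1 : HasFDerivAt (fun x => Ring.inverse (A i x))
          ((-ContinuousLinearMap.mulLeftRight ℝ (F →L[ℝ] F) (B i x) (B i x)).comp
            (_root_.fderiv ℝ (A i) x)) x :=
        HasFDerivAt.comp x (hasFDerivAt_ringInverse (𝕜 := ℝ) (u i x hx))
          (hA.differentiableAt hx).hasFDerivAt
      refine (h1.congr_fderiv ?_).congr_of_eventuallyEq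
        (eventuallyEq_of_mem ((hA.isOpen i).mem_nhds hx) (hinv i))
      ext v w
      simp
    have hB := ih (hA.mono_n n.le_succ)
    refine UnifSmooth.succ ⟨C, hC⟩ (fun i x hx => (hd i x hx).differentiableAt) ?_
    refine UnifSmooth.congr ?_ fun i x hx => (hd i x hx).fderiv
    exact (((hB.clm_comp (ContinuousLinearMap.compL ℝ F F F)).clm_comp_clm
      (hB.clm_comp (ContinuousLinearMap.compL ℝ F F F).flip)).neg).clm_comp_clm hA.fderiv

/-- Uniformly bounded perturbations of the identity with a small derivative are diffeomorphisms
onto their open ranges, with uniformly bounded inverses. -/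
theorem exists_unifSmooth_inverse {V : Set F} (hVo : IsOpen V) (hVc : Convex ℝ V)
    (hVb : Bornology.IsBounded V) {N : ι → F → F}
    (hN : ∀ n, UnifSmooth n (fun _ : ι => V) N)
    (hN' : ∀ i, ∀ x ∈ V, ‖fderiv ℝ (N i) x‖ ≤ 1 / 4) :
    ∃ K : ι → F → F, (∀ i, IsOpen ((fun x => x + N i x) '' V)) ∧
      (∀ i, ∀ x ∈ V, K i (x + N i x) = x) ∧
      ∀ n, UnifSmooth n (fun i => (fun x => x + N i x) '' V) K := by
  classical
  -- Convexity turns the bound 1/4 for DN into a Lipschitz bound, which makes the map injective with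
  -- open image.
  have happ : ∀ i, ApproximatesLinearOn (fun x => x + N i x)
      (ContinuousLinearEquiv.refl ℝ F : F →L[ℝ] F) V (1 / 4 : NNReal) := fun i => by
    intro x hx y hy
    have := norm_sub_le_of_fderiv_le hVc
      (fun z hz => (hN 1).differentiableAt (i := i) hz) (hN' i) hy hx
    simpa [add_sub_add_comm] using this
  have hlt : Subsingleton F ∨
      (1 / 4 : NNReal) < ‖((ContinuousLinearEquiv.refl ℝ F).symm : F →L[ℝ] F)‖₊⁻¹ := by
    rcases subsingleton_or_nontrivial F with h | h
    · exact Or.inl h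
    · right
      have : ‖((ContinuousLinearEquiv.refl ℝ F).symm : F →L[ℝ] F)‖₊ = 1 := by
        ext; simp
      rw [this, inv_one]
      norm_num [← NNReal.coe_lt_coe]
  let Θ : ι → OpenPartialHomeomorph F F := fun i =>
    (happ i).toOpenPartialHomeomorph (fun x => x + N i x) V hlt hVo
  have hleft : ∀ i, ∀ x ∈ V, (Θ i).symm (x + N i x) = x := fun i x hx =>
    (Θ i).left_inv (x := x) hx
  have hopen : ∀ i, IsOpen ((fun x => x + N i x) '' V) := fun i => (Θ i).open_target
  let u : ∀ i, ∀ x ∈ V, (F →L[ℝ] F)ˣ := fun i x hx =>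
    Units.oneSub (-fderiv ℝ (N i) x) (by rw [norm_neg]; linarith [hN' i x hx])
  have hu : ∀ i x (hx : x ∈ V), (u i x hx : F →L[ℝ] F) = 1 + fderiv ℝ (N i) x := fun i x hx => by
    simp [u]
  let A : ι → F → F →L[ℝ] F := fun i x => 1 + fderiv ℝ (N i) x
  let B : ι → F → F →L[ℝ] F := fun i x => Ring.inverse (A i x)
  have hB : ∀ i x (hx : x ∈ V), B i x = ↑(u i x hx)⁻¹ := fun i x hx => by
    simp only [B, A, ← hu i x hx, Ring.inverse_unit]
  have hAB : ∀ i, ∀ x ∈ V, A i x * B i x = 1 := fun i x hx => by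
    rw [hB i x hx]; simp only [A, ← hu i x hx, Units.mul_inv]
  have hBA : ∀ i, ∀ x ∈ V, B i x * A i x = 1 := fun i x hx => by
    rw [hB i x hx]; simp only [A, ← hu i x hx, Units.inv_mul]
  -- From B = 1 - DN B one gets ‖B‖ ≤ 1 + ‖B‖ / 4.
  have hBn : ∀ i, ∀ x ∈ V, ‖B i x‖ ≤ 2 := fun i x hx => by
    have h1 : B i x = 1 - fderiv ℝ (N i) x * B i x := by
      have := hAB i x hx
      simp only [A, add_mul, one_mul] at this
      exact eq_sub_of_add_eq this
    have h2 : ‖(1 : F →L[ℝ] F)‖ ≤ 1 := ContinuousLinearMap.norm_id_le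
    have h3 : ‖fderiv ℝ (N i) x * B i x‖ ≤ 1 / 4 * ‖B i x‖ :=
      (norm_mul_le _ _).trans (mul_le_mul_of_nonneg_right (hN' i x hx) (norm_nonneg _))
    have h4 : ‖B i x‖ ≤ ‖(1 : F →L[ℝ] F)‖ + ‖fderiv ℝ (N i) x * B i x‖ := by
      conv_lhs => rw [h1]
      exact norm_sub_le _ _
    linarith
  have hBU : ∀ n, UnifSmooth n (fun _ : ι => V) B := fun n =>
    ((UnifSmooth.const (fun _ => hVo) 1).add (hN (n + 1)).fderiv).inverse hAB hBA hBn
  have hder : ∀ i, ∀ x ∈ V, HasFDerivAt (fun x => x + N i x)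
      ((1 : F →L[ℝ] F) + fderiv ℝ (N i) x) x := fun i x hx =>
    (hasFDerivAt_id x).add ((hN 1).differentiableAt (i := i) hx).hasFDerivAt
  have hsymm : ∀ i, ∀ x ∈ V, HasFDerivAt (Θ i).symm (B i x) (x + N i x) := by
    intro i x hx
    have h1 : HasFDerivAt (Θ i) ((ContinuousLinearEquiv.unitsEquiv ℝ F (u i x hx) : F ≃L[ℝ] F) :
        F →L[ℝ] F) ((Θ i).symm (x + N i x)) := by
      rw [hleft i x hx]
      refine (hder i x hx).congr_fderiv ?_
      rw [← hu i x hx]; rfl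
    have := (Θ i).hasFDerivAt_symm (a := x + N i x) (mem_image_of_mem _ hx) h1
    rw [hB i x hx]
    exact this
  refine ⟨fun i => (Θ i).symm, hopen, hleft, fun n => ?_⟩
  obtain ⟨R, hR⟩ := hVb.exists_norm_le
  have hbd : ∃ C, ∀ i, ∀ z ∈ (fun x => x + N i x) '' V, ‖(Θ i).symm z‖ ≤ C := by
    refine ⟨R, ?_⟩
    rintro i z ⟨x, hx, rfl⟩
    simp only [hleft i x hx]
    exact hR x hx
  induction n with
  | zero =>
    refine ⟨hopen, fun i => ?_, fun k hk => ?_⟩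
    · simp only [Nat.cast_zero, contDiffOn_zero]
      exact (Θ i).continuousOn_symm
    · obtain rfl : k = 0 := by omega
      simpa using hbd
  | succ n ih =>
    refine UnifSmooth.succ hbd ?_ ?_
    · rintro i z ⟨x, hx, rfl⟩
      exact (hsymm i x hx).differentiableAt
    -- The derivative of the inverse is B composed with the inverse itself, so one order of
    -- smoothness yields the next.
    · refine ((hBU n).comp ih ?_).congr ?_
      · rintro i z ⟨x, hx, rfl⟩
        simpa only [hleft i x hx] using hx
      · rintro i z ⟨x, hx, rfl⟩
        simp only [hleft i x hx]
        exact (hsymm i x hx).fderiv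

end Inverse


/-! ### Symbol estimates in scaled variables -/

/-- The space of the scaled variables `(x, μ, y, ρ, ξ)`. -/
abbrev Scaled (d : ℕ) : Type := ℝ × ℝ × Base d × ℝ × Base d

/-- The map `((r, y, ρ, η), ε) ↦ (e^{-r}, ε e^{-r}, y, σ ρ, σ e^{-r} η)`. -/
noncomputable def scaling {d : ℕ} (σ : ℝ) (p : Phase d × ℝ) : Scaled d :=
  (Real.exp (-p.1.1), p.2 * Real.exp (-p.1.1), p.1.2.1, σ * p.1.2.2.1,
    (σ * Real.exp (-p.1.1)) • p.1.2.2.2)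

/-- The domain `0 < x < x₀`, `|μ| < 1`, `|y| < Y`, `|ρ - 1| < c`, `|ξ| < κ`. -/
def box (d : ℕ) (x₀ Y c κ : ℝ) : Set (Scaled d) :=
  Ioo 0 x₀ ×ˢ Ioo (-1) 1 ×ˢ Metric.ball 0 Y ×ˢ Metric.ball 1 c ×ˢ Metric.ball 0 κ

section Symbols

open Filter Topology

variable {d : ℕ} {x₀ Y c κ : ℝ}

theorem mem_box {q : Scaled d} : q ∈ box d x₀ Y c κ ↔ (0 < q.1 ∧ q.1 < x₀) ∧ |q.2.1| < 1 ∧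
    ‖q.2.2.1‖ < Y ∧ |q.2.2.2.1 - 1| < c ∧ ‖q.2.2.2.2‖ < κ := by
  simp only [box, mem_prod, mem_Ioo, abs_lt, Metric.mem_ball, Real.dist_eq, dist_zero_right]

theorem isOpen_box : IsOpen (box d x₀ Y c κ) :=
  isOpen_Ioo.prod (isOpen_Ioo.prod (Metric.isOpen_ball.prod
    (Metric.isOpen_ball.prod Metric.isOpen_ball)))

theorem convex_box : Convex ℝ (box d x₀ Y c κ) :=
  (convex_Ioo _ _).prod ((convex_Ioo _ _).prod ((convex_ball _ _).prod
    ((convex_ball _ _).prod (convex_ball _ _))))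

theorem isBounded_box : Bornology.IsBounded (box d x₀ Y c κ) :=
  (Metric.isBounded_Ioo _ _).prod ((Metric.isBounded_Ioo _ _).prod (Metric.isBounded_ball.prod
    (Metric.isBounded_ball.prod Metric.isBounded_ball)))

theorem contDiff_scaling (σ : ℝ) : ContDiff ℝ ∞ (scaling σ : Phase d × ℝ → Scaled d) := by
  unfold scaling
  fun_prop

theorem fderiv_scaling_apply (σ : ℝ) (p v : Phase d × ℝ) :
    fderiv ℝ (scaling σ) p v = (-(Real.exp (-p.1.1) * v.1.1),
      v.2 * Real.exp (-p.1.1) - p.2 * (Real.exp (-p.1.1) * v.1.1), v.1.2.1, σ * v.1.2.2.1,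
      (σ * Real.exp (-p.1.1)) • v.1.2.2.2
        - (σ * (Real.exp (-p.1.1) * v.1.1)) • p.1.2.2.2) := by
  have h1 : HasFDerivAt (scaling σ) (fderiv ℝ (scaling σ) p) p :=
    ((contDiff_scaling σ).differentiable (by simp) p).hasFDerivAt
  have hline : HasDerivAt (fun t : ℝ => p + t • v) v 0 := by
    simpa using ((hasDerivAt_id (0 : ℝ)).smul_const v).const_add p
  have h2 : HasDerivAt (fun t : ℝ => scaling σ (p + t • v)) (fderiv ℝ (scaling σ) p v) 0 :=
    HasFDerivAt.comp_hasDerivAt (x := (0 : ℝ)) (f := fun t : ℝ => p + t • v) (l := scaling σ)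
      (by simpa using h1) hline
  have hr : HasDerivAt (fun t : ℝ => Real.exp (-(p.1.1 + t * v.1.1)))
      (-(Real.exp (-p.1.1) * v.1.1)) 0 := by
    have := (((hasDerivAt_id (0 : ℝ)).mul_const v.1.1).const_add p.1.1).neg.exp
    simpa using this
  have he : HasDerivAt (fun t : ℝ => p.2 + t * v.2) v.2 0 := by
    simpa using ((hasDerivAt_id (0 : ℝ)).mul_const v.2).const_add p.2
  have hy : HasDerivAt (fun t : ℝ => p.1.2.1 + t • v.1.2.1) v.1.2.1 0 := by
    simpa using ((hasDerivAt_id (0 : ℝ)).smul_const v.1.2.1).const_add p.1.2.1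
  have hρ : HasDerivAt (fun t : ℝ => p.1.2.2.1 + t * v.1.2.2.1) v.1.2.2.1 0 := by
    simpa using ((hasDerivAt_id (0 : ℝ)).mul_const v.1.2.2.1).const_add p.1.2.2.1
  have hη : HasDerivAt (fun t : ℝ => p.1.2.2.2 + t • v.1.2.2.2) v.1.2.2.2 0 := by
    simpa using ((hasDerivAt_id (0 : ℝ)).smul_const v.1.2.2.2).const_add p.1.2.2.2
  have h3 := hr.prodMk ((he.mul hr).prodMk (hy.prodMk ((hρ.const_mul σ).prodMk
    ((hr.const_mul σ).smul hη))))
  have h4 := h2.unique h3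
  rw [h4]
  simp only [zero_mul, add_zero, zero_smul, mul_neg, neg_smul]
  refine Prod.ext rfl (Prod.ext ?_ (Prod.ext rfl (Prod.ext rfl ?_)))
  · simp only; ring
  · simp only; abel

variable {V : Type*} [NormedAddCommGroup V] [NormedSpace ℝ V]

/-- The functions `H s` vanish to the order `min b 2` at `ξ = 0`. -/
def VanishAt (x₀ Y c κ : ℝ) (b : ℕ) (H : ℝ → Scaled d → V) : Prop :=
  ∀ s, 0 ≤ s → ∀ q ∈ box d x₀ Y c κ, q.2.2.2.2 = 0 →
    (1 ≤ b → H s q = 0) ∧ (2 ≤ b → fderiv ℝ (H s) q = 0)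

/-- The functions `H s`, `s ≥ 0`, are smooth in the box with uniform bounds. -/
def UnifSmoothBox (x₀ Y c κ : ℝ) (H : ℝ → Scaled d → V) : Prop :=
  ∀ n, UnifSmooth n (fun _ : Ici (0 : ℝ) => box d x₀ Y c κ) (fun s => H s)

theorem UnifSmoothBox.differentiableAt {H : ℝ → Scaled d → V} (h : UnifSmoothBox x₀ Y c κ H)
    {s : ℝ} (hs : 0 ≤ s) {q : Scaled d} (hq : q ∈ box d x₀ Y c κ) : DifferentiableAt ℝ (H s) q :=
  (h 1).differentiableAt (i := (⟨s, hs⟩ : Ici (0 : ℝ))) hq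

/-- The line through q in the direction w stays in the slice ξ = 0 and, for short times, in the open
box; f vanishes along it. -/
theorem fderiv_apply_eq_zero {f : Scaled d → V}
    (hf : ∀ q ∈ box d x₀ Y c κ, q.2.2.2.2 = 0 → f q = 0) {q w : Scaled d}
    (hq : q ∈ box d x₀ Y c κ) (hq0 : q.2.2.2.2 = 0) (hw : w.2.2.2.2 = 0)
    (hd : DifferentiableAt ℝ f q) : fderiv ℝ f q w = 0 := by
  have hline : HasDerivAt (fun t : ℝ => q + t • w) w 0 := by
    simpa using ((hasDerivAt_id (0 : ℝ)).smul_const w).const_add q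
  have h2 : HasDerivAt (fun t : ℝ => f (q + t • w)) (fderiv ℝ f q w) 0 :=
    HasFDerivAt.comp_hasDerivAt (x := (0 : ℝ)) (f := fun t : ℝ => q + t • w)
      (by simpa using hd.hasFDerivAt) hline
  have h3 : (fun t : ℝ => f (q + t • w)) =ᶠ[𝓝 0] fun _ => 0 := by
    have h4 : ∀ᶠ t : ℝ in 𝓝 0, q + t • w ∈ box d x₀ Y c κ :=
      hline.continuousAt.eventually_mem (by simpa using isOpen_box.mem_nhds hq)
    filter_upwards [h4] with t ht
    exact hf _ ht (by simp [hq0, hw])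
  exact h2.unique ((hasDerivAt_const (0 : ℝ) (0 : V)).congr_of_eventuallyEq h3)

/-- A quadratic bound in the distance to the slice forces both the value and the differential to
vanish on it. -/
theorem UnifSmoothBox.vanishAt_two {H : ℝ → Scaled d → V} {C : ℝ}
    (hC : ∀ s, 0 ≤ s → ∀ q ∈ box d x₀ Y c κ, ‖H s q‖ ≤ C * ‖q.2.2.2.2‖ ^ 2) :
    VanishAt x₀ Y c κ 2 H := by
  intro s hs q hq hq0
  have h0 : H s q = 0 := by
    have := hC s hs q hq
    rw [hq0] at this
    simpa using this
  refine ⟨fun _ => h0, fun _ => HasFDerivAt.fderiv ?_⟩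
  rw [hasFDerivAt_iff_isLittleO]
  have h2 : (fun p => ‖p - q‖ ^ 2) =o[𝓝 q] fun p => p - q := by
    have h3 : Tendsto (fun p => ‖p - q‖) (𝓝 q) (𝓝 0) := by
      have : Continuous fun p => ‖p - q‖ := by fun_prop
      simpa using this.tendsto q
    exact ((Asymptotics.isLittleO_pow_id one_lt_two).comp_tendsto h3).of_norm_right
  refine (Asymptotics.IsBigO.of_bound |C| ?_).trans_isLittleO h2
  filter_upwards [isOpen_box.mem_nhds hq] with p hp
  rw [h0, sub_zero, zero_apply, sub_zero, norm_pow, norm_norm]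
  have h5 : ‖p.2.2.2.2‖ ≤ ‖p - q‖ := by
    have h6 : p.2.2.2.2 = (p - q).2.2.2.2 := by simp [hq0]
    rw [h6]
    exact (((norm_snd_le _).trans (norm_snd_le _)).trans (norm_snd_le _)).trans (norm_snd_le _)
  refine (hC s hs p hp).trans ((mul_le_mul_of_nonneg_right (le_abs_self C) (by positivity)).trans ?_)
  gcongr

/-- Affine vector fields A q + w cover both kinds of fields that arise from differentiating through
the scaling: constant ones and the radial one. -/
theorem UnifSmoothBox.dir {H : ℝ → Scaled d → V} (h : UnifSmoothBox x₀ Y c κ H)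
    (A : Scaled d →L[ℝ] Scaled d) (w : Scaled d) :
    UnifSmoothBox x₀ Y c κ (fun s q => fderiv ℝ (H s) q (A q + w)) := by
  intro n
  obtain ⟨R, hR⟩ := (isBounded_box (d := d) (x₀ := x₀) (Y := Y) (c := c) (κ := κ)).exists_norm_le
  refine (h (n + 1)).fderiv.clm_apply (UnifSmooth.add ?_ (UnifSmooth.const (fun _ => isOpen_box) w))
  exact UnifSmooth.clm A (fun _ => isOpen_box) ⟨‖A‖ * R, fun _ q hq =>
    (A.le_opNorm q).trans (mul_le_mul_of_nonneg_left (hR q hq) (norm_nonneg _))⟩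

theorem VanishAt.dir {H : ℝ → Scaled d → V} {b : ℕ} (hv : VanishAt x₀ Y c κ b H)
    (A : Scaled d →L[ℝ] Scaled d) (w : Scaled d) :
    VanishAt x₀ Y c κ (min (b - 1) 1) (fun s q => fderiv ℝ (H s) q (A q + w)) := by
  intro s hs q hq hq0
  refine ⟨fun hb => ?_, fun hb => by omega⟩
  simp only [(hv s hs q hq hq0).2 (by omega), zero_apply]

/-- Fields tangent to the slice ξ = 0 preserve the order of vanishing. For the differential, the
symmetry of the second derivative moves the tangent direction to the outside, where DH, which
vanishes on the slice, is differentiated along the slice. -/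
theorem VanishAt.dir_tangent {H : ℝ → Scaled d → V} {b : ℕ} (hv : VanishAt x₀ Y c κ b H)
    (h : UnifSmoothBox x₀ Y c κ H) {A : Scaled d →L[ℝ] Scaled d} {w : Scaled d}
    (hA : ∀ q : Scaled d, q.2.2.2.2 = 0 → (A q + w).2.2.2.2 = 0) :
    VanishAt x₀ Y c κ b (fun s q => fderiv ℝ (H s) q (A q + w)) := by
  intro s hs q hq hq0
  refine ⟨fun hb => fderiv_apply_eq_zero (fun p hp hp0 => (hv s hs p hp hp0).1 hb) hq hq0
    (hA q hq0) (h.differentiableAt hs hq), fun hb => ?_⟩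
  have hd : DifferentiableAt ℝ (fderiv ℝ (H s)) q :=
    (h 2).fderiv.differentiableAt (i := (⟨s, hs⟩ : Ici (0 : ℝ))) hq
  have h1 := hd.hasFDerivAt.clm_apply ((A.hasFDerivAt (x := q)).add_const w)
  refine h1.fderiv.trans ?_
  have hsymm : IsSymmSndFDerivAt ℝ (H s) q :=
    (((h 2).contDiffOn ⟨s, hs⟩).contDiffAt (isOpen_box.mem_nhds hq)).isSymmSndFDerivAt (by simp)
  have hz := fderiv_apply_eq_zero (fun p hp hp0 => (hv s hs p hp hp0).2 hb) hq hq0 (hA q hq0) hd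
  refine ContinuousLinearMap.ext fun v => ?_
  simp only [add_apply, ContinuousLinearMap.comp_apply, ContinuousLinearMap.flip_apply,
    (hv s hs q hq hq0).2 hb, zero_apply, zero_add]
  rw [hsymm.eq, hz, zero_apply]

theorem VanishAt.mono {H : ℝ → Scaled d → V} {b b' : ℕ} (hv : VanishAt x₀ Y c κ b H)
    (hb : b' ≤ b) : VanishAt x₀ Y c κ b' H := fun s hs q hq hq0 =>
  ⟨fun h => (hv s hs q hq hq0).1 (h.trans hb), fun h => (hv s hs q hq hq0).2 (h.trans hb)⟩

theorem UnifSmoothBox.smul_add_smul {H H' : ℝ → Scaled d → V} (a a' : ℝ)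
    (h : UnifSmoothBox x₀ Y c κ H) (h' : UnifSmoothBox x₀ Y c κ H') :
    UnifSmoothBox x₀ Y c κ (fun s q => a • H s q + a' • H' s q) := fun n =>
  ((h n).clm_comp (a • ContinuousLinearMap.id ℝ V)).add
    ((h' n).clm_comp (a' • ContinuousLinearMap.id ℝ V))

theorem VanishAt.smul_add_smul {H H' : ℝ → Scaled d → V} {b : ℕ} (a a' : ℝ)
    (h : UnifSmoothBox x₀ Y c κ H) (h' : UnifSmoothBox x₀ Y c κ H')
    (hv : VanishAt x₀ Y c κ b H) (hv' : VanishAt x₀ Y c κ b H') :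
    VanishAt x₀ Y c κ b (fun s q => a • H s q + a' • H' s q) := by
  intro s hs q hq hq0
  obtain ⟨h1, h2⟩ := hv s hs q hq hq0
  obtain ⟨h3, h4⟩ := hv' s hs q hq hq0
  refine ⟨fun hb => by simp [h1 hb, h3 hb], fun hb => ?_⟩
  refine (((h.differentiableAt hs hq).hasFDerivAt.const_smul a).add
    ((h'.differentiableAt hs hq).hasFDerivAt.const_smul a')).fderiv.trans ?_
  rw [h2 hb, h4 hb]
  simp

/-- The box is convex and contains with q its projection to ξ = 0, so the mean value inequality
applies on the segment between them. -/
theorem UnifSmoothBox.norm_le_of_vanishAt {H : ℝ → Scaled d → V} (h : UnifSmoothBox x₀ Y c κ H)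
    (hv : VanishAt x₀ Y c κ 1 H) :
    ∃ C, 0 ≤ C ∧ ∀ s, 0 ≤ s → ∀ q ∈ box d x₀ Y c κ, ‖H s q‖ ≤ C * ‖q.2.2.2.2‖ := by
  obtain ⟨C, hC0, hC⟩ := (h 1).norm_fderiv_le
  refine ⟨C, hC0, fun s hs q hq => ?_⟩
  let q' : Scaled d := (q.1, q.2.1, q.2.2.1, q.2.2.2.1, 0)
  have hq' : q' ∈ box d x₀ Y c κ := by
    rw [mem_box] at hq ⊢
    exact ⟨hq.1, hq.2.1, hq.2.2.1, hq.2.2.2.1, by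
      simpa [q'] using (norm_nonneg _).trans_lt hq.2.2.2.2⟩
  have h1 := norm_sub_le_of_fderiv_le convex_box (fun z hz => h.differentiableAt hs hz)
    (fun z hz => hC ⟨s, hs⟩ z hz) hq' hq
  rw [(hv s hs q' hq' rfl).1 le_rfl, sub_zero] at h1
  refine h1.trans_eq ?_
  congr 1
  simp [q', Prod.norm_def]

end Symbols


/-! ### Derivatives in the original variables of functions of the scaled variables -/

section Symbols

open Filter Topology

variable {d : ℕ} {x₀ Y c κ : ℝ} {V : Type*} [NormedAddCommGroup V] [NormedSpace ℝ V]

/-- The radial vector field `(x, μ, 0, 0, ξ)`. -/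
noncomputable def scaledRadial (d : ℕ) : Scaled d →L[ℝ] Scaled d :=
  (ContinuousLinearMap.fst ℝ ℝ _).prod
    (((ContinuousLinearMap.fst ℝ ℝ _).comp (ContinuousLinearMap.snd ℝ ℝ _)).prod
      ((0 : Scaled d →L[ℝ] Base d).prod ((0 : Scaled d →L[ℝ] ℝ).prod
        ((ContinuousLinearMap.snd ℝ ℝ _).comp ((ContinuousLinearMap.snd ℝ (Base d) _).comp
          ((ContinuousLinearMap.snd ℝ ℝ _).comp (ContinuousLinearMap.snd ℝ ℝ _)))))))

@[simp]
theorem scaledRadial_apply (q : Scaled d) :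
    scaledRadial d q = (q.1, q.2.1, 0, 0, q.2.2.2.2) := rfl

theorem fderiv_exp_smul_comp_scaling {σ : ℝ} {f : Scaled d → V} {p : Phase d × ℝ}
    (hf : DifferentiableAt ℝ f (scaling σ p)) (k : ℕ) (v : Phase d × ℝ) :
    fderiv ℝ (fun p : Phase d × ℝ => Real.exp (-(k : ℝ) * p.1.1) • f (scaling σ p)) p v =
      Real.exp (-(k : ℝ) * p.1.1) • (fderiv ℝ f (scaling σ p) (fderiv ℝ (scaling σ) p v)
        + (-(k * v.1.1)) • f (scaling σ p)) := by
  have h1 : HasFDerivAt (fun p : Phase d × ℝ => Real.exp (-(k : ℝ) * p.1.1))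
      (Real.exp (-(k : ℝ) * p.1.1) • (-(k : ℝ)) • (ContinuousLinearMap.fst ℝ ℝ _).comp
        (ContinuousLinearMap.fst ℝ (Phase d) ℝ)) p :=
    (((ContinuousLinearMap.fst ℝ ℝ _).comp
      (ContinuousLinearMap.fst ℝ (Phase d) ℝ)).hasFDerivAt.const_mul (-(k : ℝ))).exp
  have h2 := hf.hasFDerivAt.comp p
    ((contDiff_scaling σ).differentiable (by simp) p).hasFDerivAt
  have h3 := (h1.smul h2).fderiv
  have h4 := congrArg (fun L => L v) h3
  refine h4.trans ?_
  simp only [Function.comp_apply, add_apply, smul_apply, ContinuousLinearMap.comp_apply,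
    ContinuousLinearMap.smulRight_apply, ContinuousLinearMap.coe_fst',
    smul_eq_mul, smul_add, smul_smul]
  congr 2
  ring

/-- By the chain rule ∂_r becomes minus the radial field, with -k from the prefactor; ∂_y and ∂_ρ
become constant fields; ∂_ε and ∂_η become e^{-r} times constant fields. All but the one for η are
tangent to ξ = 0, hence only η-derivatives lower the order of vanishing. -/
theorem exists_deriv_symbol {σ : ℝ} {O : Set (Phase d × ℝ)}
    (hO : MapsTo (scaling σ) O (box d x₀ Y c κ)) {H : ℝ → Scaled d → V}
    (hH : UnifSmoothBox x₀ Y c κ H) {n : ℕ} (hv : VanishAt x₀ Y c κ (2 - n) H) (k : ℕ)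
    (a : Coord d) :
    ∃ H' : ℝ → Scaled d → V, UnifSmoothBox x₀ Y c κ H' ∧
      VanishAt x₀ Y c κ (2 - (n + a.etaDeg)) H' ∧ ∀ s, 0 ≤ s → ∀ p ∈ O,
      fderiv ℝ (fun p : Phase d × ℝ => Real.exp (-(k : ℝ) * p.1.1) • H s (scaling σ p)) p a.vec =
        Real.exp (-((k + a.epsDeg + a.etaDeg : ℕ) : ℝ) * p.1.1) • H' s (scaling σ p) := by
  have hexp : ∀ r : ℝ, Real.exp (-((k + 1 : ℕ) : ℝ) * r) =
      Real.exp (-(k : ℝ) * r) * Real.exp (-r) := fun r => by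
    rw [← Real.exp_add]; push_cast; ring_nf
  cases a with
  | r =>
    refine ⟨fun s q => (-1 : ℝ) • fderiv ℝ (H s) q (scaledRadial d q + 0) + (-(k : ℝ)) • H s q,
      (hH.dir (scaledRadial d) 0).smul_add_smul _ _ hH,
      VanishAt.smul_add_smul _ _ (hH.dir (scaledRadial d) 0) hH
        (hv.dir_tangent hH fun q hq => by simp [hq]) hv, fun s hs p hp => ?_⟩
    rw [fderiv_exp_smul_comp_scaling (hH.differentiableAt hs (hO hp)), fderiv_scaling_apply]
    simp only [Coord.vec, Coord.epsDeg, Coord.etaDeg, add_zero, mul_one, mul_zero, zero_mul,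
      smul_zero, zero_sub, scaledRadial_apply]
    rw [neg_one_smul, ← map_neg]
    congr 3
    simp [scaling]
  | y i =>
    refine ⟨fun s q => fderiv ℝ (H s) q ((0 : Scaled d →L[ℝ] Scaled d) q +
        (0, 0, EuclideanSpace.single i 1, 0, 0)), hH.dir 0 _,
      hv.dir_tangent hH fun q hq => by simp, fun s hs p hp => ?_⟩
    rw [fderiv_exp_smul_comp_scaling (hH.differentiableAt hs (hO hp)), fderiv_scaling_apply]
    simp [Coord.vec, Coord.epsDeg, Coord.etaDeg]
  | rho =>
    refine ⟨fun s q => fderiv ℝ (H s) q ((0 : Scaled d →L[ℝ] Scaled d) q +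
        (0, 0, 0, σ, 0)), hH.dir 0 _,
      hv.dir_tangent hH fun q hq => by simp, fun s hs p hp => ?_⟩
    rw [fderiv_exp_smul_comp_scaling (hH.differentiableAt hs (hO hp)), fderiv_scaling_apply]
    simp [Coord.vec, Coord.epsDeg, Coord.etaDeg]
  | eta i =>
    refine ⟨fun s q => fderiv ℝ (H s) q ((0 : Scaled d →L[ℝ] Scaled d) q +
        (0, 0, 0, 0, σ • EuclideanSpace.single i 1)), hH.dir 0 _,
      (hv.dir 0 _).mono (by simp only [Coord.etaDeg]; omega), fun s hs p hp => ?_⟩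
    rw [fderiv_exp_smul_comp_scaling (hH.differentiableAt hs (hO hp)), fderiv_scaling_apply]
    simp only [Coord.vec, Coord.epsDeg, Coord.etaDeg, add_zero, hexp, mul_smul, zero_apply,
      zero_add]
    congr 1
    rw [← map_smul]
    simp [smul_smul, mul_comm]
  | eps =>
    refine ⟨fun s q => fderiv ℝ (H s) q ((0 : Scaled d →L[ℝ] Scaled d) q +
        (0, 1, 0, 0, 0)), hH.dir 0 _,
      hv.dir_tangent hH fun q hq => by simp, fun s hs p hp => ?_⟩
    rw [fderiv_exp_smul_comp_scaling (hH.differentiableAt hs (hO hp)), fderiv_scaling_apply]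
    simp only [Coord.vec, Coord.epsDeg, Coord.etaDeg, add_zero, hexp, mul_smul, zero_apply,
      zero_add]
    congr 1
    rw [← map_smul]
    simp

/-- Iterates the first-order rule: each ε or η derivative contributes one power of e^{-r}, and the
remaining factor is again a uniformly smooth function in the box. -/
theorem exists_iteratedFDeriv_symbol {σ : ℝ} {O : Set (Phase d × ℝ)} (hOo : IsOpen O)
    (hO : MapsTo (scaling σ) O (box d x₀ Y c κ)) {H : ℝ → Scaled d → V}
    (hH : UnifSmoothBox x₀ Y c κ H) (hv : VanishAt x₀ Y c κ 2 H) (m : ℕ) (γ : Fin m → Coord d) :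
    ∃ H' : ℝ → Scaled d → V, UnifSmoothBox x₀ Y c κ H' ∧
      VanishAt x₀ Y c κ (2 - ∑ i, (γ i).etaDeg) H' ∧ ∀ s, 0 ≤ s → ∀ p ∈ O,
      iteratedFDeriv ℝ m (fun p => H s (scaling σ p)) p (fun i => (γ i).vec) =
        Real.exp (-((∑ i, (γ i).epsDeg + ∑ i, (γ i).etaDeg : ℕ) : ℝ) * p.1.1) •
          H' s (scaling σ p) := by
  induction m with
  | zero => exact ⟨H, hH, by simpa using hv, fun s _ p _ => by simp⟩
  | succ m ih =>
    obtain ⟨H', hH', hv', h⟩ := ih (Fin.tail γ)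
    obtain ⟨H'', hH'', hv'', h'⟩ := exists_deriv_symbol hO hH' hv'
      (∑ i, (Fin.tail γ i).epsDeg + ∑ i, (Fin.tail γ i).etaDeg) (γ 0)
    refine ⟨H'', hH'', ?_, fun s hs p hp => ?_⟩
    · rw [Fin.sum_univ_succ, add_comm]; exact hv''
    · rw [iteratedFDeriv_succ_apply_left]
      have hc : ContDiffAt ℝ ∞ (fun p => H s (scaling σ p)) p := by
        have h1 : ContDiffOn ℝ ∞ (H s) (box d x₀ Y c κ) :=
          contDiffOn_infty.2 fun n => (hH n).contDiffOn ⟨s, hs⟩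
        exact (h1.contDiffAt (isOpen_box.mem_nhds (hO hp))).comp p (contDiff_scaling σ).contDiffAt
      have hd : DifferentiableAt ℝ (iteratedFDeriv ℝ m (fun p => H s (scaling σ p))) p :=
        hc.differentiableAt_iteratedFDeriv (by exact_mod_cast WithTop.coe_lt_top _)
      have h2 : fderiv ℝ (fun p => iteratedFDeriv ℝ m (fun p => H s (scaling σ p)) p
          (fun i => (Fin.tail γ i).vec)) p (γ 0).vec =
          fderiv ℝ (iteratedFDeriv ℝ m (fun p => H s (scaling σ p))) p (γ 0).vec
            (fun i => (Fin.tail γ i).vec) := by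
        have := ((ContinuousMultilinearMap.apply ℝ (fun _ : Fin m => Phase d × ℝ) V
          (fun i => (Fin.tail γ i).vec)).hasFDerivAt.comp p hd.hasFDerivAt).fderiv
        exact congrArg (fun L => L (γ 0).vec) this
      have h3 : (fun p => iteratedFDeriv ℝ m (fun p => H s (scaling σ p)) p
          (fun i => (Fin.tail γ i).vec)) =ᶠ[𝓝 p] _ :=
        eventuallyEq_of_mem (hOo.mem_nhds hp) fun p hp => h s hs p hp
      rw [h3.fderiv_eq, h' s hs p hp] at h2
      refine h2.symm.trans ?_
      congr 3
      simp only [Fin.sum_univ_succ, Fin.tail]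
      push_cast
      ring

theorem ExpEstimates.congr {σ : ℝ} {D : Set (Phase d)} {F G : ℝ → Phase d × ℝ → V}
    (h : ExpEstimates σ D F) (hFG : ∀ t, 0 ≤ σ * t → ∀ p ∈ D ×ˢ Icc (0 : ℝ) 1, G t p = F t p) :
    ExpEstimates σ D G := by
  refine ⟨fun t ht => (h.1 t ht).congr (hFG t ht), fun m γ => ?_⟩
  obtain ⟨C, hC⟩ := h.2 m γ
  refine ⟨C, fun t ht ε hε r y ρ η hD => ?_⟩
  have : pderivWithin Coord.vec γ (G t) (D ×ˢ Icc 0 1) ((r, y, ρ, η), ε) =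
      pderivWithin Coord.vec γ (F t) (D ×ˢ Icc 0 1) ((r, y, ρ, η), ε) := by
    unfold pderivWithin
    rw [iteratedFDerivWithin_congr (hFG t ht) ⟨hD, hε⟩]
  rw [this]
  exact hC t ht ε hε r y ρ η hD

/-- For |β| ≤ 1 the remaining factor vanishes at ξ = 0 and is bounded by C|ξ| = C e^{-r}|η|. For |β|
≥ 2 it is merely bounded, but e^{-|β|r} ≤ e^{-2r}. The mapping property is asked for ε in an open
neighbourhood of [0, 1], so that one-sided derivatives are restrictions of ordinary ones. -/
theorem expEstimates_of_scaled {σ : ℝ} (hσ : |σ| = 1) {D : Set (Phase d)} (hD : IsOpen D)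
    (hmaps : MapsTo (scaling σ) (D ×ˢ Ioo (-1) 2) (box d x₀ Y c κ)) (hx₀ : x₀ ≤ 1)
    {H : ℝ → Scaled d → V} (hH : UnifSmoothBox x₀ Y c κ H) (hv : VanishAt x₀ Y c κ 2 H) :
    ExpEstimates σ D (fun t p => H (σ * t) (scaling σ p)) := by
  have hO : IsOpen (D ×ˢ Ioo (-1 : ℝ) 2) := hD.prod isOpen_Ioo
  have hsub : D ×ˢ Icc (0 : ℝ) 1 ⊆ D ×ˢ Ioo (-1 : ℝ) 2 :=
    prod_mono_right fun ε hε => ⟨by linarith [hε.1], by linarith [hε.2]⟩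
  have hcd : ∀ t, 0 ≤ σ * t →
      ContDiffOn ℝ ∞ (fun p => H (σ * t) (scaling σ p)) (D ×ˢ Ioo (-1 : ℝ) 2) := fun t ht =>
    (contDiffOn_infty.2 fun n => (hH n).contDiffOn ⟨σ * t, ht⟩).comp
      (contDiff_scaling σ).contDiffOn hmaps
  refine ⟨fun t ht => (hcd t ht).mono hsub, fun m γ => ?_⟩
  obtain ⟨H', hH', hv', h⟩ := exists_iteratedFDeriv_symbol hO hmaps hH hv m γ
  set β := ∑ i, (γ i).etaDeg with hβ
  obtain ⟨B, hB0, hB⟩ := (hH' 0).norm_le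
  have hvan : ∃ C, 0 ≤ C ∧ (β ≤ 1 →
      ∀ s, 0 ≤ s → ∀ q ∈ box d x₀ Y c κ, ‖H' s q‖ ≤ C * ‖q.2.2.2.2‖) := by
    by_cases hb : β ≤ 1
    · obtain ⟨C, hC0, hC⟩ := hH'.norm_le_of_vanishAt (hv'.mono (by omega))
      exact ⟨C, hC0, fun _ => hC⟩
    · exact ⟨0, le_rfl, fun h => absurd h hb⟩
  obtain ⟨C, hC0, hC⟩ := hvan
  refine ⟨C + B, fun t ht ε hε r y ρ η hmem => ?_⟩
  have hp : ((r, y, ρ, η), ε) ∈ D ×ˢ Icc (0 : ℝ) 1 := ⟨hmem, hε⟩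
  have huniq : UniqueDiffOn ℝ (D ×ˢ Icc (0 : ℝ) 1) :=
    hD.uniqueDiffOn.prod (uniqueDiffOn_Icc zero_lt_one)
  have hq := mem_box.1 (hmaps (hsub hp))
  simp only [scaling, norm_smul, norm_mul, Real.norm_eq_abs, hσ, one_mul, Real.abs_exp] at hq
  have hr1 : Real.exp (-r) ≤ 1 := hq.1.2.le.trans hx₀
  unfold pderivWithin
  rw [iteratedFDerivWithin_eq_iteratedFDeriv huniq
    (((hcd t ht).contDiffAt (hO.mem_nhds (hsub hp))).of_le (by exact_mod_cast le_top)) hp,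
    h _ ht _ (hsub hp), norm_smul, Real.norm_of_nonneg (Real.exp_pos _).le]
  set j := ∑ i, (γ i).epsDeg with hj
  have hsplit : Real.exp (-((j + β : ℕ) : ℝ) * r) =
      Real.exp (-(j : ℝ) * r) * Real.exp (-r) ^ β := by
    rw [← Real.exp_nat_mul, ← Real.exp_add]; push_cast; ring_nf
  have hsplit' : Real.exp (-((j : ℝ) + 1) * r) = Real.exp (-(j : ℝ) * r) * Real.exp (-r) := by
    rw [← Real.exp_add]; ring_nf
  have hx0 : 0 < Real.exp (-r) := Real.exp_pos _
  rw [hsplit, hsplit']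
  by_cases hb : β ≤ 1
  · rw [if_pos hb]
    have h1 := hC hb (σ * t) ht _ (hmaps (hsub hp))
    simp only [scaling, norm_smul, norm_mul, Real.norm_eq_abs, hσ, one_mul, Real.abs_exp] at h1
    have h2 : Real.exp (-r) ^ β ≤ 1 := pow_le_one₀ hx0.le hr1
    calc Real.exp (-(j : ℝ) * r) * Real.exp (-r) ^ β * ‖H' (σ * t) (scaling σ ((r, y, ρ, η), ε))‖
        ≤ Real.exp (-(j : ℝ) * r) * 1 * (C * (Real.exp (-r) * ‖η‖)) := by
          gcongr
          exact h1
      _ ≤ (C + B) * (Real.exp (-(j : ℝ) * r) * Real.exp (-r)) * ‖η‖ := by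
          have : 0 ≤ B * (Real.exp (-(j : ℝ) * r) * Real.exp (-r)) * ‖η‖ := by positivity
          nlinarith
  · rw [if_neg hb]
    have h1 := hB ⟨σ * t, ht⟩ _ (hmaps (hsub hp))
    have h2 : Real.exp (-r) ^ β ≤ Real.exp (-r) ^ 2 := pow_le_pow_of_le_one hx0.le hr1 (by omega)
    calc Real.exp (-(j : ℝ) * r) * Real.exp (-r) ^ β * ‖H' (σ * t) (scaling σ ((r, y, ρ, η), ε))‖
        ≤ Real.exp (-(j : ℝ) * r) * Real.exp (-r) ^ 2 * B := by
          gcongr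
      _ ≤ (C + B) * (Real.exp (-(j : ℝ) * r) * Real.exp (-r)) * (‖η‖ + Real.exp (-r)) := by
          have h3 : 0 ≤ (C + B) * (Real.exp (-(j : ℝ) * r) * Real.exp (-r)) * ‖η‖ := by positivity
          have h4 : 0 ≤ C * (Real.exp (-(j : ℝ) * r) * Real.exp (-r)) * Real.exp (-r) := by
            positivity
          nlinarith

end Symbols


/-! ### Global integral curves -/

section Global

open Filter Topology

variable {E : Type*} [NormedAddCommGroup E] [NormedSpace ℝ E] [FiniteDimensional ℝ E]

/-- On a compact interval both curves stay in a ball, where X is Lipschitz. -/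
theorem eqOn_of_integralCurve {X : E → E} (hX : ContDiff ℝ 1 X) {f g : ℝ → E} {a b t₀ : ℝ}
    (ht : t₀ ∈ Ioo a b) (hfc : ContinuousOn f (Icc a b))
    (hf : ∀ t ∈ Ioo a b, HasDerivAt f (X (f t)) t) (hgc : ContinuousOn g (Icc a b))
    (hg : ∀ t ∈ Ioo a b, HasDerivAt g (X (g t)) t) (h0 : f t₀ = g t₀) : EqOn f g (Icc a b) := by
  obtain ⟨R, hR⟩ := ((isCompact_Icc.image_of_continuousOn hfc).union
    (isCompact_Icc.image_of_continuousOn hgc)).isBounded.exists_norm_le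
  obtain ⟨K, hK⟩ := hX.contDiffOn.exists_lipschitzOnWith (s := Metric.closedBall (0 : E) R)
    (by simp) (convex_closedBall _ _) (isCompact_closedBall _ _)
  exact ODE_solution_unique_of_mem_Icc (v := fun _ => X) (s := fun _ => Metric.closedBall 0 R)
    (fun _ _ => hK) ht hfc hf
    (fun t ht => by simpa using hR _ (Or.inl (mem_image_of_mem f (Ioo_subset_Icc_self ht)))) hgc hg
    (fun t ht => by simpa using hR _ (Or.inr (mem_image_of_mem g (Ioo_subset_Icc_self ht)))) h0

/-- A vector field has global integral curves if all its cut-offs satisfy a priori bounds. -/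
theorem exists_global_integralCurve {X : E → E} (hX : ContDiff ℝ 1 X) (z : E)
    (hbd : ∀ T : ℝ, 0 < T → ∃ M, ∀ χ : E → ℝ, (∀ x, χ x ∈ Icc (0 : ℝ) 1) → ∀ γ : ℝ → E, γ 0 = z →
      (∀ t ∈ Icc (-T) T, HasDerivWithinAt γ (χ (γ t) • X (γ t)) (Icc (-T) T) t) →
      ∀ t ∈ Icc (-T) T, ‖γ t‖ ≤ M) :
    ∃ γ : ℝ → E, γ 0 = z ∧ ∀ t, HasDerivAt γ (X (γ t)) t := by
  have hsol : ∀ n : ℕ, ∃ γ : ℝ → E, γ 0 = z ∧ ∀ t ∈ Icc (-((n : ℝ) + 1)) (n + 1),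
      HasDerivWithinAt γ (X (γ t)) (Icc (-((n : ℝ) + 1)) (n + 1)) t := by
    intro n
    have hT : (0 : ℝ) < n + 1 := by positivity
    obtain ⟨M, hM⟩ := hbd _ hT
    have hR : 0 < |M| + 1 := by positivity
    -- Equal to 1 on a ball containing the a priori bound, so that the solution of the cut-off
    -- equation solves the original one.
    let χ : ContDiffBump (0 : E) := ⟨|M| + 1, |M| + 2, hR, by linarith⟩
    have hh : ContDiff ℝ 1 (fun x => χ x • X x) := χ.contDiff.smul hX
    have hcs : HasCompactSupport (fun x => χ x • X x) := χ.hasCompactSupport.smul_right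
    obtain ⟨C, hC⟩ := hh.lipschitzWith_of_hasCompactSupport hcs (by simp)
    obtain ⟨B, hB⟩ := hcs.exists_bound_of_continuous hh.continuous
    obtain ⟨γ, h0, hγ⟩ := exists_integralCurve_of_bounded (f := fun _ x => χ x • X x)
      (a := -((n : ℝ) + 1)) (b := n + 1) (t₀ := 0) ⟨by linarith, hT.le⟩ z (fun _ _ => hC)
      (fun _ => continuousOn_const) (fun _ _ => hB)
    refine ⟨γ, h0, fun t ht => ?_⟩
    have h1 := hM χ (fun x => ⟨χ.nonneg, χ.le_one⟩) γ h0 hγ t ht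
    have h2 : χ (γ t) = 1 := χ.one_of_mem_closedBall (by
      rw [mem_closedBall_zero_iff]
      simp only [χ]
      linarith [le_abs_self M])
    simpa [h2] using hγ t ht
  choose γ h0 hγ using hsol
  have hder : ∀ n : ℕ, ∀ t ∈ Ioo (-((n : ℝ) + 1)) (n + 1), HasDerivAt (γ n) (X (γ n t)) t :=
    fun n t ht => (hγ n t (Ioo_subset_Icc_self ht)).hasDerivAt (Icc_mem_nhds ht.1 ht.2)
  obtain ⟨Γ, hΓ⟩ := exists_eqOn_of_monotone
    (fun n : ℕ => Icc (-((n : ℝ) + 1)) (n + 1)) γ fun n m hnm => by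
      have hnm' : (n : ℝ) ≤ m := by exact_mod_cast hnm
      have hsub : Icc (-((n : ℝ) + 1)) (n + 1) ⊆ Icc (-((m : ℝ) + 1)) (m + 1) :=
        Icc_subset_Icc (by linarith) (by linarith)
      exact eqOn_of_integralCurve hX (t₀ := 0) ⟨by linarith [n.cast_nonneg (α := ℝ)], by positivity⟩
        (fun t ht => (hγ n t ht).continuousWithinAt) (hder n)
        (fun t ht => ((hγ m t (hsub ht)).continuousWithinAt).mono hsub)
        (fun t ht => hder m t ⟨by linarith [ht.1], by linarith [ht.2]⟩) ((h0 n).trans (h0 m).symm)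
  refine ⟨Γ, (hΓ 0 ⟨by norm_num, by norm_num⟩).trans (h0 0), fun t => ?_⟩
  obtain ⟨n, hn⟩ := exists_nat_gt |t|
  have ht : t ∈ Ioo (-((n : ℝ) + 1)) (n + 1) := by
    rw [mem_Ioo, ← abs_lt]; linarith
  have h1 : Γ =ᶠ[𝓝 t] γ n := eventuallyEq_of_mem (Icc_mem_nhds ht.1 ht.2) (hΓ n)
  rw [h1.eq_of_nhds]
  exact (hder n t ht).congr_of_eventuallyEq h1

end Global

/-! ### Hamiltonian vector fields -/

section Hamiltonian

open Filter Topology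

variable {d : ℕ}

/-- The inclusion of the `y`-space. -/
noncomputable def inclY (d : ℕ) : Base d →L[ℝ] Phase d :=
  (ContinuousLinearMap.inr ℝ ℝ _).comp (ContinuousLinearMap.inl ℝ (Base d) (ℝ × Base d))

/-- The inclusion of the `η`-space. -/
noncomputable def inclEta (d : ℕ) : Base d →L[ℝ] Phase d :=
  (ContinuousLinearMap.inr ℝ ℝ _).comp ((ContinuousLinearMap.inr ℝ (Base d) _).comp
    (ContinuousLinearMap.inr ℝ ℝ (Base d)))

@[simp] theorem inclY_apply (y : Base d) : inclY d y = (0, y, 0, 0) := rfl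

@[simp] theorem inclEta_apply (η : Base d) : inclEta d η = (0, 0, 0, η) := rfl

/-- The Hamiltonian vector field of a function on the phase space. -/
noncomputable def hamVF (P : Phase d → ℝ) (z : Phase d) : Phase d :=
  (fderiv ℝ P z (0, 0, 1, 0),
    (InnerProductSpace.toDual ℝ (Base d)).symm ((fderiv ℝ P z).comp (inclEta d)),
    -fderiv ℝ P z (1, 0, 0, 0),
    -(InnerProductSpace.toDual ℝ (Base d)).symm ((fderiv ℝ P z).comp (inclY d)))

/-- The pairing of the momenta of `z` with the positions of `w`. -/
noncomputable def pairing (z w : Phase d) : ℝ := z.2.2.1 * w.1 + ⟪z.2.2.2, w.2.1⟫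

theorem contDiff_hamVF {P : Phase d → ℝ} (hP : ContDiff ℝ ∞ P) : ContDiff ℝ ∞ (hamVF P) := by
  have h1 : ContDiff ℝ ∞ (fderiv ℝ P) := hP.fderiv_right (by simp)
  have h2 := (InnerProductSpace.toDual ℝ (Base d)).symm.contDiff (n := ∞)
  unfold hamVF
  exact (h1.clm_apply contDiff_const).prodMk ((h2.comp (h1.clm_comp contDiff_const)).prodMk
    ((h1.clm_apply contDiff_const).neg.prodMk (h2.comp (h1.clm_comp contDiff_const)).neg))

theorem clm_phase_apply (L : Phase d →L[ℝ] ℝ) (w : Phase d) : L w = w.1 * L (1, 0, 0, 0) +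
    L (0, w.2.1, 0, 0) + w.2.2.1 * L (0, 0, 1, 0) + L (0, 0, 0, w.2.2.2) := by
  have h : w = w.1 • ((1, 0, 0, 0) : Phase d) + (0, w.2.1, 0, 0) +
      w.2.2.1 • ((0, 0, 1, 0) : Phase d) + (0, 0, 0, w.2.2.2) := by
    ext <;> simp
  conv_lhs => rw [h]
  simp only [map_add, map_smul, smul_eq_mul]

/-- The left side is the symplectic form of X_P and w: the defining property of the Hamiltonian
vector field. -/
theorem pairing_hamVF_sub (P : Phase d → ℝ) (z w : Phase d) :
    pairing (hamVF P z) w - pairing w (hamVF P z) = -fderiv ℝ P z w := by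
  rw [clm_phase_apply (fderiv ℝ P z) w]
  simp only [pairing, hamVF, inner_neg_left, InnerProductSpace.toDual_symm_apply]
  rw [real_inner_comm, InnerProductSpace.toDual_symm_apply]
  simp only [ContinuousLinearMap.comp_apply, inclY_apply, inclEta_apply]
  ring

/-- Antisymmetry of the symplectic form: conservation of energy. -/
theorem fderiv_hamVF (P : Phase d → ℝ) (z : Phase d) : fderiv ℝ P z (hamVF P z) = 0 := by
  have := pairing_hamVF_sub P z (hamVF P z)
  linarith

theorem HasDerivAt.pairing {f g : ℝ → Phase d} {f' g' : Phase d} {t : ℝ} (hf : HasDerivAt f f' t)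
    (hg : HasDerivAt g g' t) :
    HasDerivAt (fun s => pairing (f s) (g s)) (pairing f' (g t) + pairing (f t) g') t := by
  have hf1 : HasDerivAt (fun s => (f s).2.2.1) f'.2.2.1 t := by
    simpa using hf.hasFDerivAt.snd.snd.fst.hasDerivAt
  have hf2 : HasDerivAt (fun s => (f s).2.2.2) f'.2.2.2 t := by
    simpa using hf.hasFDerivAt.snd.snd.snd.hasDerivAt
  have hg1 : HasDerivAt (fun s => (g s).1) g'.1 t := by
    simpa using hg.hasFDerivAt.fst.hasDerivAt
  have hg2 : HasDerivAt (fun s => (g s).2.1) g'.2.1 t := by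
    simpa using hg.hasFDerivAt.snd.fst.hasDerivAt
  refine ((hf1.mul hg1).add (hf2.inner ℝ hg2)).congr_deriv ?_
  simp only [HypEikonal.pairing]
  ring

theorem HasFDerivAt.pairing_apply {G : Type*} [NormedAddCommGroup G] [NormedSpace ℝ G]
    {f g : G → Phase d} {f' g' : G →L[ℝ] Phase d} {x : G} (hf : HasFDerivAt f f' x)
    (hg : HasFDerivAt g g' x) (v : G) :
    fderiv ℝ (fun s => pairing (f s) (g s)) x v = pairing (f' v) (g x) + pairing (f x) (g' v) := by
  have h1 := ((hf.snd.snd.fst).mul hg.fst).add ((hf.snd.snd.snd).inner ℝ hg.snd.fst)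
  have h2 := congrArg (fun L => L v) h1.fderiv
  refine h2.trans ?_
  simp only [pairing, add_apply, smul_apply, ContinuousLinearMap.comp_apply, smul_eq_mul,
    fderivInnerCLM_apply, ContinuousLinearMap.prod_apply, ContinuousLinearMap.coe_fst',
    ContinuousLinearMap.coe_snd']
  ring

theorem contDiff_pairing : ContDiff ℝ ∞ (fun p : Phase d × Phase d => pairing p.1 p.2) := by
  unfold pairing
  exact ((contDiff_fst.comp (contDiff_snd.comp (contDiff_snd.comp contDiff_fst))).mul
    (contDiff_fst.comp contDiff_snd)).add ((contDiff_snd.comp (contDiff_snd.comp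
    (contDiff_snd.comp contDiff_fst))).inner ℝ (contDiff_fst.comp (contDiff_snd.comp contDiff_snd)))

/-- For a Hamiltonian which is homogeneous of degree `2` in the momenta. -/
theorem pairing_hamVF_add {P : Phase d → ℝ} (hP : ContDiff ℝ ∞ P)
    (hE : ∀ z, pairing z (hamVF P z) = 2 * P z) (z w : Phase d) :
    -- This is the Lie derivative of the form ρ dr + η dy along X_P. Differentiating Euler's
    -- identity `hE` gives pairing w X_P + pairing z (DX_P w) = 2 dP w, and the symplectic identity
    -- exchanges the arguments of the first term at the cost of dP w.
    pairing (hamVF P z) w + pairing z (fderiv ℝ (hamVF P) z w) = fderiv ℝ P z w := by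
  have h1 := HasFDerivAt.pairing_apply (hasFDerivAt_id z)
    ((contDiff_hamVF hP).differentiable (by simp) z).hasFDerivAt w
  have h2 : fderiv ℝ (fun z => pairing (id z) (hamVF P z)) z w = 2 * fderiv ℝ P z w := by
    have h3 : (fun z => pairing (id z) (hamVF P z)) = fun z => 2 * P z := funext hE
    rw [h3, fderiv_const_mul (hP.differentiable (by simp) z)]
    simp
  have h3 := pairing_hamVF_sub P z w
  simp only [id] at h1 h2
  rw [h2] at h1
  simp only [ContinuousLinearMap.id_apply] at h1
  linarith

/-- The momenta of a homogeneous Hamiltonian flow `Z`, paired with its differential in the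
initial value `z`. -/
theorem pairing_fderiv_flow {P : Phase d → ℝ} (hP : ContDiff ℝ ∞ P)
    (hE : ∀ z, pairing z (hamVF P z) = 2 * P z) {I : Set ℝ} {O : Set (Phase d)} (hI : IsOpen I)
    (hIc : Convex ℝ I) (h0 : (0 : ℝ) ∈ I) (hO : IsOpen O) {Z : ℝ × Phase d → Phase d}
    (hZ : ContDiffOn ℝ ∞ Z (I ×ˢ O)) (hZ0 : ∀ z ∈ O, Z (0, z) = z)
    (hZt : ∀ t ∈ I, ∀ z ∈ O, fderiv ℝ Z (t, z) (1, 0) = hamVF P (Z (t, z))) :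
    (∀ t ∈ I, ∀ z ∈ O, P (Z (t, z)) = P z) ∧ ∀ t ∈ I, ∀ z ∈ O, ∀ δ : Phase d,
      pairing (Z (t, z)) (fderiv ℝ Z (t, z) (0, δ)) = pairing z δ + t * fderiv ℝ P z δ := by
  have hopen : IsOpen (I ×ˢ O) := hI.prod hO
  have hcd : ∀ t ∈ I, ∀ z ∈ O, ContDiffAt ℝ ∞ Z (t, z) := fun t ht z hz =>
    hZ.contDiffAt (hopen.mem_nhds ⟨ht, hz⟩)
  have hdiff : ∀ t ∈ I, ∀ z ∈ O, HasFDerivAt Z (fderiv ℝ Z (t, z)) (t, z) := fun t ht z hz =>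
    ((hcd t ht z hz).differentiableAt (by simp)).hasFDerivAt
  have hline : ∀ (t : ℝ) (z : Phase d), HasDerivAt (fun s : ℝ => (s, z)) (1, 0) t := fun t z =>
    (hasDerivAt_id t).prodMk (hasDerivAt_const t z)
  have hdt : ∀ t ∈ I, ∀ z ∈ O, HasDerivAt (fun s => Z (s, z)) (hamVF P (Z (t, z))) t := by
    intro t ht z hz
    rw [← hZt t ht z hz]
    exact (hdiff t ht z hz).comp_hasDerivAt t (hline t z)
  have hconst : ∀ {f f' : ℝ → ℝ}, (∀ t ∈ I, HasDerivAt f (f' t) t) → (∀ t ∈ I, f' t = 0) →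
      ∀ t ∈ I, f t = f 0 := by
    intro f f' hf hf' t ht
    refine hIc.is_const_of_fderivWithin_eq_zero (𝕜 := ℝ) (f := f)
      (fun s hs => (hf s hs).differentiableAt.differentiableWithinAt) (fun s hs => ?_) ht h0
    rw [((hf s hs).hasFDerivAt.hasFDerivWithinAt).fderivWithin (hI.uniqueDiffWithinAt hs), hf' s hs]
    exact ContinuousLinearMap.ext fun v => by simp
  have hcons : ∀ t ∈ I, ∀ z ∈ O, P (Z (t, z)) = P z := by
    intro t ht z hz
    rw [hconst (f := fun s => P (Z (s, z))) (f' := fun s => fderiv ℝ P (Z (s, z)) (hamVF P (Z (s, z))))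
      (fun s hs => ((hP.differentiable (by simp) _).hasFDerivAt).comp_hasDerivAt s (hdt s hs z hz))
      (fun s hs => fderiv_hamVF P _) t ht, hZ0 z hz]
  refine ⟨hcons, fun t ht z hz δ => ?_⟩
  -- The variational equation, by exchanging the time derivative with the derivative in the initial
  -- value.
  have hD : ∀ s ∈ I, HasDerivAt (fun s => fderiv ℝ Z (s, z) (0, δ))
      (fderiv ℝ (hamVF P) (Z (s, z)) (fderiv ℝ Z (s, z) (0, δ))) s := by
    intro s hs
    have h2 : DifferentiableAt ℝ (fderiv ℝ Z) (s, z) :=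
      ((hcd s hs z hz).fderiv_right (m := 1) (by norm_cast)).differentiableAt (by simp)
    have hsymm := (hcd s hs z hz).isSymmSndFDerivAt (by
      simp only [minSmoothness_of_isRCLikeNormedField]; exact WithTop.coe_le_coe.2 le_top)
    have h3 : HasDerivAt (fun s => fderiv ℝ Z (s, z)) (fderiv ℝ (fderiv ℝ Z) (s, z) (1, 0)) s :=
      h2.hasFDerivAt.comp_hasDerivAt (l := fderiv ℝ Z) s (hline s z)
    have h4 := h3.clm_apply (hasDerivAt_const s ((0, δ) : ℝ × Phase d))
    simp only [map_zero, add_zero] at h4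
    refine h4.congr_deriv ?_
    rw [hsymm.eq (1, 0) (0, δ)]
    have h5 : HasFDerivAt (fun p => fderiv ℝ Z p (1, 0))
        ((fderiv ℝ (hamVF P) (Z (s, z))).comp (fderiv ℝ Z (s, z))) (s, z) := by
      refine HasFDerivAt.congr_of_eventuallyEq (f := fun p => hamVF P (Z p)) ?_ ?_
      · exact (((contDiff_hamVF hP).differentiable (by simp) _).hasFDerivAt).comp (s, z)
          (hdiff s hs z hz)
      · filter_upwards [hopen.mem_nhds ⟨hs, hz⟩] with p hp using hZt p.1 hp.1 p.2 hp.2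
    have h6 : HasFDerivAt (fun p => fderiv ℝ Z p (1, 0))
        ((ContinuousLinearMap.apply ℝ (Phase d) ((1, 0) : ℝ × Phase d)).comp
          (fderiv ℝ (fderiv ℝ Z) (s, z))) (s, z) :=
      (ContinuousLinearMap.apply ℝ (Phase d) ((1, 0) : ℝ × Phase d)).hasFDerivAt.comp (s, z)
        h2.hasFDerivAt
    exact congrArg (fun L => L ((0, δ) : ℝ × Phase d)) (h6.unique h5)
  have hDP : ∀ s ∈ I, fderiv ℝ P (Z (s, z)) (fderiv ℝ Z (s, z) (0, δ)) = fderiv ℝ P z δ := by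
    intro s hs
    have h1 : HasFDerivAt (fun w => P (Z (s, w))) (((fderiv ℝ P (Z (s, z))).comp
        (fderiv ℝ Z (s, z))).comp (ContinuousLinearMap.inr ℝ ℝ (Phase d))) z :=
      (((hP.differentiable (by simp) _).hasFDerivAt).comp (s, z) (hdiff s hs z hz)).comp z
        (hasFDerivAt_prodMk_right s z)
    have h2 : HasFDerivAt (fun w => P (Z (s, w))) (fderiv ℝ P z) z := by
      refine ((hP.differentiable (by simp) z).hasFDerivAt).congr_of_eventuallyEq ?_
      filter_upwards [hO.mem_nhds hz] with w hw using hcons s hs w hw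
    exact congrArg (fun L => L δ) (h1.unique h2)
  -- The derivative of the pairing along the flow is dP applied to the transported vector, which by
  -- conservation of energy is the constant dP z δ; hence the pairing grows linearly in s.
  have hα := hconst
    (f := fun s => pairing (Z (s, z)) (fderiv ℝ Z (s, z) (0, δ)) - s * fderiv ℝ P z δ)
    (fun s hs => (HasDerivAt.pairing (hdt s hs z hz) (hD s hs)).sub
      ((hasDerivAt_id s).mul_const _)) (fun s hs => by
        rw [pairing_hamVF_add hP hE, hDP s hs]; simp) t ht
  have h7 : fderiv ℝ Z (0, z) (0, δ) = δ := by
    have h1 : HasFDerivAt (fun w => Z (0, w)) ((fderiv ℝ Z (0, z)).comp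
        (ContinuousLinearMap.inr ℝ ℝ (Phase d))) z :=
      (hdiff 0 h0 z hz).comp z (hasFDerivAt_prodMk_right 0 z)
    have h2 : HasFDerivAt (fun w => Z (0, w)) (ContinuousLinearMap.id ℝ (Phase d)) z := by
      refine (hasFDerivAt_id z).congr_of_eventuallyEq ?_
      filter_upwards [hO.mem_nhds hz] with w hw using hZ0 w hw
    exact congrArg (fun L => L δ) (h1.unique h2)
  simp only [hZ0 z hz, h7] at hα
  linarith

/-- The differential of the generating function of a homogeneous Hamiltonian flow. -/
theorem hasFDerivAt_generating {P : Phase d → ℝ} (hP : ContDiff ℝ ∞ P)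
    (hE : ∀ z, pairing z (hamVF P z) = 2 * P z) {I : Set ℝ} {O : Set (Phase d)} (hI : IsOpen I)
    (hIc : Convex ℝ I) (h0 : (0 : ℝ) ∈ I) (hO : IsOpen O) {Z : ℝ × Phase d → Phase d}
    (hZ : ContDiffOn ℝ ∞ Z (I ×ˢ O)) (hZ0 : ∀ z ∈ O, Z (0, z) = z)
    (hZt : ∀ t ∈ I, ∀ z ∈ O, fderiv ℝ Z (t, z) (1, 0) = hamVF P (Z (t, z)))
    {t : ℝ} (ht : t ∈ I) {z : Phase d} (hz : z ∈ O) :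
    ∃ L : ℝ × Phase d →L[ℝ] ℝ,
      HasFDerivAt (fun p : ℝ × Phase d => pairing (Z p) (Z p) - p.1 * P p.2) L (t, z) ∧
      ∀ v, L v = pairing (fderiv ℝ Z (t, z) v) (Z (t, z)) + v.1 * P z + pairing z v.2 := by
  obtain ⟨hcons, hpair⟩ := pairing_fderiv_flow hP hE hI hIc h0 hO hZ hZ0 hZt
  have hd : HasFDerivAt Z (fderiv ℝ Z (t, z)) (t, z) :=
    ((hZ.contDiffAt ((hI.prod hO).mem_nhds ⟨ht, hz⟩)).differentiableAt (by simp)).hasFDerivAt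
  have h1 : DifferentiableAt ℝ (fun p : ℝ × Phase d => pairing (Z p) (Z p)) (t, z) :=
    (contDiff_pairing.differentiable (by simp) _).comp (t, z)
      (hd.differentiableAt.prodMk hd.differentiableAt)
  have h2 : HasFDerivAt (fun p : ℝ × Phase d => p.1 * P p.2) _ (t, z) :=
    hasFDerivAt_fst.mul (((hP.differentiable (by simp) z).hasFDerivAt).comp (t, z) hasFDerivAt_snd)
  refine ⟨_, h1.hasFDerivAt.sub h2, fun v => ?_⟩
  have h3 := HasFDerivAt.pairing_apply hd hd v
  have hv : v = v.1 • ((1, 0) : ℝ × Phase d) + (0, v.2) := by ext <;> simp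
  -- Time and space directions are separated. Euler's identity and conservation of energy give 2 P z
  -- for the first; in the second the term t dP will cancel against the differential of t P.
  have h4 : pairing (Z (t, z)) (fderiv ℝ Z (t, z) v) =
      v.1 * (2 * P z) + (pairing z v.2 + t * fderiv ℝ P z v.2) := by
    conv_lhs => rw [hv]
    rw [map_add, map_smul, hZt t ht z hz]
    have h5 : ∀ (a : ℝ) (x y w : Phase d), pairing x (a • y + w) = a * pairing x y + pairing x w := by
      intro a x y w
      simp only [pairing, Prod.smul_fst, Prod.smul_snd, Prod.fst_add, Prod.snd_add, inner_add_right,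
        inner_smul_right, smul_eq_mul]
      ring
    rw [h5, hE, hcons t ht z hz, hpair t ht z hz]
  simp only [sub_apply, h3, h4, add_apply, smul_apply, ContinuousLinearMap.comp_apply,
    ContinuousLinearMap.coe_fst', ContinuousLinearMap.coe_snd', smul_eq_mul]
  ring

end Hamiltonian


/-! ### The Hamiltonian p_ε and its global flow -/

section ConcreteHamiltonian

open Filter Topology

variable {d : ℕ} {g : Base d → QuadraticForm ℝ (Base d)}
  {gt : ℝ → Base d → QuadraticForm ℝ (Base d)}

/-- The Hamiltonian `p_ε` as a function on the phase space. -/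
noncomputable def phaseHam (g : Base d → QuadraticForm ℝ (Base d))
    (gt : ℝ → Base d → QuadraticForm ℝ (Base d)) (ε : ℝ) (z : Phase d) : ℝ :=
  ham g gt ε z.1 z.2.1 z.2.2.1 z.2.2.2

/-- The quadratic form `g_ε(r, y, ·)`. -/
noncomputable def formEps (g : Base d → QuadraticForm ℝ (Base d))
    (gt : ℝ → Base d → QuadraticForm ℝ (Base d)) (ε r : ℝ) (y : Base d) :
    QuadraticForm ℝ (Base d) :=
  g y + (ε * Real.exp (-r)) • gt (Real.exp (-r)) y

theorem formEps_apply (ε r : ℝ) (y η : Base d) : formEps g gt ε r y η = gEps g gt ε r y η := rfl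

theorem contDiff_phaseHam (hg : Admissible g gt) (ε : ℝ) : ContDiff ℝ ∞ (phaseHam g gt ε) := by
  have hm : ContDiff ℝ ∞ (fun z : Phase d => (Real.exp (-z.1), z.2.1, z.2.2.2)) := by fun_prop
  have hmaps : ∀ z : Phase d, (Real.exp (-z.1), z.2.1, z.2.2.2) ∈ Ici (0 : ℝ) ×ˢ univ :=
    fun z => ⟨(Real.exp_pos _).le, trivial⟩
  have h1 : ContDiff ℝ ∞ (fun z : Phase d => g z.2.1 z.2.2.2) :=
    hg.bounds_g.smooth.comp_contDiff hm hmaps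
  have h2 : ContDiff ℝ ∞ (fun z : Phase d => gt (Real.exp (-z.1)) z.2.1 z.2.2.2) :=
    hg.bounds_gt.smooth.comp_contDiff hm hmaps
  have h3 : ContDiff ℝ ∞ (fun z : Phase d => Real.exp (-2 * z.1)) := by fun_prop
  have h4 : ContDiff ℝ ∞ (fun z : Phase d => ε * Real.exp (-z.1)) := by fun_prop
  have h5 : ContDiff ℝ ∞ (fun z : Phase d => z.2.2.1 ^ 2) := by fun_prop
  exact h5.add (h3.mul (h1.add (h4.mul h2)))

theorem hamField_eq_hamVF (hg : Admissible g gt) (ε : ℝ) :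
    hamField g gt ε = hamVF (phaseHam g gt ε) := by
  funext z
  obtain ⟨r, y, ρ, η⟩ := z
  have hP : HasFDerivAt (phaseHam g gt ε) (fderiv ℝ (phaseHam g gt ε) (r, y, ρ, η)) (r, y, ρ, η) :=
    ((contDiff_phaseHam hg ε).differentiable (by simp) _).hasFDerivAt
  refine Prod.ext ?_ (Prod.ext ?_ (Prod.ext ?_ ?_))
  · refine HasDerivAt.deriv (hP.comp_hasDerivAt (l := phaseHam g gt ε) ρ
      (f := fun ρ' => (r, y, ρ', η)) ?_)
    exact (hasDerivAt_const ρ r).prodMk ((hasDerivAt_const ρ y).prodMk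
      ((hasDerivAt_id ρ).prodMk (hasDerivAt_const ρ η)))
  · refine congrArg (InnerProductSpace.toDual ℝ (Base d)).symm (HasFDerivAt.fderiv
      (f := fun η' => phaseHam g gt ε (r, y, ρ, η')) (hP.comp η (f := fun η' => (r, y, ρ, η')) ?_))
    exact ((inclEta d).hasFDerivAt.const_add ((r, y, ρ, 0) : Phase d)).congr_of_eventuallyEq
      (Eventually.of_forall fun w => by simp)
  · refine congrArg Neg.neg (HasDerivAt.deriv (hP.comp_hasDerivAt (l := phaseHam g gt ε) r
      (f := fun r' => (r', y, ρ, η)) ?_))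
    exact (hasDerivAt_id r).prodMk ((hasDerivAt_const r y).prodMk
      ((hasDerivAt_const r ρ).prodMk (hasDerivAt_const r η)))
  · refine congrArg Neg.neg (congrArg (InnerProductSpace.toDual ℝ (Base d)).symm (HasFDerivAt.fderiv
      (f := fun y' => phaseHam g gt ε (r, y', ρ, η)) (hP.comp y (f := fun y' => (r, y', ρ, η)) ?_)))
    exact ((inclY d).hasFDerivAt.const_add ((r, 0, ρ, η) : Phase d)).congr_of_eventuallyEq
      (Eventually.of_forall fun w => by simp)

/-- Euler's identity, from the derivative at 1 of the dilation of the momenta. -/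
theorem pairing_hamVF_phaseHam (hg : Admissible g gt) (ε : ℝ) (z : Phase d) :
    pairing z (hamVF (phaseHam g gt ε) z) = 2 * phaseHam g gt ε z := by
  have hP : HasFDerivAt (phaseHam g gt ε) (fderiv ℝ (phaseHam g gt ε) z) z :=
    ((contDiff_phaseHam hg ε).differentiable (by simp) _).hasFDerivAt
  obtain ⟨r, y, ρ, η⟩ := z
  have hl : HasDerivAt (fun s : ℝ => ((r, y, s * ρ, s • η) : Phase d)) (0, 0, ρ, η) 1 := by
    simpa using (hasDerivAt_const (1 : ℝ) r).prodMk ((hasDerivAt_const (1 : ℝ) y).prodMk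
      (((hasDerivAt_id (1 : ℝ)).mul_const ρ).prodMk ((hasDerivAt_id (1 : ℝ)).smul_const η)))
  have h1 : HasDerivAt (fun s : ℝ => phaseHam g gt ε (r, y, s * ρ, s • η))
      (fderiv ℝ (phaseHam g gt ε) (r, y, ρ, η) (0, 0, ρ, η)) 1 :=
    HasFDerivAt.comp_hasDerivAt (l := phaseHam g gt ε) (1 : ℝ) (by simpa using hP) hl
  have h2 : HasDerivAt (fun s : ℝ => phaseHam g gt ε (r, y, s * ρ, s • η))
      (2 * phaseHam g gt ε (r, y, ρ, η)) 1 := by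
    have h3 : (fun s : ℝ => phaseHam g gt ε (r, y, s * ρ, s • η)) =
        fun s => s ^ 2 * phaseHam g gt ε (r, y, ρ, η) := by
      funext s
      simp only [phaseHam, ham, gEps, QuadraticMap.map_smul, smul_eq_mul]
      ring
    rw [h3]
    simpa using ((hasDerivAt_id (1 : ℝ)).pow 2).mul_const (phaseHam g gt ε (r, y, ρ, η))
  have h3 := clm_phase_apply (fderiv ℝ (phaseHam g gt ε) (r, y, ρ, η)) (0, 0, ρ, η)
  rw [h1.unique h2] at h3
  simp only [pairing, hamVF]
  rw [real_inner_comm, InnerProductSpace.toDual_symm_apply]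
  simp only [ContinuousLinearMap.comp_apply, inclEta_apply]
  rw [h3]
  have h4 : ((0, (0 : Base d), (0 : ℝ), (0 : Base d)) : Phase d) = 0 := rfl
  simp [h4]

/-- Polarisation expresses the velocity of y by values of g_ε alone. It can then be bounded by
ellipticity for every r, whereas the symbol bounds concern only x ≤ 1, that is r ≥ 0. -/
theorem fderiv_phaseHam_eta (hg : Admissible g gt) (ε : ℝ) (z : Phase d) (ζ : Base d) :
    fderiv ℝ (phaseHam g gt ε) z (0, 0, 0, ζ) =
      Real.exp (-2 * z.1) * ((gEps g gt ε z.1 z.2.1 (z.2.2.2 + ζ)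
        - gEps g gt ε z.1 z.2.1 (z.2.2.2 - ζ)) / 2) := by
  have hP : HasFDerivAt (phaseHam g gt ε) (fderiv ℝ (phaseHam g gt ε) z) z :=
    ((contDiff_phaseHam hg ε).differentiable (by simp) _).hasFDerivAt
  obtain ⟨r, y, ρ, η⟩ := z
  have hl : HasDerivAt (fun s : ℝ => ((r, y, ρ, η + s • ζ) : Phase d)) (0, 0, 0, ζ) 0 := by
    simpa using (hasDerivAt_const (0 : ℝ) r).prodMk ((hasDerivAt_const (0 : ℝ) y).prodMk
      ((hasDerivAt_const (0 : ℝ) ρ).prodMk (((hasDerivAt_id (0 : ℝ)).smul_const ζ).const_add η)))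
  have h1 : HasDerivAt (fun s : ℝ => phaseHam g gt ε (r, y, ρ, η + s • ζ))
      (fderiv ℝ (phaseHam g gt ε) (r, y, ρ, η) (0, 0, 0, ζ)) 0 :=
    HasFDerivAt.comp_hasDerivAt (l := phaseHam g gt ε) (0 : ℝ) (by simpa using hP) hl
  refine h1.unique ?_
  have hpol : ∀ a b, formEps g gt ε r y (a + b) = formEps g gt ε r y a + formEps g gt ε r y b +
      QuadraticMap.polar (formEps g gt ε r y) a b := fun a b => by
    simp only [QuadraticMap.polar]; ring
  have h3 : (fun s : ℝ => phaseHam g gt ε (r, y, ρ, η + s • ζ)) =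
      fun s => ρ ^ 2 + Real.exp (-2 * r) * (formEps g gt ε r y η + s ^ 2 * formEps g gt ε r y ζ +
        s * QuadraticMap.polar (formEps g gt ε r y) η ζ) := by
    funext s
    simp only [phaseHam, ham]
    rw [← formEps_apply, hpol, QuadraticMap.map_smul, QuadraticMap.polar_smul_right]
    simp only [smul_eq_mul]
    ring
  have h4 : (gEps g gt ε r y (η + ζ) - gEps g gt ε r y (η - ζ)) / 2 =
      QuadraticMap.polar (formEps g gt ε r y) η ζ := by
    rw [← formEps_apply, ← formEps_apply, sub_eq_add_neg η ζ, hpol, hpol, QuadraticMap.map_neg,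
      QuadraticMap.polar_neg_right]
    ring
  rw [h3]
  simp only [h4]
  have h5 := ((((hasDerivAt_id (0 : ℝ)).pow 2).mul_const (formEps g gt ε r y ζ)).const_add
    (formEps g gt ε r y η)).add ((hasDerivAt_id (0 : ℝ)).mul_const
      (QuadraticMap.polar (formEps g gt ε r y) η ζ))
  refine ((h5.const_mul (Real.exp (-2 * r))).const_add (ρ ^ 2)).congr_deriv ?_
  simp

/-- The Hamiltonian flow is globally defined. -/
theorem exists_isHamFlow (hg : Admissible g gt) : ∃ φ, IsHamFlow g gt φ := by
  obtain ⟨C₀, hC₀, hell⟩ := hg.elliptic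
  have key : ∀ ε ∈ Icc (0 : ℝ) 1, ∀ z : Phase d, ∃ γ : ℝ → Phase d, γ 0 = z ∧
      ∀ t, HasDerivAt γ (hamField g gt ε (γ t)) t := by
    intro ε hε z
    rw [hamField_eq_hamVF hg]
    have hPs := contDiff_phaseHam hg ε
    refine exists_global_integralCurve ((contDiff_hamVF hPs).of_le (by simp)) z fun T hT => ?_
    have hnn : ∀ r y η, 0 ≤ gEps g gt ε r y η := fun r y η =>
      le_trans (by positivity) (hell ε hε r y η).1
    -- Since dp(X) = 0, the cut-off curves also conserve the energy E₀. This bounds |ρ| by E₀ + 1,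
    -- then |r| by R on [-T, T], then |η| by N through ellipticity, and finally the velocity of y by
    -- L. The summands 1 turn bounds for squares into bounds for the quantities.
    let E₀ := phaseHam g gt ε z
    have hE₀ : 0 ≤ E₀ := add_nonneg (sq_nonneg _) (mul_nonneg (Real.exp_pos _).le (hnn _ _ _))
    let R := |z.1| + 2 * (E₀ + 1) * T
    let N := C₀ * E₀ * Real.exp (2 * R) + 1
    let L := Real.exp (2 * R) * (C₀ * (N + 1) ^ 2)
    have hR : 0 ≤ R := by positivity
    have hN : 0 ≤ N := by positivity
    refine ⟨max R (max (‖z.2.1‖ + L * T) (max (E₀ + 1) N)), fun χ hχ γ h0 hγ => ?_⟩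
    have h0T : (0 : ℝ) ∈ Icc (-T) T := ⟨by linarith, hT.le⟩
    have mvt : ∀ {F : Type} [NormedAddCommGroup F] [NormedSpace ℝ F] (f f' : ℝ → F) (C : ℝ),
        0 ≤ C →
        (∀ t ∈ Icc (-T) T, HasDerivWithinAt f (f' t) (Icc (-T) T) t) →
        (∀ t ∈ Icc (-T) T, ‖f' t‖ ≤ C) → ∀ t ∈ Icc (-T) T, ‖f t‖ ≤ ‖f 0‖ + C * T := by
      intro F _ _ f f' C hC hf hb t ht
      have h1 := (convex_Icc (-T) T).norm_image_sub_le_of_norm_hasDerivWithin_le hf hb h0T ht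
      have h2 : ‖f t‖ ≤ ‖f 0‖ + ‖f t - f 0‖ := by
        simpa using norm_add_le (f 0) (f t - f 0)
      have h3 : ‖t - 0‖ ≤ T := by rw [sub_zero]; exact abs_le.2 ht
      have := mul_le_mul_of_nonneg_left h3 hC
      linarith
    have hcons : ∀ t ∈ Icc (-T) T, phaseHam g gt ε (γ t) = E₀ := by
      intro t ht
      have hd : ∀ t ∈ Icc (-T) T, HasDerivWithinAt (fun t => phaseHam g gt ε (γ t)) 0
          (Icc (-T) T) t := by
        intro t ht
        have h1 := ((hPs.differentiable (by simp) (γ t)).hasFDerivAt).comp_hasDerivWithinAt t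
          (hγ t ht)
        exact h1.congr_deriv (by simp [fderiv_hamVF])
      have h1 := (convex_Icc (-T) T).norm_image_sub_le_of_norm_hasDerivWithin_le hd
        (C := 0) (fun t _ => by simp) h0T ht
      rw [zero_mul] at h1
      have h2 := sub_eq_zero.1 (norm_le_zero_iff.1 h1)
      rw [h2, h0]
    have hρ : ∀ t ∈ Icc (-T) T, |(γ t).2.2.1| ≤ E₀ + 1 := by
      intro t ht
      have h1 : (γ t).2.2.1 ^ 2 ≤ E₀ := by
        rw [← hcons t ht]
        exact le_add_of_nonneg_right (mul_nonneg (Real.exp_pos _).le (hnn _ _ _))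
      exact abs_le.2 ⟨by nlinarith, by nlinarith⟩
    have hr : ∀ t ∈ Icc (-T) T, ‖(γ t).1‖ ≤ R := by
      intro t ht
      have h1 := mvt (fun t => (γ t).1) (fun t => χ (γ t) * (2 * (γ t).2.2.1)) (2 * (E₀ + 1))
        (by positivity) (fun t ht => ?_) (fun t ht => ?_) t ht
      · simpa [h0, R] using h1
      · have h2 := (ContinuousLinearMap.fst ℝ ℝ (Base d × ℝ × Base d)).hasFDerivAt
          |>.comp_hasDerivWithinAt t (hγ t ht)
        refine h2.congr_deriv ?_
        rw [← hamField_eq_hamVF hg]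
        simp only [ContinuousLinearMap.coe_fst', Prod.smul_fst, smul_eq_mul, hamField]
        congr 1
        simp only [ham]
        simp
      · rw [norm_mul, Real.norm_of_nonneg (hχ _).1, norm_mul, Real.norm_eq_abs, Real.norm_eq_abs,
          abs_two]
        exact (mul_le_of_le_one_left (by positivity) (hχ _).2).trans
          (mul_le_mul_of_nonneg_left (hρ t ht) zero_le_two)
    have hexp : ∀ t ∈ Icc (-T) T, Real.exp (2 * (γ t).1) ≤ Real.exp (2 * R) ∧
        Real.exp (-2 * (γ t).1) ≤ Real.exp (2 * R) := by
      intro t ht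
      have := abs_le.1 (hr t ht)
      exact ⟨Real.exp_le_exp.2 (by linarith), Real.exp_le_exp.2 (by linarith)⟩
    have hη : ∀ t ∈ Icc (-T) T, ‖(γ t).2.2.2‖ ≤ N := by
      intro t ht
      have h1 : Real.exp (-2 * (γ t).1) * (C₀⁻¹ * ‖(γ t).2.2.2‖ ^ 2) ≤ E₀ := by
        rw [← hcons t ht]
        exact (mul_le_mul_of_nonneg_left (hell ε hε _ _ _).1 (Real.exp_pos _).le).trans
          (le_add_of_nonneg_left (sq_nonneg _))
      have h2 : ‖(γ t).2.2.2‖ ^ 2 = C₀ * Real.exp (2 * (γ t).1) *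
          (Real.exp (-2 * (γ t).1) * (C₀⁻¹ * ‖(γ t).2.2.2‖ ^ 2)) := by
        have h3 : Real.exp (2 * (γ t).1) * Real.exp (-2 * (γ t).1) = 1 := by
          rw [← Real.exp_add]; simp
        have h4 : C₀ * C₀⁻¹ = 1 := mul_inv_cancel₀ hC₀.ne'
        linear_combination (-‖(γ t).2.2.2‖ ^ 2) * h4 - C₀ * C₀⁻¹ * ‖(γ t).2.2.2‖ ^ 2 * h3
      have h5 : ‖(γ t).2.2.2‖ ^ 2 ≤ C₀ * Real.exp (2 * R) * E₀ := by
        rw [h2]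
        have := (hexp t ht).1
        gcongr
      have h6 : N = C₀ * Real.exp (2 * R) * E₀ + 1 := by simp only [N]; ring
      nlinarith [norm_nonneg (γ t).2.2.2]
    have hy : ∀ t ∈ Icc (-T) T, ‖(γ t).2.1‖ ≤ ‖z.2.1‖ + L * T := by
      intro t ht
      have h1 := mvt (fun t => (γ t).2.1)
        (fun t => χ (γ t) • (hamVF (phaseHam g gt ε) (γ t)).2.1) L
        (by positivity) (fun t ht => ?_) (fun t ht => ?_) t ht
      · simpa [h0] using h1
      · exact ((ContinuousLinearMap.fst ℝ (Base d) (ℝ × Base d)).comp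
          (ContinuousLinearMap.snd ℝ ℝ (Base d × ℝ × Base d))).hasFDerivAt.comp_hasDerivWithinAt t
          (hγ t ht)
      · rw [norm_smul, Real.norm_of_nonneg (hχ _).1]
        refine (mul_le_of_le_one_left (norm_nonneg _) (hχ _).2).trans ?_
        simp only [hamVF, LinearIsometryEquiv.norm_map]
        refine ContinuousLinearMap.opNorm_le_of_unit_norm (by positivity) fun ζ hζ => ?_
        simp only [ContinuousLinearMap.comp_apply, inclEta_apply]
        rw [fderiv_phaseHam_eta hg, norm_mul, Real.norm_of_nonneg (Real.exp_pos _).le]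
        have hb : ∀ w : Base d, ‖w‖ ≤ N + 1 →
            gEps g gt ε (γ t).1 (γ t).2.1 w ∈ Icc 0 (C₀ * (N + 1) ^ 2) := fun w hw =>
          ⟨hnn _ _ _, (hell ε hε _ _ _).2.trans (by gcongr)⟩
        have hb1 := hb ((γ t).2.2.2 + ζ) ((norm_add_le _ _).trans (by linarith [hη t ht]))
        have hb2 := hb ((γ t).2.2.2 - ζ) ((norm_sub_le _ _).trans (by linarith [hη t ht]))
        refine mul_le_mul (hexp t ht).2 ?_ (norm_nonneg _) (Real.exp_pos _).le
        rw [Real.norm_eq_abs, abs_le]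
        constructor <;> linarith [hb1.1, hb1.2, hb2.1, hb2.2]
    intro t ht
    exact norm_prod_le_iff.2 ⟨(hr t ht).trans (le_max_left _ _), norm_prod_le_iff.2
      ⟨(hy t ht).trans ((le_max_left _ _).trans (le_max_right _ _)), norm_prod_le_iff.2
      ⟨(hρ t ht).trans ((le_max_left _ _).trans ((le_max_right _ _).trans (le_max_right _ _))),
      (hη t ht).trans ((le_max_right _ _).trans ((le_max_right _ _).trans (le_max_right _ _)))⟩⟩⟩
  choose! φ hφ using key
  exact ⟨fun ε t z => φ ε z t, fun ε hε z => hφ ε hε z⟩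

/-- The Hamiltonian flow is unique. -/
theorem IsHamFlow.eq_of_hasDerivAt (hg : Admissible g gt) {φ : ℝ → ℝ → Phase d → Phase d}
    (hφ : IsHamFlow g gt φ) {ε : ℝ} (hε : ε ∈ Icc (0 : ℝ) 1) {γ : ℝ → Phase d} {I : Set ℝ}
    (hI : I.OrdConnected) (h0 : (0 : ℝ) ∈ interior I)
    (hγ : ∀ t ∈ I, HasDerivAt γ (hamField g gt ε (γ t)) t) {t : ℝ} (ht : t ∈ interior I) :
    φ ε t (γ 0) = γ t := by
  have hex : ∀ s ∈ interior I, ∃ δ > 0, Ioo (s - δ) (s + δ) ⊆ I := fun s hs => by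
    obtain ⟨δ, hδ, h⟩ := Metric.mem_nhds_iff.1 (mem_interior_iff_mem_nhds.1 hs)
    exact ⟨δ, hδ, by rwa [← Real.ball_eq_Ioo]⟩
  obtain ⟨δ₀, hδ₀, h0'⟩ := hex 0 h0
  obtain ⟨δ₁, hδ₁, h1'⟩ := hex t ht
  let a := min (-(δ₀ / 2)) (t - δ₁ / 2)
  let b := max (δ₀ / 2) (t + δ₁ / 2)
  have ha : a ∈ I := by
    rcases min_choice (-(δ₀ / 2)) (t - δ₁ / 2) with h | h <;> simp only [a, h]
    · exact h0' ⟨by linarith, by linarith⟩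
    · exact h1' ⟨by linarith, by linarith⟩
  have hb : b ∈ I := by
    rcases max_choice (δ₀ / 2) (t + δ₁ / 2) with h | h <;> simp only [b, h]
    · exact h0' ⟨by linarith, by linarith⟩
    · exact h1' ⟨by linarith, by linarith⟩
  have hsub : Icc a b ⊆ I := hI.out ha hb
  have ha0 : a < 0 := (min_le_left _ _).trans_lt (by linarith)
  have hb0 : 0 < b := lt_of_lt_of_le (by linarith) (le_max_left _ _)
  have hat : a ≤ t := (min_le_right _ _).trans (by linarith)
  have hbt : t ≤ b := le_trans (by linarith) (le_max_right _ _)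
  have hX : ContDiff ℝ 1 (hamField g gt ε) := by
    rw [hamField_eq_hamVF hg]
    exact (contDiff_hamVF (contDiff_phaseHam hg ε)).of_le (by simp)
  exact eqOn_of_integralCurve hX (t₀ := 0) ⟨ha0, hb0⟩
    (fun s _ => ((hφ ε hε (γ 0)).2 s).continuousAt.continuousWithinAt)
    (fun s _ => (hφ ε hε (γ 0)).2 s)
    (fun s hs => (hγ s (hsub hs)).continuousAt.continuousWithinAt)
    (fun s hs => hγ s (hsub (Ioo_subset_Icc_self hs))) (hφ ε hε (γ 0)).1 ⟨hat, hbt⟩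

end ConcreteHamiltonian


/-! ### Uniform bounds for the rescaled metric -/

section MetricFunctions

open Filter Topology

/-- Uniform bounds for the restriction of `f` to an affine subspace follow from bounds for its
partial derivatives along a generating system of that subspace. -/
theorem unifSmooth_of_partials {E E' F : Type*} [NormedAddCommGroup E] [NormedSpace ℝ E]
    [NormedAddCommGroup E'] [NormedSpace ℝ E'] [FiniteDimensional ℝ E']
    [NormedAddCommGroup F] [NormedSpace ℝ F] {α : Type*} [Fintype α] (e : α → E')
    (he : ∀ v : E', ∃ c : α → ℝ, v = ∑ a, c a • e a) (L : E' →L[ℝ] E) (c : E)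
    {U : Set E'} (hU : IsOpen U) {O : Set E} (hO : IsOpen O) (hUO : ∀ w ∈ U, L w + c ∈ O) (n : ℕ) :
    ∀ {f : E → F}, ContDiffOn ℝ ∞ f O →
      (∀ (m : ℕ) (γ : Fin m → α), ∃ C, ∀ w ∈ U,
        ‖iteratedFDeriv ℝ m f (L w + c) (fun i => L (e (γ i)))‖ ≤ C) →
      UnifSmooth n (fun _ : Unit => U) (fun _ w => f (L w + c)) := by
  have hA : ∀ w, HasFDerivAt (fun w => L w + c) L w := fun w => L.hasFDerivAt.add_const c
  induction n with
  | zero =>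
    intro f hf hb
    refine ⟨fun _ => hU, fun _ => ?_, fun k hk => ?_⟩
    · exact (hf.of_le (by simp)).comp (L.contDiff.add contDiff_const).contDiffOn hUO
    · obtain rfl : k = 0 := by omega
      obtain ⟨C, hC⟩ := hb 0 Fin.elim0
      exact ⟨C, fun _ w hw => by simpa using hC w hw⟩
  | succ n ih =>
    intro f hf hb
    have hd : ∀ w ∈ U, HasFDerivAt f (fderiv ℝ f (L w + c)) (L w + c) := fun w hw =>
      ((hf.contDiffAt (hO.mem_nhds (hUO w hw))).differentiableAt (by simp)).hasFDerivAt
    have hd' : ∀ w ∈ U, HasFDerivAt (fun w => f (L w + c)) ((fderiv ℝ f (L w + c)).comp L) w :=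
      fun w hw => (hd w hw).comp w (hA w)
    refine UnifSmooth.succ ?_ (fun _ w hw => (hd' w hw).differentiableAt) ?_
    · obtain ⟨C, hC⟩ := hb 0 Fin.elim0
      exact ⟨C, fun _ w hw => by simpa using hC w hw⟩
    have hpart : ∀ a, UnifSmooth n (fun _ : Unit => U)
        (fun _ w => fderiv ℝ f (L w + c) (L (e a))) := by
      intro a
      have hf' : ContDiffOn ℝ ∞ (fderiv ℝ f) O := hf.fderiv_of_isOpen hO (by simp)
      refine ih (f := fun p => fderiv ℝ f p (L (e a))) (hf'.clm_apply contDiffOn_const) ?_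
      intro m γ
      -- The direction a is appended last, as the innermost derivative, so that the first m
      -- derivatives act on the partial derivative of f.
      obtain ⟨C, hC⟩ := hb (m + 1) (Fin.snoc γ a)
      refine ⟨C, fun w hw => ?_⟩
      have h1 := ContinuousLinearMap.iteratedFDeriv_comp_left
        (ContinuousLinearMap.apply ℝ F (L (e a))) (x := L w + c) (i := m)
        (hf'.contDiffAt (hO.mem_nhds (hUO w hw))) (by exact_mod_cast le_top)
      have h2 := hC w hw
      rw [iteratedFDeriv_succ_apply_right] at h2
      have h3 : iteratedFDeriv ℝ m (fun p => fderiv ℝ f p (L (e a))) (L w + c) =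
          (ContinuousLinearMap.apply ℝ F (L (e a))).compContinuousMultilinearMap
            (iteratedFDeriv ℝ m (fderiv ℝ f) (L w + c)) := h1
      rw [h3]
      simpa [Fin.init_def] using h2
    refine UnifSmooth.of_clm_apply zero_lt_one (fun v _ => ?_) (fun _ => hU)
    obtain ⟨cf, hcf⟩ := he v
    refine (UnifSmooth.sum Finset.univ (fun _ => hU) fun a _ =>
      (hpart a).clm_comp (cf a • ContinuousLinearMap.id ℝ F)).congr fun _ w hw => ?_
    rw [(hd' w hw).fderiv, hcf]
    simp [map_sum]

variable {d : ℕ}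

/-- For fixed η only the partial derivatives in x and y enter, whose symbol bound is the constant
C|η|². At x > 0 the derivatives within the half space are ordinary derivatives. -/
theorem SymbolBounds.unifSmooth_slice {h : ℝ → Base d → QuadraticForm ℝ (Base d)}
    (hh : SymbolBounds h) (η : Base d) (n : ℕ) :
    UnifSmooth n (fun _ : Unit => Ioo (0 : ℝ) 1 ×ˢ (univ : Set (Base d)))
      (fun _ w => h w.1 w.2 η) := by
  let e : Option (Fin d) → ℝ × Base d := fun a =>
    a.elim (1, 0) fun i => (0, EuclideanSpace.single i 1)
  let L : ℝ × Base d →L[ℝ] ℝ × Base d × Base d :=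
    (ContinuousLinearMap.fst ℝ ℝ (Base d)).prod ((ContinuousLinearMap.snd ℝ ℝ (Base d)).prod 0)
  let O : Set (ℝ × Base d × Base d) := Ioi 0 ×ˢ univ
  have hO : IsOpen O := isOpen_Ioi.prod isOpen_univ
  have hOs : O ⊆ Ici 0 ×ˢ univ := prod_mono Ioi_subset_Ici_self subset_rfl
  have he : ∀ v : ℝ × Base d, ∃ c : Option (Fin d) → ℝ, v = ∑ a, c a • e a := by
    intro v
    refine ⟨fun a => a.elim v.1 fun i => v.2 i, ?_⟩
    rw [Fintype.sum_option]
    have h1 := (EuclideanSpace.basisFun (Fin d) ℝ).sum_repr v.2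
    simp only [EuclideanSpace.basisFun_repr, EuclideanSpace.basisFun_apply] at h1
    refine Prod.ext ?_ ?_
    · simp [e, Prod.fst_sum]
    · simpa [e, Prod.snd_sum] using h1.symm
  have hmain := unifSmooth_of_partials (F := ℝ) e he L (0, 0, η)
    (isOpen_Ioo.prod isOpen_univ : IsOpen (Ioo (0 : ℝ) 1 ×ˢ (univ : Set (Base d)))) hO
    (fun w hw => ⟨by simpa [L] using hw.1.1, trivial⟩) n (hh.smooth.mono hOs) ?_
  · exact hmain.congr fun _ w _ => by simp [L]
  intro m γ
  let γ' : Fin m → MetricCoord d := fun i => (γ i).elim .x .y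
  obtain ⟨C, hC⟩ := hh.bound m γ'
  refine ⟨C * ‖η‖ ^ 2, fun w hw => ?_⟩
  have h1 := hC w.1 (Ioo_subset_Icc_self hw.1) w.2 η
  have h2 : ∑ i, (γ' i).etaDeg = 0 := Finset.sum_eq_zero fun i _ => by
    simp only [γ']
    cases γ i <;> rfl
  rw [h2] at h1
  have h3 : L w + (0, 0, η) = (w.1, w.2, η) := by simp [L]
  have h4 : (fun i => L (e (γ i))) = fun i => (γ' i).vec := by
    funext i
    simp only [γ', e, L]
    cases γ i <;> simp [MetricCoord.vec]
  have hw' : (w.1, w.2, η) ∈ O := mk_mem_prod (mem_Ioi.2 hw.1.1) (mem_univ _)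
  rw [h3, h4, ← iteratedFDerivWithin_of_isOpen m hO hw']
  have h5 : (Ici (0 : ℝ) ×ˢ (univ : Set (Base d × Base d))) =ᶠ[𝓝 (w.1, w.2, η)] O := by
    filter_upwards [hO.mem_nhds (show (w.1, w.2, η) ∈ O from ⟨hw.1.1, trivial⟩)] with p hp
    exact propext ⟨fun _ => hp, fun _ => hOs hp⟩
  unfold pderivWithin at h1
  rw [iteratedFDerivWithin_congr_set h5] at h1
  simpa using h1

/-- The coefficients are combinations of values of Q at fixed vectors, so joint smoothness in ξ
reduces to smoothness of the slices with η fixed. -/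
theorem quadraticForm_eq_sum (Q : QuadraticForm ℝ (Base d)) (ξ : Base d) :
    Q ξ = ∑ i, ∑ j, (ξ i * ξ j) * ((1 / 2 : ℝ) *
      (Q (EuclideanSpace.single i 1 + EuclideanSpace.single j 1) - Q (EuclideanSpace.single i 1)
        - Q (EuclideanSpace.single j 1))) := by
  have h1 := (EuclideanSpace.basisFun (Fin d) ℝ).sum_repr ξ
  simp only [EuclideanSpace.basisFun_repr, EuclideanSpace.basisFun_apply] at h1
  have h2 : Q ξ = 1 / 2 * Q.polarBilin ξ ξ := by
    rw [QuadraticMap.polarBilin_apply_apply, QuadraticMap.polar_self]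
    simp
  rw [h2]
  conv_lhs => rw [← h1]
  simp only [map_sum, map_smul, LinearMap.sum_apply, LinearMap.smul_apply, smul_eq_mul,
    QuadraticMap.polarBilin_apply_apply, QuadraticMap.polar, Finset.mul_sum]
  exact Finset.sum_comm.trans (Finset.sum_congr rfl fun i _ => Finset.sum_congr rfl fun j _ => by
    ring_nf)

theorem SymbolBounds.unifSmooth {h : ℝ → Base d → QuadraticForm ℝ (Base d)}
    (hh : SymbolBounds h) (Y : ℝ) (n : ℕ) :
    UnifSmooth n (fun _ : Unit => Ioo (0 : ℝ) 1 ×ˢ Metric.ball (0 : Base d) Y ×ˢ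
      Metric.ball (0 : Base d) 1) (fun _ q => h q.1 q.2.1 q.2.2) := by
  have hU : ∀ _ : Unit, IsOpen (Ioo (0 : ℝ) 1 ×ˢ Metric.ball (0 : Base d) Y ×ˢ
      Metric.ball (0 : Base d) 1) := fun _ =>
    isOpen_Ioo.prod (Metric.isOpen_ball.prod Metric.isOpen_ball)
  obtain ⟨R, hR⟩ := ((Metric.isBounded_Ioo (0 : ℝ) 1).prod
    ((Metric.isBounded_ball (x := (0 : Base d)) (r := Y)).prod
      (Metric.isBounded_ball (x := (0 : Base d)) (r := 1)))).exists_norm_le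
  have hid : UnifSmooth n (fun _ : Unit => Ioo (0 : ℝ) 1 ×ˢ Metric.ball (0 : Base d) Y ×ˢ
      Metric.ball (0 : Base d) 1) (fun _ q => q) :=
    UnifSmooth.clm (ContinuousLinearMap.id ℝ _) hU ⟨R, fun _ q hq => hR q hq⟩
  have hcoef : ∀ η : Base d, UnifSmooth n (fun _ : Unit => Ioo (0 : ℝ) 1 ×ˢ
      Metric.ball (0 : Base d) Y ×ˢ Metric.ball (0 : Base d) 1) (fun _ q => h q.1 q.2.1 η) :=
    fun η => (hh.unifSmooth_slice η n).comp (hid.fst.prodMk hid.snd.fst)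
      fun _ q hq => ⟨hq.1, trivial⟩
  have hcoord : ∀ i, UnifSmooth n (fun _ : Unit => Ioo (0 : ℝ) 1 ×ˢ
      Metric.ball (0 : Base d) Y ×ˢ Metric.ball (0 : Base d) 1) (fun _ q => q.2.2 i) :=
    fun i => hid.snd.snd.clm_comp (EuclideanSpace.proj i)
  refine (UnifSmooth.sum Finset.univ hU fun i _ => UnifSmooth.sum Finset.univ hU fun j _ =>
    ((hcoord i).mul (hcoord j)).mul ((UnifSmooth.const hU (1 / 2 : ℝ)).mul
      (((hcoef (EuclideanSpace.single i 1 + EuclideanSpace.single j 1)).sub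
        (hcoef (EuclideanSpace.single i 1))).sub (hcoef (EuclideanSpace.single j 1))))).congr
    fun _ q _ => quadraticForm_eq_sum _ _

/-- The points `(x, μ, u, y, ξ)`. -/
abbrev MetricPoint (d : ℕ) : Type := ℝ × ℝ × ℝ × Base d × Base d

/-- The rescaled metric function `g(y, ξ) + μ u g̃(x u, y, ξ)`. -/
noncomputable def scaledMetric (g : Base d → QuadraticForm ℝ (Base d))
    (gt : ℝ → Base d → QuadraticForm ℝ (Base d)) (p : MetricPoint d) : ℝ :=
  g p.2.2.2.1 p.2.2.2.2 + p.2.1 * p.2.2.1 * gt (p.1 * p.2.2.1) p.2.2.2.1 p.2.2.2.2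

/-- The domain `0 < x < 1/2`, `|μ| < 1`, `0 < u < 2`, `|y| < Y`, `|ξ| < 1`. -/
def metricBox (d : ℕ) (Y : ℝ) : Set (MetricPoint d) :=
  Ioo 0 (1 / 2) ×ˢ Ioo (-1) 1 ×ˢ Ioo 0 2 ×ˢ Metric.ball 0 Y ×ˢ Metric.ball 0 1

theorem isOpen_metricBox {Y : ℝ} : IsOpen (metricBox d Y) :=
  isOpen_Ioo.prod (isOpen_Ioo.prod (isOpen_Ioo.prod (Metric.isOpen_ball.prod Metric.isOpen_ball)))

theorem isBounded_metricBox {Y : ℝ} : Bornology.IsBounded (metricBox d Y) :=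
  (Metric.isBounded_Ioo _ _).prod ((Metric.isBounded_Ioo _ _).prod ((Metric.isBounded_Ioo _ _).prod
    (Metric.isBounded_ball.prod Metric.isBounded_ball)))

theorem unifSmooth_id {E : Type*} [NormedAddCommGroup E] [NormedSpace ℝ E] {U : Set E}
    (hU : IsOpen U) (hb : Bornology.IsBounded U) (ι : Type*) (n : ℕ) :
    UnifSmooth n (fun _ : ι => U) (fun _ q => q) := by
  obtain ⟨R, hR⟩ := hb.exists_norm_le
  exact UnifSmooth.clm (ContinuousLinearMap.id ℝ _) (fun _ => hU) ⟨R, fun _ q hq => hR q hq⟩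

variable {g : Base d → QuadraticForm ℝ (Base d)} {gt : ℝ → Base d → QuadraticForm ℝ (Base d)}

theorem unifSmooth_scaledMetric (hg : Admissible g gt) (Y : ℝ) (n : ℕ) :
    UnifSmooth n (fun _ : Unit => metricBox d Y) (fun _ => scaledMetric g gt) := by
  have hid := unifSmooth_id (isOpen_metricBox (d := d) (Y := Y)) isBounded_metricBox Unit n
  have hxu : ∀ p ∈ metricBox d Y, p.1 * p.2.2.1 ∈ Ioo (0 : ℝ) 1 := by
    rintro ⟨x, μ, u, y, ξ⟩ ⟨hx, -, hu, -⟩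
    simp only [mem_Ioo] at *
    constructor <;> nlinarith [hx.1, hx.2, hu.1, hu.2]
  have h1 := (hg.bounds_g.unifSmooth Y n).comp (U := fun _ : Unit => metricBox d Y)
    (f := fun _ p => (p.1, p.2.2.2.1, p.2.2.2.2)) (hid.fst.prodMk
    (hid.snd.snd.snd.fst.prodMk hid.snd.snd.snd.snd)) fun _ p hp =>
      ⟨⟨hp.1.1, hp.1.2.trans (by norm_num)⟩, hp.2.2.2⟩
  have h2 := (hg.bounds_gt.unifSmooth Y n).comp (U := fun _ : Unit => metricBox d Y)
    (f := fun _ p => (p.1 * p.2.2.1, p.2.2.2.1, p.2.2.2.2))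
    ((hid.fst.mul hid.snd.snd.fst).prodMk
    (hid.snd.snd.snd.fst.prodMk hid.snd.snd.snd.snd)) fun _ p hp =>
      ⟨hxu p hp, hp.2.2.2⟩
  exact h1.add ((hid.snd.fst.mul hid.snd.snd.fst).mul h2)

theorem scaledMetric_smul (p : MetricPoint d) (t : ℝ) :
    scaledMetric g gt (p.1, p.2.1, p.2.2.1, p.2.2.2.1, t • p.2.2.2.2) =
      t ^ 2 * scaledMetric g gt p := by
  simp only [scaledMetric, QuadraticMap.map_smul, smul_eq_mul]
  ring

/-- The dilation of the variable `ξ`. -/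
noncomputable def dilateXi (d : ℕ) (t : ℝ) : MetricPoint d →L[ℝ] MetricPoint d :=
  (ContinuousLinearMap.id ℝ ℝ).prodMap ((ContinuousLinearMap.id ℝ ℝ).prodMap
    ((ContinuousLinearMap.id ℝ ℝ).prodMap ((ContinuousLinearMap.id ℝ (Base d)).prodMap
      (t • ContinuousLinearMap.id ℝ (Base d)))))

theorem dilateXi_apply (t : ℝ) (p : MetricPoint d) :
    dilateXi d t p = (p.1, p.2.1, p.2.2.1, p.2.2.2.1, t • p.2.2.2.2) := rfl

theorem fderiv_scaledMetric_dilateXi {t : ℝ} {p : MetricPoint d}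
    (h1 : DifferentiableAt ℝ (scaledMetric g gt) p)
    (h2 : DifferentiableAt ℝ (scaledMetric g gt) (dilateXi d t p)) (w : MetricPoint d) :
    fderiv ℝ (scaledMetric g gt) (dilateXi d t p) (dilateXi d t w) =
      t ^ 2 * fderiv ℝ (scaledMetric g gt) p w := by
  have h3 := h2.hasFDerivAt.comp p (dilateXi d t).hasFDerivAt
  have h4 : HasFDerivAt (scaledMetric g gt ∘ dilateXi d t)
      (t ^ 2 • fderiv ℝ (scaledMetric g gt) p) p := by
    refine (h1.hasFDerivAt.const_smul (t ^ 2)).congr_of_eventuallyEq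
      (Eventually.of_forall fun q => ?_)
    simp only [Function.comp_apply, dilateXi_apply, scaledMetric_smul, Pi.smul_apply, smul_eq_mul]
  simpa using congrArg (fun L => L w) (h3.unique h4)

/-- Homogeneity of degree 2 in ξ upgrades uniform bounds at |ξ| = 1/2 to O(|ξ|²) for the function
and its derivatives in the other variables, and to O(|ξ|) for derivatives in ξ. -/
theorem exists_bound_fderiv_scaledMetric (hg : Admissible g gt) (Y : ℝ) :
    ∃ C, 0 ≤ C ∧ ∀ p ∈ metricBox d Y, |scaledMetric g gt p| ≤ C * ‖p.2.2.2.2‖ ^ 2 ∧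
      (∀ w, |fderiv ℝ (scaledMetric g gt) p w| ≤ C * ‖p.2.2.2.2‖ * ‖w‖) ∧
      ∀ w, w.2.2.2.2 = 0 → |fderiv ℝ (scaledMetric g gt) p w| ≤ C * ‖p.2.2.2.2‖ ^ 2 * ‖w‖ := by
  obtain ⟨C, hC0, hC⟩ := (unifSmooth_scaledMetric hg Y 0).norm_le
  obtain ⟨C', hC0', hC'⟩ := (unifSmooth_scaledMetric hg Y (0 + 1)).norm_fderiv_le
  have hd : ∀ p ∈ metricBox d Y, DifferentiableAt ℝ (scaledMetric g gt) p := fun p hp =>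
    (unifSmooth_scaledMetric hg Y (0 + 1)).differentiableAt (i := ()) hp
  refine ⟨4 * C + 4 * C', by positivity, fun p hp => ?_⟩
  -- At ξ = 0 the dilation by 2 fixes the point, and comparing the factors 1, 2 and 4 makes value
  -- and differential vanish.
  by_cases hξ : p.2.2.2.2 = 0
  · have hp2 : dilateXi d 2 p = p := by
      rw [dilateXi_apply, hξ, smul_zero, ← hξ]
    have h1 := fderiv_scaledMetric_dilateXi (t := 2) (hd p hp) (by rw [hp2]; exact hd p hp)
    rw [hp2] at h1
    have hA : ∀ w : MetricPoint d, w.2.2.2.2 = 0 → fderiv ℝ (scaledMetric g gt) p w = 0 := by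
      intro w hw
      have h2 := h1 w
      rw [dilateXi_apply, hw, smul_zero, ← hw] at h2
      have : fderiv ℝ (scaledMetric g gt) p w = 2 ^ 2 * fderiv ℝ (scaledMetric g gt) p w := h2
      linarith
    have hB : ∀ ζ : Base d, fderiv ℝ (scaledMetric g gt) p (0, 0, 0, 0, ζ) = 0 := by
      intro ζ
      have h2 := h1 (0, 0, 0, 0, ζ)
      have h3 : dilateXi d 2 (0, 0, 0, 0, ζ) = (2 : ℝ) • ((0, 0, 0, 0, ζ) : MetricPoint d) := by
        simp [dilateXi_apply]
      rw [h3, map_smul, smul_eq_mul] at h2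
      linarith
    have hC : ∀ w : MetricPoint d, fderiv ℝ (scaledMetric g gt) p w = 0 := by
      intro w
      have h2 : w = (w.1, w.2.1, w.2.2.1, w.2.2.2.1, 0) + (0, 0, 0, 0, w.2.2.2.2) := by simp
      rw [h2, map_add, hB, hA _ rfl, add_zero]
    refine ⟨?_, fun w => ?_, fun w _ => ?_⟩
    · have h2 := scaledMetric_smul (g := g) (gt := gt) p 2
      rw [hξ, smul_zero, ← hξ] at h2
      have h3 : scaledMetric g gt p = 2 ^ 2 * scaledMetric g gt p := h2
      have h4 : scaledMetric g gt p = 0 := by linarith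
      rw [h4, abs_zero]
      positivity
    · rw [hC, abs_zero]; positivity
    · rw [hC, abs_zero]; positivity
  · have hn : 0 < ‖p.2.2.2.2‖ := norm_pos_iff.2 hξ
    have hn1 : ‖p.2.2.2.2‖ < 1 := by simpa using hp.2.2.2.2
    -- Division of ξ by t brings its norm to 1/2, well inside the box.
    set t := 2 * ‖p.2.2.2.2‖ with ht
    have ht0 : 0 < t := by positivity
    let p' := dilateXi d t⁻¹ p
    have hpp : ∀ w, dilateXi d t (dilateXi d t⁻¹ w) = w := fun w => by
      simp [dilateXi_apply, smul_smul, ht0.ne']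
    have hp' : p' ∈ metricBox d Y := by
      simp only [p', dilateXi_apply]
      refine ⟨hp.1, hp.2.1, hp.2.2.1, hp.2.2.2.1, ?_⟩
      rw [mem_ball_zero_iff, norm_smul, norm_inv, Real.norm_of_nonneg ht0.le, ht, mul_inv, mul_assoc,
        inv_mul_cancel₀ hn.ne']
      norm_num
    have h1 := fderiv_scaledMetric_dilateXi (t := t) (hd p' hp')
      (by simp only [p']; rw [hpp]; exact hd p hp)
    have h2 : ∀ w, fderiv ℝ (scaledMetric g gt) p w =
        t ^ 2 * fderiv ℝ (scaledMetric g gt) p' (dilateXi d t⁻¹ w) := by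
      intro w
      have h3 := h1 (dilateXi d t⁻¹ w)
      simp only [p'] at h3
      rwa [hpp, hpp] at h3
    have hop : ∀ w, |fderiv ℝ (scaledMetric g gt) p' w| ≤ C' * ‖w‖ := fun w =>
      (ContinuousLinearMap.le_opNorm _ w).trans (mul_le_mul_of_nonneg_right (hC' () p' hp')
        (norm_nonneg _))
    refine ⟨?_, fun w => ?_, fun w hw => ?_⟩
    · have h3 := scaledMetric_smul (g := g) (gt := gt) p' t
      rw [← dilateXi_apply] at h3
      simp only [p'] at h3
      rw [hpp] at h3
      have h4 : |scaledMetric g gt p'| ≤ C := hC () p' hp'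
      rw [h3, abs_mul, abs_of_nonneg (by positivity : 0 ≤ t ^ 2)]
      have h5 := mul_le_mul_of_nonneg_left h4 (by positivity : 0 ≤ t ^ 2)
      have h6 : t ^ 2 * C = 4 * C * ‖p.2.2.2.2‖ ^ 2 := by rw [ht]; ring
      have h7 : 0 ≤ 4 * C' * ‖p.2.2.2.2‖ ^ 2 := by positivity
      simp only [p'] at h5
      linarith
    · have h3 : t * ‖dilateXi d t⁻¹ w‖ ≤ 2 * ‖w‖ := by
        have h4 : t • dilateXi d t⁻¹ w = (t * w.1, t * w.2.1, t * w.2.2.1, t • w.2.2.2.1,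
            w.2.2.2.2) := by
          simp [dilateXi_apply, smul_smul, ht0.ne']
        have h5 : t * ‖dilateXi d t⁻¹ w‖ = ‖t • dilateXi d t⁻¹ w‖ := by
          rw [norm_smul, Real.norm_of_nonneg ht0.le]
        rw [h5, h4]
        have ht2 : t ≤ 2 := by linarith
        have hb : ∀ {F : Type} [NormedAddCommGroup F] [NormedSpace ℝ F] (v : F), ‖v‖ ≤ ‖w‖ →
            ‖t • v‖ ≤ 2 * ‖w‖ := fun v hv => by
          rw [norm_smul, Real.norm_of_nonneg ht0.le]
          exact mul_le_mul ht2 hv (norm_nonneg _) zero_le_two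
        have hw2 := norm_snd_le w
        have hw3 := (norm_snd_le w.2).trans hw2
        have hw4 := (norm_snd_le w.2.2).trans hw3
        exact norm_prod_le_iff.2 ⟨hb w.1 (norm_fst_le _), norm_prod_le_iff.2
          ⟨hb w.2.1 ((norm_fst_le _).trans hw2), norm_prod_le_iff.2
          ⟨hb w.2.2.1 ((norm_fst_le _).trans hw3), norm_prod_le_iff.2
          ⟨hb w.2.2.2.1 ((norm_fst_le _).trans hw4),
            ((norm_snd_le _).trans hw4).trans (by linarith [norm_nonneg w])⟩⟩⟩⟩
      rw [h2, abs_mul, abs_of_nonneg (by positivity : 0 ≤ t ^ 2)]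
      calc t ^ 2 * |fderiv ℝ (scaledMetric g gt) p' (dilateXi d t⁻¹ w)|
          ≤ t ^ 2 * (C' * ‖dilateXi d t⁻¹ w‖) :=
            mul_le_mul_of_nonneg_left (hop _) (by positivity)
        _ = t * C' * (t * ‖dilateXi d t⁻¹ w‖) := by ring
        _ ≤ t * C' * (2 * ‖w‖) := mul_le_mul_of_nonneg_left h3 (by positivity)
        _ = 4 * C' * ‖p.2.2.2.2‖ * ‖w‖ := by rw [ht]; ring
        _ ≤ (4 * C + 4 * C') * ‖p.2.2.2.2‖ * ‖w‖ := by gcongr; linarith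
    · have h3 : dilateXi d t⁻¹ w = w := by
        rw [dilateXi_apply, hw, smul_zero, ← hw]
      rw [h2, h3, abs_mul, abs_of_nonneg (by positivity : 0 ≤ t ^ 2)]
      calc t ^ 2 * |fderiv ℝ (scaledMetric g gt) p' w| ≤ t ^ 2 * (C' * ‖w‖) :=
            mul_le_mul_of_nonneg_left (hop _) (by positivity)
        _ = 4 * C' * ‖p.2.2.2.2‖ ^ 2 * ‖w‖ := by rw [ht]; ring
        _ ≤ (4 * C + 4 * C') * ‖p.2.2.2.2‖ ^ 2 * ‖w‖ := by gcongr; linarith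

/-- The Riesz isomorphism, as a continuous linear map. -/
noncomputable def riesz (d : ℕ) : (Base d →L[ℝ] ℝ) →L[ℝ] Base d :=
  LinearMap.mkContinuous
    { toFun := (InnerProductSpace.toDual ℝ (Base d)).symm
      map_add' := map_add _
      map_smul' := fun c L => by simp } 1 (fun L => by simp)

theorem riesz_apply (L : Base d →L[ℝ] ℝ) :
    riesz d L = (InnerProductSpace.toDual ℝ (Base d)).symm L := rfl

theorem norm_riesz_le {L : Base d →L[ℝ] ℝ} {C : ℝ} (hC : 0 ≤ C) (h : ∀ v, |L v| ≤ C * ‖v‖) :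
    ‖riesz d L‖ ≤ C := by
  rw [riesz_apply, LinearIsometryEquiv.norm_map]
  exact L.opNorm_le_bound hC h

/-- The inclusion of the `y`-space into the metric points. -/
noncomputable def inclMetricY (d : ℕ) : Base d →L[ℝ] MetricPoint d :=
  (ContinuousLinearMap.inr ℝ ℝ _).comp ((ContinuousLinearMap.inr ℝ ℝ _).comp
    ((ContinuousLinearMap.inr ℝ ℝ _).comp (ContinuousLinearMap.inl ℝ (Base d) (Base d))))

/-- The inclusion of the `ξ`-space into the metric points. -/
noncomputable def inclMetricXi (d : ℕ) : Base d →L[ℝ] MetricPoint d :=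
  (ContinuousLinearMap.inr ℝ ℝ _).comp ((ContinuousLinearMap.inr ℝ ℝ _).comp
    ((ContinuousLinearMap.inr ℝ ℝ _).comp (ContinuousLinearMap.inr ℝ (Base d) (Base d))))

theorem inclMetricY_apply (y : Base d) : inclMetricY d y = (0, 0, 0, y, 0) := rfl

theorem inclMetricXi_apply (ξ : Base d) : inclMetricXi d ξ = (0, 0, 0, 0, ξ) := rfl

/-- The gradient of the rescaled metric function in `y`. -/
noncomputable def metricGradY (g : Base d → QuadraticForm ℝ (Base d))
    (gt : ℝ → Base d → QuadraticForm ℝ (Base d)) (p : MetricPoint d) : Base d :=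
  riesz d ((fderiv ℝ (scaledMetric g gt) p).comp (inclMetricY d))

/-- The gradient of the rescaled metric function in `ξ`. -/
noncomputable def metricGradXi (g : Base d → QuadraticForm ℝ (Base d))
    (gt : ℝ → Base d → QuadraticForm ℝ (Base d)) (p : MetricPoint d) : Base d :=
  riesz d ((fderiv ℝ (scaledMetric g gt) p).comp (inclMetricXi d))

/-- The force `2 G + u ∂_u G`. -/
noncomputable def metricForce (g : Base d → QuadraticForm ℝ (Base d))
    (gt : ℝ → Base d → QuadraticForm ℝ (Base d)) (p : MetricPoint d) : ℝ :=
  2 * scaledMetric g gt p + p.2.2.1 * fderiv ℝ (scaledMetric g gt) p (0, 0, 1, 0, 0)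

theorem unifSmooth_metricGradY (hg : Admissible g gt) (Y : ℝ) (n : ℕ) :
    UnifSmooth n (fun _ : Unit => metricBox d Y) (fun _ => metricGradY g gt) :=
  ((unifSmooth_scaledMetric hg Y (n + 1)).fderiv.clm_comp
    ((ContinuousLinearMap.compL ℝ (Base d) (MetricPoint d) ℝ).flip (inclMetricY d))).clm_comp
      (riesz d)

theorem unifSmooth_metricGradXi (hg : Admissible g gt) (Y : ℝ) (n : ℕ) :
    UnifSmooth n (fun _ : Unit => metricBox d Y) (fun _ => metricGradXi g gt) :=
  ((unifSmooth_scaledMetric hg Y (n + 1)).fderiv.clm_comp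
    ((ContinuousLinearMap.compL ℝ (Base d) (MetricPoint d) ℝ).flip (inclMetricXi d))).clm_comp
      (riesz d)

theorem unifSmooth_metricForce (hg : Admissible g gt) (Y : ℝ) (n : ℕ) :
    UnifSmooth n (fun _ : Unit => metricBox d Y) (fun _ => metricForce g gt) := by
  have hU : ∀ _ : Unit, IsOpen (metricBox d Y) := fun _ => isOpen_metricBox
  have hid := unifSmooth_id (isOpen_metricBox (d := d) (Y := Y)) isBounded_metricBox Unit n
  exact ((UnifSmooth.const hU (2 : ℝ)).mul (unifSmooth_scaledMetric hg Y n)).add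
    (hid.snd.snd.fst.mul ((unifSmooth_scaledMetric hg Y (n + 1)).fderiv.clm_apply
      (UnifSmooth.const hU ((0, 0, 1, 0, 0) : MetricPoint d))))

theorem exists_bound_metric (hg : Admissible g gt) (Y : ℝ) :
    ∃ C, 0 ≤ C ∧ ∀ p ∈ metricBox d Y, |scaledMetric g gt p| ≤ C * ‖p.2.2.2.2‖ ^ 2 ∧
      |metricForce g gt p| ≤ C * ‖p.2.2.2.2‖ ^ 2 ∧ ‖metricGradY g gt p‖ ≤ C * ‖p.2.2.2.2‖ ^ 2 ∧
      ‖metricGradXi g gt p‖ ≤ C * ‖p.2.2.2.2‖ := by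
  obtain ⟨C, hC0, hC⟩ := exists_bound_fderiv_scaledMetric hg Y
  refine ⟨4 * C, by positivity, fun p hp => ?_⟩
  obtain ⟨h1, h2, h3⟩ := hC p hp
  have hsq : 0 ≤ C * ‖p.2.2.2.2‖ ^ 2 := by positivity
  have hsn : 0 ≤ C * ‖p.2.2.2.2‖ := by positivity
  refine ⟨by linarith, ?_, ?_, ?_⟩
  · have h4 := h3 (0, 0, 1, 0, 0) rfl
    have h5 : ‖((0, 0, 1, 0, 0) : MetricPoint d)‖ = 1 := by simp [Prod.norm_def]
    rw [h5, mul_one] at h4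
    have hu : |p.2.2.1| ≤ 2 := by
      rw [abs_of_pos hp.2.2.1.1]; exact hp.2.2.1.2.le
    calc |metricForce g gt p| ≤ |2 * scaledMetric g gt p| +
        |p.2.2.1 * fderiv ℝ (scaledMetric g gt) p (0, 0, 1, 0, 0)| := abs_add_le _ _
      _ ≤ 2 * (C * ‖p.2.2.2.2‖ ^ 2) + 2 * (C * ‖p.2.2.2.2‖ ^ 2) := by
        rw [abs_mul, abs_mul, abs_two]
        exact add_le_add (mul_le_mul_of_nonneg_left h1 zero_le_two)
          (mul_le_mul hu h4 (abs_nonneg _) zero_le_two)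
      _ = _ := by ring
  · refine (norm_riesz_le hsq fun v => ?_).trans (by linarith)
    have h4 := h3 (inclMetricY d v) rfl
    have h5 : ‖inclMetricY d v‖ = ‖v‖ := by simp [inclMetricY_apply, Prod.norm_def]
    rwa [h5] at h4
  · refine (norm_riesz_le hsn fun v => ?_).trans (by linarith)
    have h4 := h2 (inclMetricXi d v)
    have h5 : ‖inclMetricXi d v‖ = ‖v‖ := by simp [inclMetricXi_apply, Prod.norm_def]
    rwa [h5] at h4

end MetricFunctions


/-! ### Further uniformly smooth families -/

section GeneralUnifSmooth

open Filter Topology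

variable {ι E F : Type*} [NormedAddCommGroup E] [NormedSpace ℝ E]
  [NormedAddCommGroup F] [NormedSpace ℝ F]

theorem unifSmooth_of_contDiffOn [FiniteDimensional ℝ E] {U O : Set E} {f : E → F}
    (hO : IsOpen O) (hf : ContDiffOn ℝ ∞ f O) (hU : IsOpen U) (hb : Bornology.IsBounded U)
    (hUO : closure U ⊆ O) (n : ℕ) : UnifSmooth n (fun _ : ι => U) (fun _ => f) := by
  refine ⟨fun _ => hU, fun _ => (hf.mono (subset_closure.trans hUO)).of_le (by exact_mod_cast le_top),
    fun k _ => ?_⟩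
  have h1 : ContinuousOn (iteratedFDerivWithin ℝ k f O) O :=
    hf.continuousOn_iteratedFDerivWithin (by exact_mod_cast le_top) hO.uniqueDiffOn
  obtain ⟨C, hC⟩ := (hb.isCompact_closure).exists_bound_of_continuousOn (h1.mono hUO)
  refine ⟨C, fun _ x hx => ?_⟩
  have hx' := subset_closure hx
  rw [← iteratedFDerivWithin_of_isOpen k hO (hUO hx')]
  exact hC x hx'

theorem unifSmooth_const_of_bounded {U : ι → Set E} (hU : ∀ i, IsOpen (U i)) {c : ι → F} {C : ℝ}
    (hc : ∀ i, ‖c i‖ ≤ C) (n : ℕ) : UnifSmooth n U (fun i _ => c i) := by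
  refine ⟨hU, fun i => contDiffOn_const, fun k _ => ?_⟩
  rcases k with _ | k
  · exact ⟨C, fun i x _ => by simpa using hc i⟩
  · exact ⟨0, fun i x _ => by rw [iteratedFDeriv_const_of_ne (by omega)]; simp⟩

/-- Each derivative in r raises the power of s by one, and s^j e^{-sr} ≤ s^j e^{-s} ≤ j! for r > 1.
This is the source of all uniformity for large times. -/
theorem unifSmooth_pow_mul_exp (n : ℕ) : ∀ j : ℕ, UnifSmooth n (fun _ : Ici (0 : ℝ) => Ioi (1 : ℝ))
    (fun s r => (s : ℝ) ^ j * Real.exp (-(s * r))) := by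
  have hb : ∀ j : ℕ, ∀ s : Ici (0 : ℝ), ∀ r ∈ Ioi (1 : ℝ),
      ‖(s : ℝ) ^ j * Real.exp (-(s * r))‖ ≤ j.factorial := by
    rintro j ⟨s, hs⟩ r hr
    have hs' : 0 ≤ s := hs
    have hr' : 1 < r := hr
    rw [Real.norm_of_nonneg (mul_nonneg (pow_nonneg hs' _) (Real.exp_pos _).le)]
    have h1 := Real.pow_div_factorial_le_exp s hs' j
    rw [div_le_iff₀ (by positivity)] at h1
    have h2 : Real.exp (-(s * r)) ≤ Real.exp (-s) := Real.exp_le_exp.2 (by nlinarith)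
    calc s ^ j * Real.exp (-(s * r)) ≤ (Real.exp s * j.factorial) * Real.exp (-s) := by
          gcongr
      _ = (Real.exp s * Real.exp (-s)) * j.factorial := by ring
      _ = j.factorial := by rw [← Real.exp_add]; simp
  have hd : ∀ j : ℕ, ∀ s r : ℝ, HasFDerivAt (fun r => s ^ j * Real.exp (-(s * r)))
      ((-ContinuousLinearMap.mul ℝ ℝ) (s ^ (j + 1) * Real.exp (-(s * r)))) r := by
    intro j s r
    have h1 := (((hasDerivAt_id r).const_mul s).neg.exp).const_mul (s ^ j)
    refine h1.hasFDerivAt.congr_fderiv ?_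
    ext
    simp
    ring
  induction n with
  | zero =>
    intro j
    refine ⟨fun _ => isOpen_Ioi, fun _ => by fun_prop, fun k hk => ?_⟩
    obtain rfl : k = 0 := by omega
    exact ⟨j.factorial, fun s r hr => by simpa using hb j s r hr⟩
  | succ n ih =>
    intro j
    refine UnifSmooth.succ ⟨j.factorial, hb j⟩ (fun s r _ => (hd j s r).differentiableAt) ?_
    exact ((ih (j + 1)).clm_comp _).congr fun s r _ => (hd j s r).fderiv

end GeneralUnifSmooth

/-! ### The equation for the displacement in compactified time -/

section ScaledField

open Filter Topology

variable {d : ℕ} {g : Base d → QuadraticForm ℝ (Base d)}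
  {gt : ℝ → Base d → QuadraticForm ℝ (Base d)}

/-- The argument of the metric functions along the rescaled flow. -/
noncomputable def metricPoint (u : ℝ) (q : Scaled d) (v : Phase d) : MetricPoint d :=
  (q.1, q.2.1, u, q.2.2.1 + q.1 • v.2.1, q.2.2.2.2 + q.1 • v.2.2.2)

/-- The rescaled Hamiltonian vector field with weights `A`, `B`. -/
noncomputable def scaledField (g : Base d → QuadraticForm ℝ (Base d))
    (gt : ℝ → Base d → QuadraticForm ℝ (Base d)) (u A B : ℝ) (q : Scaled d) (v : Phase d) :
    Phase d :=
  (-2 * B * metricForce g gt (metricPoint u q v), A • metricGradXi g gt (metricPoint u q v),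
    A * metricForce g gt (metricPoint u q v), -(A • metricGradY g gt (metricPoint u q v)))

theorem unifSmooth_metricPoint {ι E : Type*} [NormedAddCommGroup E] [NormedSpace ℝ E] {n : ℕ}
    {U : ι → Set E} {u : ι → E → ℝ} {q : ι → E → Scaled d} {v : ι → E → Phase d}
    (hu : UnifSmooth n U u) (hq : UnifSmooth n U q) (hv : UnifSmooth n U v) :
    UnifSmooth n U (fun i e => metricPoint (u i e) (q i e) (v i e)) :=
  hq.fst.prodMk (hq.snd.fst.prodMk (hu.prodMk ((hq.snd.snd.fst.add (hq.fst.smul hv.snd.fst)).prodMk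
    (hq.snd.snd.snd.snd.add (hq.fst.smul hv.snd.snd.snd)))))

theorem unifSmooth_scaledField (hg : Admissible g gt) {Y : ℝ} {ι E : Type*} [NormedAddCommGroup E]
    [NormedSpace ℝ E] {n : ℕ} {U : ι → Set E} {u A B : ι → E → ℝ} {q : ι → E → Scaled d}
    {v : ι → E → Phase d} (hu : UnifSmooth n U u) (hA : UnifSmooth n U A) (hB : UnifSmooth n U B)
    (hq : UnifSmooth n U q) (hv : UnifSmooth n U v)
    (hm : ∀ i, ∀ e ∈ U i, metricPoint (u i e) (q i e) (v i e) ∈ metricBox d Y) :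
    UnifSmooth n U (fun i e => scaledField g gt (u i e) (A i e) (B i e) (q i e) (v i e)) := by
  have hp := unifSmooth_metricPoint hu hq hv
  have h1 := ((unifSmooth_metricForce hg Y n).reindex fun _ : ι => ()).comp hp hm
  have h2 := ((unifSmooth_metricGradY hg Y n).reindex fun _ : ι => ()).comp hp hm
  have h3 := ((unifSmooth_metricGradXi hg Y n).reindex fun _ : ι => ()).comp hp hm
  exact (((UnifSmooth.const hu.isOpen (-2 : ℝ)).mul hB).mul h1).prodMk
    ((hA.smul h3).prodMk ((hA.mul h1).prodMk (hA.smul h2).neg))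

/-- The time `s` with `τ = 1 - e^{-s}`. -/
noncomputable def unscaledTime (τ : ℝ) : ℝ := -Real.log (1 - τ)

/-- The factor `u = e^{-(r_s - r)}` at the time `s`. -/
noncomputable def weightU (s : ℝ) (q : Scaled d) (v : Phase d) : ℝ :=
  Real.exp (-(v.1 + 2 * s * (q.2.2.2.1 + v.2.2.1)))

/-- The rescaled Hamiltonian vector field with respect to the time `τ = 1 - e^{-s}`. -/
noncomputable def timeField (g : Base d → QuadraticForm ℝ (Base d))
    (gt : ℝ → Base d → QuadraticForm ℝ (Base d)) (τ : ℝ) (w : Scaled d × Phase d) : Phase d :=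
  scaledField g gt (weightU (unscaledTime τ) w.1 w.2)
    (Real.exp (unscaledTime τ) * weightU (unscaledTime τ) w.1 w.2 ^ 2)
    (unscaledTime τ * (Real.exp (unscaledTime τ) * weightU (unscaledTime τ) w.1 w.2 ^ 2)) w.1 w.2

theorem unscaledTime_nonneg {τ : ℝ} (h : τ ∈ Ico (0 : ℝ) 1) : 0 ≤ unscaledTime τ := by
  rw [unscaledTime, neg_nonneg]
  exact Real.log_nonpos (by linarith [h.2]) (by linarith [h.1])

theorem unscaledTime_lower {τ : ℝ} (h : τ ∈ Ioo (-(1 / 10) : ℝ) 1) :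
    -(1 / 10) ≤ unscaledTime τ := by
  have h1 : 0 < 1 - τ := by linarith [h.2]
  have := Real.log_le_sub_one_of_pos h1
  rw [unscaledTime]
  linarith [h.1]

theorem contDiffOn_unscaledTime : ContDiffOn ℝ ∞ unscaledTime (Iio 1) := by
  unfold unscaledTime
  refine (ContDiffOn.log (by fun_prop) fun τ hτ => ?_).neg
  have : τ < 1 := hτ
  linarith

/-- The domain of the rescaled vector field. -/
def stateBox (d : ℕ) (x₀ Y κ : ℝ) : Set (Scaled d × Phase d) :=
  box d x₀ Y (1 / 4) κ ×ˢ Metric.ball 0 (1 / 10)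

variable {x₀ Y κ : ℝ}

theorem isOpen_stateBox : IsOpen (stateBox d x₀ Y κ) := isOpen_box.prod Metric.isOpen_ball

theorem convex_stateBox : Convex ℝ (stateBox d x₀ Y κ) := convex_box.prod (convex_ball _ _)

theorem isBounded_stateBox : Bornology.IsBounded (stateBox d x₀ Y κ) :=
  isBounded_box.prod Metric.isBounded_ball

theorem norm_components_le {v : Phase d} {c : ℝ} (h : ‖v‖ ≤ c) :
    |v.1| ≤ c ∧ ‖v.2.1‖ ≤ c ∧ |v.2.2.1| ≤ c ∧ ‖v.2.2.2‖ ≤ c :=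
  ⟨(norm_fst_le v).trans h, (norm_fst_le v.2).trans ((norm_snd_le v).trans h),
    (norm_fst_le v.2.2).trans ((norm_snd_le v.2).trans ((norm_snd_le v).trans h)),
    (norm_snd_le v.2.2).trans ((norm_snd_le v.2).trans ((norm_snd_le v).trans h))⟩

/-- The current momentum σρ is within 1/4 + 1/10 of 1. Hence 2σρ > 1 and 4σρ - 1 > 1, the rates at
which u and e^s u² decay in s. -/
theorem rho_mem_of_mem_stateBox {w : Scaled d × Phase d} (hw : w ∈ stateBox d x₀ Y κ) :
    |w.2.1| ≤ 1 / 10 ∧ w.1.2.2.2.1 + w.2.2.2.1 ∈ Ioo (0.65 : ℝ) 1.35 := by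
  obtain ⟨h1, -, h3, -⟩ := norm_components_le (mem_ball_zero_iff.1 hw.2).le
  obtain ⟨-, -, -, h2, -⟩ := mem_box.1 hw.1
  rw [abs_lt] at h2
  rw [abs_le] at h3
  refine ⟨h1, ?_, ?_⟩ <;> norm_num at * <;> linarith [h2.1, h2.2, h3.1, h3.2]

/-- Small negative times are allowed in order to have two-sided derivatives at time 0; there the
exponent of u is at most 1/10 + 2 · 1.35 / 10 < 1/2. -/
theorem weightU_mem {w : Scaled d × Phase d} (hw : w ∈ stateBox d x₀ Y κ) {s : ℝ}
    (hs : -(1 / 10) ≤ s) : weightU s w.1 w.2 ∈ Ioo (0 : ℝ) 2 := by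
  obtain ⟨h1, h2, h3⟩ := rho_mem_of_mem_stateBox hw
  rw [abs_le] at h1
  refine ⟨Real.exp_pos _, ?_⟩
  have h4 : -(w.2.1 + 2 * s * (w.1.2.2.2.1 + w.2.2.2.1)) ≤ 1 / 2 := by
    norm_num at *
    nlinarith
  have h5 : Real.exp (1 / 2) < 2 := by
    have h6 : Real.exp (1 / 2) ^ 2 = Real.exp 1 := by
      rw [← Real.exp_nat_mul]; norm_num
    have h7 := Real.exp_one_lt_d9
    nlinarith [Real.exp_pos (1 / 2)]
  exact (Real.exp_le_exp.2 h4).trans_lt h5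

theorem exp_mul_weightU_sq (s : ℝ) (q : Scaled d) (v : Phase d) :
    Real.exp s * weightU s q v ^ 2 =
      Real.exp (-2 * v.1) * Real.exp (-(s * (4 * (q.2.2.2.1 + v.2.2.1) - 1))) := by
  rw [weightU, ← Real.exp_nat_mul, ← Real.exp_add, ← Real.exp_add]
  congr 1
  push_cast
  ring

/-- The exponent of e^s u² is -2 v.1 - s(4σρ - 1), at most 1 for s ≥ -1/10. For s ≥ 0 the factor s
is absorbed by a further e^s, since 4σρ > 2. -/
theorem weights_le {w : Scaled d × Phase d} (hw : w ∈ stateBox d x₀ Y κ) {s : ℝ}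
    (hs : -(1 / 10) ≤ s) : |Real.exp s * weightU s w.1 w.2 ^ 2| ≤ 3 ∧
      |s * (Real.exp s * weightU s w.1 w.2 ^ 2)| ≤ 3 := by
  obtain ⟨h1, h2, h3⟩ := rho_mem_of_mem_stateBox hw
  rw [abs_le] at h1
  have he : Real.exp 1 < 3 := Real.exp_one_lt_d9.trans (by norm_num)
  have h0 : 0 ≤ Real.exp s * weightU s w.1 w.2 ^ 2 := by positivity
  have hA : Real.exp s * weightU s w.1 w.2 ^ 2 ≤ 3 := by
    rw [exp_mul_weightU_sq, ← Real.exp_add]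
    refine (Real.exp_le_exp.2 (?_ : _ ≤ (1 : ℝ))).trans he.le
    norm_num at *
    nlinarith
  refine ⟨by rwa [abs_of_nonneg h0], ?_⟩
  rw [abs_mul, abs_of_nonneg h0]
  rcases le_total 0 s with h | h
  · rw [abs_of_nonneg h]
    have h4 : s ≤ Real.exp s := by linarith [Real.add_one_le_exp s]
    refine (mul_le_mul_of_nonneg_right h4 h0).trans ?_
    rw [exp_mul_weightU_sq, ← Real.exp_add, ← Real.exp_add]
    refine (Real.exp_le_exp.2 (?_ : _ ≤ (1 : ℝ))).trans he.le
    norm_num at *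
    nlinarith
  · rw [abs_of_nonpos h]
    nlinarith

/-- The displacements enter with the factor x < 1/2, so y and ξ move by at most 1/20. -/
theorem metricPoint_mem (hx : x₀ ≤ 1 / 2) (hκ : κ ≤ 1 / 2) {w : Scaled d × Phase d}
    (hw : w ∈ stateBox d x₀ Y κ) {s : ℝ} (hs : -(1 / 10) ≤ s) :
    metricPoint (weightU s w.1 w.2) w.1 w.2 ∈ metricBox d (Y + 1) := by
  obtain ⟨-, h1, -, h2⟩ := norm_components_le (mem_ball_zero_iff.1 hw.2).le
  obtain ⟨⟨hx1, hx2⟩, h3, h4, -, h5⟩ := mem_box.1 hw.1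
  have hb : ∀ v : Base d, ‖v‖ ≤ 1 / 10 → ‖w.1.1 • v‖ ≤ 1 / 20 := fun v hv => by
    rw [norm_smul, Real.norm_of_nonneg hx1.le]
    have := mul_le_mul (hx2.le.trans hx) hv (norm_nonneg _) (by norm_num)
    linarith
  refine ⟨⟨hx1, hx2.trans_le hx⟩, abs_lt.1 h3, weightU_mem hw hs, ?_, ?_⟩
  · rw [mem_ball_zero_iff]
    exact (norm_add_le _ _).trans_lt (by linarith [hb _ h1])
  · rw [mem_ball_zero_iff]
    exact (norm_add_le _ _).trans_lt (by linarith [hb _ h2])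

/-- The time dependent weights are, up to e^{c v.1}, of the form s^j e^{-s r} with r > 1 an affine
function of the state. -/
theorem unifSmooth_timeField (hg : Admissible g gt) (hx : x₀ ≤ 1 / 2) (hκ : κ ≤ 1 / 2) (n : ℕ) :
    UnifSmooth n (fun _ : Ico (0 : ℝ) 1 => stateBox d x₀ Y κ) (fun τ => timeField g gt τ) := by
  have hid := unifSmooth_id (isOpen_stateBox (d := d) (x₀ := x₀) (Y := Y) (κ := κ))
    isBounded_stateBox (Ico (0 : ℝ) 1) n
  have hU : ∀ _ : Ico (0 : ℝ) 1, IsOpen (stateBox d x₀ Y κ) := fun _ => isOpen_stateBox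
  have hexp : ∀ c : ℝ, UnifSmooth n (fun _ : Ico (0 : ℝ) 1 => stateBox d x₀ Y κ)
      (fun _ w => Real.exp (c * w.2.1)) := fun c =>
    unifSmooth_of_contDiffOn isOpen_univ (by fun_prop) isOpen_stateBox isBounded_stateBox
      (subset_univ _) n
  let e : Ico (0 : ℝ) 1 → Ici (0 : ℝ) := fun τ => ⟨unscaledTime τ, unscaledTime_nonneg τ.2⟩
  have hrho := hid.fst.snd.snd.snd.fst.add hid.snd.snd.snd.fst
  have hu := ((unifSmooth_pow_mul_exp n 0).reindex e).comp ((UnifSmooth.const hU (2 : ℝ)).mul hrho)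
    fun τ w hw => by
      have := (rho_mem_of_mem_stateBox hw).2.1
      rw [mem_Ioi]; norm_num at *; linarith
  have hA : ∀ j, UnifSmooth n (fun _ : Ico (0 : ℝ) 1 => stateBox d x₀ Y κ) fun τ w =>
      (e τ : ℝ) ^ j * Real.exp (-(e τ * (4 * (w.1.2.2.2.1 + w.2.2.2.1) - 1))) := fun j =>
    ((unifSmooth_pow_mul_exp n j).reindex e).comp (((UnifSmooth.const hU (4 : ℝ)).mul hrho).sub
      (UnifSmooth.const hU 1)) fun τ w hw => by
        have := (rho_mem_of_mem_stateBox hw).2.1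
        rw [mem_Ioi]; norm_num at *; linarith
  refine unifSmooth_scaledField hg (Y := Y + 1) (((hexp (-1)).mul hu).congr fun τ w hw => ?_)
    (((hexp (-2)).mul (hA 0)).congr fun τ w hw => ?_)
    (((hexp (-2)).mul (hA 1)).congr fun τ w hw => ?_) hid.fst hid.snd fun τ w hw =>
      metricPoint_mem hx hκ hw (by linarith [unscaledTime_nonneg τ.2])
  · rw [weightU, pow_zero, one_mul, ← Real.exp_add]
    congr 1
    simp only [e]
    ring
  · rw [exp_mul_weightU_sq, pow_zero, one_mul]
  · rw [exp_mul_weightU_sq, pow_one]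
    ring

theorem contDiffOn_weightU :
    ContDiffOn ℝ ∞ (fun z : ℝ × Scaled d × Phase d => weightU (unscaledTime z.1) z.2.1 z.2.2)
      (Iio 1 ×ˢ univ) := by
  have h1 : ContDiffOn ℝ ∞ (fun z : ℝ × Scaled d × Phase d => unscaledTime z.1) (Iio 1 ×ˢ univ) :=
    contDiffOn_unscaledTime.comp contDiffOn_fst fun z hz => hz.1
  unfold weightU
  refine ContDiffOn.exp (ContDiffOn.neg (ContDiffOn.add (by fun_prop) (ContDiffOn.mul
    (contDiffOn_const.mul h1) (by fun_prop))))

/-- Away from τ = 1 the weights are smooth on a neighbourhood of the compact closure, which yields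
joint smoothness in time and state. -/
theorem unifSmooth_timeField_joint (hg : Admissible g gt) (hx : x₀ ≤ 1 / 2) (hκ : κ ≤ 1 / 2)
    {M : ℝ} (hM : M < 1) (n : ℕ) :
    UnifSmooth n (fun _ : Unit => Ioo (-(1 / 10) : ℝ) M ×ˢ stateBox d x₀ Y κ)
      (fun _ z => timeField g gt z.1 z.2) := by
  have hUo : IsOpen (Ioo (-(1 / 10) : ℝ) M ×ˢ stateBox d x₀ Y κ) := isOpen_Ioo.prod isOpen_stateBox
  have hUb : Bornology.IsBounded (Ioo (-(1 / 10) : ℝ) M ×ˢ stateBox d x₀ Y κ) :=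
    (Metric.isBounded_Ioo _ _).prod isBounded_stateBox
  have hid := unifSmooth_id hUo hUb Unit n
  have hcl : closure (Ioo (-(1 / 10) : ℝ) M ×ˢ stateBox d x₀ Y κ) ⊆ Iio 1 ×ˢ univ := by
    rw [closure_prod_eq]
    exact prod_mono ((closure_mono Ioo_subset_Iio_self).trans
      (by rw [closure_Iio]; exact Iic_subset_Iio.2 hM)) (subset_univ _)
  have hO : IsOpen (Iio (1 : ℝ) ×ˢ (univ : Set (Scaled d × Phase d))) := isOpen_Iio.prod isOpen_univ
  have h1 : ContDiffOn ℝ ∞ (fun z : ℝ × Scaled d × Phase d => unscaledTime z.1) (Iio 1 ×ˢ univ) :=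
    contDiffOn_unscaledTime.comp contDiffOn_fst fun z hz => hz.1
  have h2 := h1.exp.mul (contDiffOn_weightU.pow 2)
  exact unifSmooth_scaledField hg (Y := Y + 1)
    (unifSmooth_of_contDiffOn hO contDiffOn_weightU hUo hUb hcl n)
    (unifSmooth_of_contDiffOn hO h2 hUo hUb hcl n)
    (unifSmooth_of_contDiffOn hO (h1.mul h2) hUo hUb hcl n) hid.snd.fst hid.snd.snd
    fun _ z hz => metricPoint_mem hx hκ hz.2
      (unscaledTime_lower ⟨hz.1.1, hz.1.2.trans hM⟩)

theorem contDiffOn_timeField (hg : Admissible g gt) (hx : x₀ ≤ 1 / 2) (hκ : κ ≤ 1 / 2) :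
    ContDiffOn ℝ ∞ (fun z : ℝ × Scaled d × Phase d => timeField g gt z.1 z.2)
      (Ioo (-(1 / 10)) 1 ×ˢ stateBox d x₀ Y κ) := by
  rintro ⟨τ, w⟩ ⟨hτ, hw⟩
  refine ContDiffAt.contDiffWithinAt (contDiffAt_infty.2 fun n => ?_)
  obtain ⟨M, hM1, hM2⟩ := exists_between hτ.2
  have h1 := unifSmooth_timeField_joint (Y := Y) hg hx hκ hM2 n
  exact (h1.contDiffOn ()).contDiffAt ((h1.isOpen ()).mem_nhds ⟨⟨hτ.1, hM1⟩, hw⟩)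

end ScaledField


/-! ### Existence and size of the displacement -/

section Existence

open Filter Topology

/-- The Picard fixed point is taken in a space of curves confined to the ball, which gives the
confinement along with the solution. -/
theorem exists_integralCurve_mem_closedBall {E : Type*} [NormedAddCommGroup E] [NormedSpace ℝ E]
    [CompleteSpace E] {f : ℝ → E → E} {a b R L : ℝ} (h0 : (0 : ℝ) ∈ Icc a b) {K : NNReal}
    (hL : ∀ t ∈ Icc a b, LipschitzOnWith K (f t) (Metric.closedBall 0 R))
    (hc : ∀ x ∈ Metric.closedBall (0 : E) R, ContinuousOn (fun t => f t x) (Icc a b))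
    (hb : ∀ t ∈ Icc a b, ∀ x ∈ Metric.closedBall (0 : E) R, ‖f t x‖ ≤ L) (hR : 0 ≤ R)
    (hLR : L * max b (-a) ≤ R) :
    ∃ γ : ℝ → E, γ 0 = 0 ∧ ∀ t ∈ Icc a b, ‖γ t‖ ≤ R ∧
      HasDerivWithinAt γ (f t (γ t)) (Icc a b) t := by
  have hL0 : 0 ≤ L := (norm_nonneg _).trans (hb 0 h0 0 (Metric.mem_closedBall_self hR))
  lift R to NNReal using hR
  lift L to NNReal using hL0
  have hf : IsPicardLindelof f (⟨0, h0⟩ : Icc a b) 0 R 0 L K :=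
    ⟨hL, hc, hb, by simpa using hLR⟩
  obtain ⟨α, hα⟩ := ODE.FunSpace.exists_isFixedPt_next hf (Metric.mem_closedBall_self le_rfl)
  refine ⟨α.compProj, ?_, fun t ht => ⟨?_, ?_⟩⟩
  · have h1 := ODE.FunSpace.compProj_val (α := α) (t := (⟨0, h0⟩ : Icc a b))
    rw [h1, ← hα, ODE.FunSpace.next_apply₀]
  · simpa using α.compProj_mem_closedBall hf.mul_max_le (t := t)
  · refine (ODE.hasDerivWithinAt_picard_Icc h0 hf.continuousOn_uncurry
      α.continuous_compProj.continuousOn (fun _ _ => α.compProj_mem_closedBall hf.mul_max_le)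
      0 ht).congr_of_mem (fun t' ht' => ?_) ht
    nth_rw 1 [← hα]
    rw [ODE.FunSpace.compProj_of_mem ht', ODE.FunSpace.next_apply]

variable {d : ℕ} {g : Base d → QuadraticForm ℝ (Base d)}
  {gt : ℝ → Base d → QuadraticForm ℝ (Base d)} {x₀ Y κ : ℝ}

/-- The field is evaluated at the current ξ + x v.η, so the weights and the homogeneity of the
metric give quadratic bounds in it, except for the y-component, which contains a derivative in ξ and
is linear. -/
theorem exists_bound_timeField (hg : Admissible g gt) (Y : ℝ) :
    ∃ C, 0 ≤ C ∧ ∀ x₀ ≤ (1 / 2 : ℝ), ∀ κ ≤ (1 / 2 : ℝ), ∀ w ∈ stateBox d x₀ Y κ,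
      ∀ τ ∈ Ioo (-(1 / 10) : ℝ) 1,
        ‖w.1.2.2.2.2 + w.1.1 • w.2.2.2.2‖ ≤ 1 ∧
        |(timeField g gt τ w).1| ≤ C * ‖w.1.2.2.2.2 + w.1.1 • w.2.2.2.2‖ ^ 2 ∧
        ‖(timeField g gt τ w).2.1‖ ≤ C * ‖w.1.2.2.2.2 + w.1.1 • w.2.2.2.2‖ ∧
        |(timeField g gt τ w).2.2.1| ≤ C * ‖w.1.2.2.2.2 + w.1.1 • w.2.2.2.2‖ ^ 2 ∧
        ‖(timeField g gt τ w).2.2.2‖ ≤ C * ‖w.1.2.2.2.2 + w.1.1 • w.2.2.2.2‖ ^ 2 := by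
  obtain ⟨C, hC0, hC⟩ := exists_bound_metric hg (Y + 1)
  refine ⟨6 * C, by positivity, fun x₀ hx κ hκ w hw τ hτ => ?_⟩
  have hp := metricPoint_mem hx hκ hw (unscaledTime_lower hτ)
  obtain ⟨hA, hB⟩ := weights_le hw (unscaledTime_lower hτ)
  obtain ⟨-, h2, h3, h4⟩ := hC _ hp
  set p := metricPoint (weightU (unscaledTime τ) w.1 w.2) w.1 w.2 with hp'
  have hξ : p.2.2.2.2 = w.1.2.2.2.2 + w.1.1 • w.2.2.2.2 := rfl
  rw [← hξ]
  have hn := norm_nonneg p.2.2.2.2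
  have hsq : 0 ≤ C * ‖p.2.2.2.2‖ ^ 2 := by positivity
  have hsn : 0 ≤ C * ‖p.2.2.2.2‖ := by positivity
  refine ⟨(mem_ball_zero_iff.1 hp.2.2.2.2).le, ?_, ?_, ?_, ?_⟩
  · simp only [timeField, scaledField, ← hp']
    rw [abs_mul, abs_mul, show |(-2 : ℝ)| = 2 by norm_num, mul_assoc]
    have := mul_le_mul hB h2 (abs_nonneg _) (by norm_num)
    linarith
  · simp only [timeField, scaledField, ← hp']
    rw [norm_smul, Real.norm_eq_abs]
    have := mul_le_mul hA h4 (norm_nonneg _) (by norm_num)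
    linarith
  · simp only [timeField, scaledField, ← hp']
    rw [abs_mul]
    have := mul_le_mul hA h2 (abs_nonneg _) (by norm_num)
    linarith
  · simp only [timeField, scaledField, ← hp']
    rw [norm_neg, norm_smul, Real.norm_eq_abs]
    have := mul_le_mul hA h3 (norm_nonneg _) (by norm_num)
    linarith

theorem lipschitzOnWith_timeField (hg : Admissible g gt) (hx : x₀ ≤ 1 / 2) (hκ : κ ≤ 1 / 2)
    {b : ℝ} (hb : b < 1) : ∃ K : NNReal, ∀ τ ∈ Ioc (-(1 / 10) : ℝ) b,
      ∀ q ∈ box d x₀ Y (1 / 4) κ,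
        LipschitzOnWith K (fun v => timeField g gt τ (q, v)) (Metric.closedBall 0 (1 / 20)) := by
  obtain ⟨M, hM1, hM2⟩ := exists_between hb
  have h1 := unifSmooth_timeField_joint (Y := Y) hg hx hκ hM2 (0 + 1)
  obtain ⟨C, hC0, hC⟩ := h1.norm_fderiv_le
  refine ⟨⟨C, hC0⟩, fun τ hτ q hq => LipschitzOnWith.of_dist_le_mul fun v hv v' hv' => ?_⟩
  have hmem : ∀ v ∈ Metric.closedBall (0 : Phase d) (1 / 20),
      (τ, q, v) ∈ Ioo (-(1 / 10) : ℝ) M ×ˢ stateBox d x₀ Y κ := fun v hv =>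
    ⟨⟨hτ.1, hτ.2.trans_lt hM1⟩, hq, Metric.closedBall_subset_ball (by norm_num) hv⟩
  have h2 := norm_sub_le_of_fderiv_le ((convex_Ioo _ _).prod convex_stateBox)
    (fun z hz => h1.differentiableAt (i := ()) hz) (fun z hz => hC () z hz) (hmem v' hv')
    (hmem v hv)
  rw [dist_eq_norm, dist_eq_norm]
  refine h2.trans_eq ?_
  congr 1
  simp [Prod.norm_def]

/-- While |v| ≤ 1/20 the speed is at most C(κ + x₀) ≤ 1/20, and the time available in either
direction is at most 1. So the solution never leaves the ball and exists up to the ends of the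
interval. -/
theorem exists_scaled_solution (hg : Admissible g gt) {C : ℝ} (hC0 : 0 ≤ C)
    (hx0 : 0 < x₀) (hx : x₀ ≤ 1 / 2) (hκ : κ ≤ 1 / 2)
    (hC : ∀ w ∈ stateBox d x₀ Y κ, ∀ τ ∈ Ioo (-(1 / 10) : ℝ) 1,
      ‖timeField g gt τ w‖ ≤ C * ‖w.1.2.2.2.2 + w.1.1 • w.2.2.2.2‖)
    (hsmall : C * (κ + x₀) ≤ 1 / 20) {q : Scaled d} (hq : q ∈ box d x₀ Y (1 / 4) κ) :
    ∃ v : ℝ → Phase d, v 0 = 0 ∧ ∀ τ ∈ Ioo (-(1 / 10) : ℝ) 1, ‖v τ‖ ≤ 1 / 20 ∧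
      HasDerivAt v (timeField g gt τ (q, v τ)) τ := by
  have hmem : ∀ v ∈ Metric.closedBall (0 : Phase d) (1 / 20), (q, v) ∈ stateBox d x₀ Y κ :=
    fun v hv => ⟨hq, Metric.closedBall_subset_ball (by norm_num) hv⟩
  have hcont := (contDiffOn_timeField (Y := Y) hg hx hκ).continuousOn
  -- Compact intervals around 0 exhausting (-1/10, 1); the Lipschitz constant is controlled only on
  -- such intervals.
  let a : ℕ → ℝ := fun n => -(1 / 10) * (1 - 1 / ((n : ℝ) + 2))
  let b : ℕ → ℝ := fun n => 1 - 1 / ((n : ℝ) + 2)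
  have hn : ∀ n : ℕ, 0 < 1 / ((n : ℝ) + 2) ∧ 1 / ((n : ℝ) + 2) ≤ 1 / 2 := fun n =>
    ⟨by positivity, one_div_le_one_div_of_le (by norm_num) (by linarith [n.cast_nonneg (α := ℝ)])⟩
  have ha : ∀ n, -(1 / 10) < a n ∧ a n < 0 := fun n => by
    obtain ⟨h1, h2⟩ := hn n
    constructor <;> simp only [a] <;> nlinarith
  have hb : ∀ n, 0 < b n ∧ b n < 1 := fun n => by
    obtain ⟨h1, h2⟩ := hn n
    constructor <;> simp only [b] <;> linarith
  have hsub : ∀ n, Icc (a n) (b n) ⊆ Ioo (-(1 / 10) : ℝ) 1 := fun n t ht =>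
    ⟨(ha n).1.trans_le ht.1, ht.2.trans_lt (hb n).2⟩
  have hsol : ∀ n : ℕ, ∃ γ : ℝ → Phase d, γ 0 = 0 ∧ ∀ t ∈ Icc (a n) (b n), ‖γ t‖ ≤ 1 / 20 ∧
      HasDerivWithinAt γ (timeField g gt t (q, γ t)) (Icc (a n) (b n)) t := by
    intro n
    obtain ⟨K, hK⟩ := lipschitzOnWith_timeField (Y := Y) hg hx hκ (hb n).2
    refine exists_integralCurve_mem_closedBall (f := fun t v => timeField g gt t (q, v))
      (K := K) (L := 1 / 20)
      ⟨(ha n).2.le, (hb n).1.le⟩ (fun t ht => hK t ⟨(ha n).1.trans_le ht.1, ht.2⟩ q hq)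
      (fun v hv => hcont.comp (f := fun t : ℝ => (t, q, v)) (by fun_prop)
        fun t ht => ⟨hsub n ht, hmem v hv⟩)
      (fun t ht v hv => (hC _ (hmem v hv) t (hsub n ht)).trans
        ((mul_le_mul_of_nonneg_left ?_ hC0).trans hsmall)) (by norm_num) ?_
    · obtain ⟨⟨h1, h2⟩, -, -, -, h3⟩ := mem_box.1 hq
      have h4 := (norm_components_le (mem_closedBall_zero_iff.1 hv)).2.2.2
      refine (norm_add_le _ _).trans ?_
      rw [norm_smul, Real.norm_of_nonneg h1.le]
      nlinarith [norm_nonneg v.2.2.2]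
    · have : max (b n) (-a n) ≤ 1 := max_le (hb n).2.le (by linarith [(ha n).1])
      linarith
  choose γ h0 hγ using hsol
  have hder : ∀ n : ℕ, ∀ t ∈ Ioo (a n) (b n), HasDerivAt (γ n) (timeField g gt t (q, γ n t)) t :=
    fun n t ht => (hγ n t (Ioo_subset_Icc_self ht)).2.hasDerivAt (Icc_mem_nhds ht.1 ht.2)
  obtain ⟨Γ, hΓ⟩ := exists_eqOn_of_monotone (fun n : ℕ => Icc (a n) (b n)) γ fun n m hnm => by
    have hnm' : (n : ℝ) ≤ m := by exact_mod_cast hnm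
    have h1 : 1 / ((m : ℝ) + 2) ≤ 1 / ((n : ℝ) + 2) :=
      one_div_le_one_div_of_le (by positivity) (by linarith)
    have ha' : a m ≤ a n := by simp only [a]; nlinarith
    have hb' : b n ≤ b m := by simp only [b]; linarith
    have hsub : Icc (a n) (b n) ⊆ Icc (a m) (b m) := Icc_subset_Icc ha' hb'
    obtain ⟨K, hK⟩ := lipschitzOnWith_timeField (Y := Y) hg hx hκ (hb n).2
    exact ODE_solution_unique_of_mem_Icc (v := fun t v => timeField g gt t (q, v))
      (s := fun _ => Metric.closedBall 0 (1 / 20)) (K := K) (t₀ := 0)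
      (fun t ht => hK t ⟨(ha n).1.trans ht.1, ht.2.le⟩ q hq) ⟨(ha n).2, (hb n).1⟩
      (fun t ht => (hγ n t ht).2.continuousWithinAt) (hder n)
      (fun t ht => mem_closedBall_zero_iff.2 (hγ n t (Ioo_subset_Icc_self ht)).1)
      (fun t ht => ((hγ m t (hsub ht)).2.continuousWithinAt).mono hsub)
      (fun t ht => hder m t ⟨ha'.trans_lt ht.1, ht.2.trans_le hb'⟩)
      (fun t ht => mem_closedBall_zero_iff.2 (hγ m t (hsub (Ioo_subset_Icc_self ht))).1)
      ((h0 n).trans (h0 m).symm)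
  refine ⟨Γ, (hΓ 0 ⟨(ha 0).2.le, (hb 0).1.le⟩).trans (h0 0), fun t ht => ?_⟩
  have hex : ∃ n : ℕ, t ∈ Ioo (a n) (b n) := by
    have hδ : 0 < min (1 - t) (10 * (t + 1 / 10)) :=
      lt_min (by linarith [ht.2]) (by linarith [ht.1])
    obtain ⟨n, hn⟩ := exists_nat_one_div_lt hδ
    have h1 : 1 / ((n : ℝ) + 2) ≤ 1 / ((n : ℝ) + 1) :=
      one_div_le_one_div_of_le (by positivity) (by linarith)
    have h2 := h1.trans_lt hn
    have h3 := h2.trans_le (min_le_left _ _)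
    have h4 := h2.trans_le (min_le_right _ _)
    refine ⟨n, ?_, ?_⟩
    · simp only [a]; linarith
    · simp only [b]; linarith
  obtain ⟨n, hn⟩ := hex
  have h1 : Γ =ᶠ[𝓝 t] γ n := eventuallyEq_of_mem (Icc_mem_nhds hn.1 hn.2) (hΓ n)
  rw [h1.eq_of_nhds]
  exact ⟨(hγ n t (Ioo_subset_Icc_self hn)).1, (hder n t hn).congr_of_eventuallyEq h1⟩

/-- A solution of the rescaled equations with the uniform bounds which follow from them. -/
structure IsScaledFlow (g : Base d → QuadraticForm ℝ (Base d))
    (gt : ℝ → Base d → QuadraticForm ℝ (Base d)) (x₀ Y κ C : ℝ) (v : ℝ → Scaled d → Phase d) :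
    Prop where
  init : ∀ q ∈ box d x₀ Y (1 / 4) κ, v 0 q = 0
  norm_le : ∀ q ∈ box d x₀ Y (1 / 4) κ, ∀ τ ∈ Ioo (-(1 / 10) : ℝ) 1, ‖v τ q‖ ≤ 1 / 20
  hasDerivAt : ∀ q ∈ box d x₀ Y (1 / 4) κ, ∀ τ ∈ Ioo (-(1 / 10) : ℝ) 1,
    HasDerivAt (fun τ => v τ q) (timeField g gt τ (q, v τ q)) τ
  estimates : ∀ q ∈ box d x₀ Y (1 / 4) κ, ∀ τ ∈ Ico (0 : ℝ) 1,
    ‖q.2.2.2.2 + q.1 • (v τ q).2.2.2‖ ≤ C * ‖q.2.2.2.2‖ ∧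
    |(v τ q).1| ≤ C * ‖q.2.2.2.2‖ ^ 2 ∧ ‖(v τ q).2.1‖ ≤ C * ‖q.2.2.2.2‖ ∧
    |(v τ q).2.2.1| ≤ C * ‖q.2.2.2.2‖ ^ 2 ∧ ‖(v τ q).2.2.2‖ ≤ C * ‖q.2.2.2.2‖ ^ 2

/-- Grönwall first shows that the current ξ stays comparable to the initial one; the quadratic and
linear bounds of the field are then integrated over the time interval. -/
theorem exists_isScaledFlow (hg : Admissible g gt) (Y : ℝ) :
    ∃ x₀ κ C v, 0 < x₀ ∧ x₀ ≤ 1 / 2 ∧ 0 < κ ∧ κ ≤ 1 / 2 ∧ 0 ≤ C ∧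
      IsScaledFlow (d := d) g gt x₀ Y κ C v := by
  obtain ⟨C, hC0, hC⟩ := exists_bound_timeField hg Y
  -- The same number serves as x₀ and as κ; the last condition keeps the speed below 1/20.
  obtain ⟨x₀, hx0, hx, hxC⟩ : ∃ x₀ : ℝ, 0 < x₀ ∧ x₀ ≤ 1 / 2 ∧ C * (x₀ + x₀) ≤ 1 / 20 := by
    refine ⟨1 / (40 * (C + 1)), by positivity, ?_, ?_⟩
    · rw [div_le_div_iff₀ (by positivity) (by norm_num)]; nlinarith
    · rw [← two_mul, ← mul_assoc, mul_one_div, div_le_div_iff₀ (by positivity) (by norm_num)]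
      nlinarith
  have hC' : ∀ w ∈ stateBox d x₀ Y x₀, ∀ τ ∈ Ioo (-(1 / 10) : ℝ) 1,
      ‖timeField g gt τ w‖ ≤ C * ‖w.1.2.2.2.2 + w.1.1 • w.2.2.2.2‖ := by
    intro w hw τ hτ
    obtain ⟨h0, h1, h2, h3, h4⟩ := hC x₀ hx x₀ hx w hw τ hτ
    have h5 : ‖w.1.2.2.2.2 + w.1.1 • w.2.2.2.2‖ ^ 2 ≤ ‖w.1.2.2.2.2 + w.1.1 • w.2.2.2.2‖ := by
      nlinarith [norm_nonneg (w.1.2.2.2.2 + w.1.1 • w.2.2.2.2)]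
    have h6 := mul_le_mul_of_nonneg_left h5 hC0
    exact norm_prod_le_iff.2 ⟨h1.trans h6, norm_prod_le_iff.2 ⟨h2, norm_prod_le_iff.2
      ⟨h3.trans h6, h4.trans h6⟩⟩⟩
  have hsol := fun (q : Scaled d) (hq : q ∈ box d x₀ Y (1 / 4) x₀) =>
    exists_scaled_solution hg hC0 hx0 hx hx hC' hxC hq
  choose! v hv0 hv using hsol
  let D := 1 + C * Real.exp C
  have hD1 : 1 ≤ D := le_add_of_nonneg_right (by positivity)
  refine ⟨x₀, x₀, D + C * D ^ 2 + C * D, fun τ q => v q τ, hx0, hx, hx0, hx, by positivity, ?_⟩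
  refine ⟨hv0, fun q hq τ hτ => (hv q hq τ hτ).1, fun q hq τ hτ => (hv q hq τ hτ).2,
    fun q hq τ hτ => ?_⟩
  have hI : ∀ t ∈ Ico (0 : ℝ) 1, t ∈ Ioo (-(1 / 10) : ℝ) 1 := fun t ht =>
    ⟨by linarith [ht.1], ht.2⟩
  have hF : ∀ t ∈ Ico (0 : ℝ) 1, _ := fun t ht => hC x₀ hx x₀ hx (q, v q t)
    ⟨hq, mem_ball_zero_iff.2 ((hv q hq t (hI t ht)).1.trans_lt (by norm_num))⟩ t (hI t ht)
  obtain ⟨⟨hq1, hq2⟩, -, -, -, -⟩ := mem_box.1 hq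
  have hder : ∀ {F : Type} [NormedAddCommGroup F] [NormedSpace ℝ F] (L : Phase d →L[ℝ] F),
      ∀ t ∈ Ico (0 : ℝ) 1, HasDerivWithinAt (fun t => L (v q t))
        (L (timeField g gt t (q, v q t))) (Ico 0 1) t := fun L t ht =>
    (L.hasFDerivAt.comp_hasDerivAt t (hv q hq t (hI t ht)).2).hasDerivWithinAt
  have hL0 : ∀ {F : Type} [NormedAddCommGroup F] [NormedSpace ℝ F] (L : Phase d →L[ℝ] F),
      ‖L (v q 0)‖ ≤ 0 := fun L => by rw [hv0 q hq, map_zero, norm_zero]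
  let L₁ : Phase d →L[ℝ] ℝ := ContinuousLinearMap.fst ℝ ℝ _
  let L₂ : Phase d →L[ℝ] Base d := (ContinuousLinearMap.fst ℝ (Base d) _).comp
    (ContinuousLinearMap.snd ℝ ℝ _)
  let L₃ : Phase d →L[ℝ] ℝ := (ContinuousLinearMap.fst ℝ ℝ _).comp
    ((ContinuousLinearMap.snd ℝ (Base d) _).comp (ContinuousLinearMap.snd ℝ ℝ _))
  let L₄ : Phase d →L[ℝ] Base d := (ContinuousLinearMap.snd ℝ ℝ _).comp
    ((ContinuousLinearMap.snd ℝ (Base d) _).comp (ContinuousLinearMap.snd ℝ ℝ _))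
  have hsum : ∀ t, ‖q.2.2.2.2 + q.1 • (v q t).2.2.2‖ ≤ ‖q.2.2.2.2‖ + ‖(v q t).2.2.2‖ := fun t => by
    refine (norm_add_le _ _).trans (add_le_add le_rfl ?_)
    rw [norm_smul, Real.norm_of_nonneg hq1.le]
    exact mul_le_of_le_one_left (norm_nonneg _) (by linarith)
  -- Since the current ξ has norm at most 1, its square is bounded by |ξ| + |v.η|, which makes the
  -- inequality for v.η linear.
  have hξ : ∀ t ∈ Ico (0 : ℝ) 1, ‖q.2.2.2.2 + q.1 • (v q t).2.2.2‖ ≤ D * ‖q.2.2.2.2‖ := by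
    intro t ht
    have h1 := norm_le_of_norm_deriv_le (f := fun t => L₄ (v q t)) hC0
      (by positivity : 0 ≤ C * ‖q.2.2.2.2‖) (hder L₄) (hL0 L₄) (fun s hs => by
        obtain ⟨h1, -, -, -, h2⟩ := hF s hs
        refine h2.trans ?_
        rw [← mul_add]
        refine mul_le_mul_of_nonneg_left (le_trans ?_ ((hsum s).trans_eq (add_comm _ _))) hC0
        nlinarith [norm_nonneg (q.2.2.2.2 + q.1 • (v q s).2.2.2)]) t ht
    rw [zero_add] at h1
    have h2 : ‖(v q t).2.2.2‖ ≤ C * ‖q.2.2.2.2‖ * Real.exp C := h1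
    calc _ ≤ ‖q.2.2.2.2‖ + ‖(v q t).2.2.2‖ := hsum t
      _ ≤ ‖q.2.2.2.2‖ + C * ‖q.2.2.2.2‖ * Real.exp C := by linarith
      _ = D * ‖q.2.2.2.2‖ := by simp only [D]; ring
  have hint : ∀ {F : Type} [NormedAddCommGroup F] [NormedSpace ℝ F] (L : Phase d →L[ℝ] F) (ε : ℝ),
      0 ≤ ε → (∀ t ∈ Ico (0 : ℝ) 1, ‖L (timeField g gt t (q, v q t))‖ ≤ ε) →
      ‖L (v q τ)‖ ≤ ε := fun L ε hε h => by
    have h1 := norm_le_of_norm_deriv_le (f := fun t => L (v q t)) le_rfl hε (hder L) (hL0 L)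
      (fun s hs => by rw [zero_mul, zero_add]; exact h s hs) τ hτ
    simpa using h1
  have hsq : ∀ t ∈ Ico (0 : ℝ) 1, C * ‖q.2.2.2.2 + q.1 • (v q t).2.2.2‖ ^ 2 ≤
      C * D ^ 2 * ‖q.2.2.2.2‖ ^ 2 := fun t ht => by
    rw [mul_assoc, ← mul_pow]
    have := hξ t ht
    gcongr
  have hlin : ∀ t ∈ Ico (0 : ℝ) 1, C * ‖q.2.2.2.2 + q.1 • (v q t).2.2.2‖ ≤
      C * D * ‖q.2.2.2.2‖ := fun t ht => by
    rw [mul_assoc]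
    exact mul_le_mul_of_nonneg_left (hξ t ht) hC0
  have hCD : 0 ≤ C * D := by positivity
  have hCD2 : 0 ≤ C * D ^ 2 := by positivity
  have hDD : 0 ≤ D := by positivity
  have h1 := hint L₁ _ (by positivity) fun t ht => (hF t ht).2.1.trans (hsq t ht)
  have h2 := hint L₂ _ (by positivity) fun t ht => (hF t ht).2.2.1.trans (hlin t ht)
  have h3 := hint L₃ _ (by positivity) fun t ht => (hF t ht).2.2.2.1.trans (hsq t ht)
  have h4 := hint L₄ _ (by positivity) fun t ht => (hF t ht).2.2.2.2.trans (hsq t ht)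
  refine ⟨(hξ τ hτ).trans ?_, h1.trans ?_, h2.trans ?_, h3.trans ?_, h4.trans ?_⟩ <;>
    refine mul_le_mul_of_nonneg_right ?_ (by positivity) <;> linarith

end Existence


/-! ### Smoothness of the displacement in time and initial point -/

section Smoothness

open Filter Topology

variable {d : ℕ} {g : Base d → QuadraticForm ℝ (Base d)}
  {gt : ℝ → Base d → QuadraticForm ℝ (Base d)} {x₀ Y κ C : ℝ} {v : ℝ → Scaled d → Phase d}

theorem IsScaledFlow.mem_stateBox (h : IsScaledFlow g gt x₀ Y κ C v) {q : Scaled d}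
    (hq : q ∈ box d x₀ Y (1 / 4) κ) {τ : ℝ} (hτ : τ ∈ Ioo (-(1 / 10) : ℝ) 1) :
    (q, v τ q) ∈ stateBox d x₀ Y κ :=
  ⟨hq, mem_ball_zero_iff.2 ((h.norm_le q hq τ hτ).trans_lt (by norm_num))⟩

/-- The initial point q is a parameter of the equation; adjoining it to the state as a constant
component gives an equation without parameters. -/
theorem IsScaledFlow.unifSmooth (hg : Admissible g gt) (h : IsScaledFlow g gt x₀ Y κ C v)
    (hx : x₀ ≤ 1 / 2) (hκ : κ ≤ 1 / 2) (n : ℕ) :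
    UnifSmooth n (fun _ : Ico (0 : ℝ) 1 => box d x₀ Y (1 / 4) κ) (fun τ => v τ) := by
  have hI : ∀ t ∈ Ico (0 : ℝ) 1, t ∈ Ioo (-(1 / 10) : ℝ) 1 := fun t ht =>
    ⟨by linarith [ht.1], ht.2⟩
  refine (unifSmooth_of_ode n (E := Scaled d × Phase d) (P := Scaled d) (U := stateBox d x₀ Y κ)
    (V := box d x₀ Y (1 / 4) κ) (Ψ := fun τ w => (0, timeField g gt τ w))
    (W := fun τ q => (q, v τ q)) (a := -(1 / 10)) (by norm_num) isOpen_stateBox convex_stateBox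
    isBounded_stateBox isOpen_box isBounded_box
    (fun m => (UnifSmooth.const (fun _ => isOpen_stateBox) 0).prodMk
      (unifSmooth_timeField hg hx hκ m))
    (contDiffOn_const.prodMk (contDiffOn_timeField hg hx hκ))
    (fun m => (unifSmooth_id isOpen_box isBounded_box Unit m).prodMk
      ((UnifSmooth.const (fun _ => isOpen_box) 0).congr fun _ q hq => h.init q hq))
    (fun q hq t ht => h.mem_stateBox hq (hI t ht))
    (fun q hq t ht => ?_)).snd
  exact (hasDerivWithinAt_const t _ q).prodMk (h.hasDerivAt q hq t (hI t ht)).hasDerivWithinAt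

/-- Time is turned into a parameter: t ↦ v(T t, q) solves an equation whose field is T times the
original one at time T t, so smooth dependence on T is dependence on parameters. -/
theorem IsScaledFlow.contDiffOn (hg : Admissible g gt) (h : IsScaledFlow g gt x₀ Y κ C v)
    (hx : x₀ ≤ 1 / 2) (hκ : κ ≤ 1 / 2) :
    ContDiffOn ℝ ∞ (fun z : ℝ × Scaled d => v z.1 z.2)
      (Ioo (-(1 / 20)) 1 ×ˢ box d x₀ Y (1 / 4) κ) := by
  rintro ⟨τ₀, q₀⟩ ⟨hτ₀, hq₀⟩
  refine ContDiffAt.contDiffWithinAt (contDiffAt_infty.2 fun n => ?_)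
  -- The solution is evaluated at t = M < 1 and T = τ₀ / M. The bound M ≥ 1/2 gives T > -1/10
  -- because τ₀ > -1/20, and T < M follows from ((1 + τ₀) / 2)² > τ₀.
  let M := max (1 / 2) ((1 + τ₀) / 2)
  have hM0 : 1 / 2 ≤ M := le_max_left _ _
  have hM1 : M < 1 := max_lt (by norm_num) (by linarith [hτ₀.2])
  have hMτ : (1 + τ₀) / 2 ≤ M := le_max_right _ _
  let J : Set ℝ := Ioo (-(1 / 10)) M
  have hprod : ∀ t ∈ Ioo (-(1 / 10) : ℝ) 1, ∀ T ∈ J, T * t ∈ J := by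
    intro t ht T hT
    simp only [J, mem_Ioo] at *
    rcases le_total 0 T with h0 | h0 <;> rcases le_total 0 t with h1 | h1 <;>
      constructor <;> nlinarith [ht.1, ht.2, hT.1, hT.2]
  have hJ : ∀ T ∈ J, T ∈ Ioo (-(1 / 10) : ℝ) 1 := fun T hT => ⟨hT.1, hT.2.trans hM1⟩
  have hI : ∀ t ∈ Ico (0 : ℝ) 1, t ∈ Ioo (-(1 / 10) : ℝ) 1 := fun t ht =>
    ⟨by linarith [ht.1], ht.2⟩
  let U : Set (ℝ × Scaled d × Phase d) := J ×ˢ stateBox d x₀ Y κ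
  let V : Set (ℝ × Scaled d) := J ×ˢ box d x₀ Y (1 / 4) κ
  have hUo : IsOpen U := isOpen_Ioo.prod isOpen_stateBox
  have hUb : Bornology.IsBounded U := (Metric.isBounded_Ioo _ _).prod isBounded_stateBox
  have hVo : IsOpen V := isOpen_Ioo.prod isOpen_box
  have hVb : Bornology.IsBounded V := (Metric.isBounded_Ioo _ _).prod isBounded_box
  have hΨ : ∀ m, UnifSmooth m (fun _ : Ico (0 : ℝ) 1 => U)
      (fun t z => ((0, 0, z.1 • timeField g gt (z.1 * t) z.2) : ℝ × Scaled d × Phase d)) := by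
    intro m
    have hid := unifSmooth_id hUo hUb (Ico (0 : ℝ) 1) m
    have ht := unifSmooth_const_of_bounded (U := fun _ : Ico (0 : ℝ) 1 => U) (fun _ => hUo)
      (c := fun t => (t : ℝ)) (C := 1) (fun t => by
        rw [Real.norm_of_nonneg t.2.1]; exact t.2.2.le) m
    have h1 := ((unifSmooth_timeField_joint (Y := Y) hg hx hκ hM1 m).reindex
      fun _ : Ico (0 : ℝ) 1 => ()).comp ((hid.fst.mul ht).prodMk hid.snd)
      fun t z hz => ⟨hprod t (hI t t.2) z.1 hz.1, hz.2⟩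
    exact (UnifSmooth.const (fun _ => hUo) 0).prodMk
      ((UnifSmooth.const (fun _ => hUo) 0).prodMk (hid.fst.smul h1))
  have hΨs : ContDiffOn ℝ ∞ (fun p : ℝ × ℝ × Scaled d × Phase d =>
      ((0, 0, p.2.1 • timeField g gt (p.2.1 * p.1) p.2.2) : ℝ × Scaled d × Phase d))
      (Ioo (-(1 / 10)) 1 ×ˢ U) := by
    have h1 : ContDiffOn ℝ ∞ (fun p : ℝ × ℝ × Scaled d × Phase d =>
        timeField g gt (p.2.1 * p.1) p.2.2) (Ioo (-(1 / 10)) 1 ×ˢ U) :=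
      (contDiffOn_timeField (Y := Y) hg hx hκ).comp
        (f := fun p : ℝ × ℝ × Scaled d × Phase d => (p.2.1 * p.1, p.2.2)) (by fun_prop)
        fun p hp => ⟨hJ _ (hprod p.1 hp.1 p.2.1 hp.2.1), hp.2.2⟩
    have h2 : ContDiffOn ℝ ∞ (fun p : ℝ × ℝ × Scaled d × Phase d => p.2.1)
        (Ioo (-(1 / 10)) 1 ×ˢ U) := by fun_prop
    exact contDiffOn_const.prodMk (contDiffOn_const.prodMk (h2.smul h1))
  have key := unifSmooth_of_ode n (E := ℝ × Scaled d × Phase d) (P := ℝ × Scaled d) (U := U)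
    (Ψ := fun t z => (0, 0, z.1 • timeField g gt (z.1 * t) z.2))
    (W := fun t p => (p.1, p.2, v (p.1 * t) p.2)) (V := V)
    (a := -(1 / 10)) (by norm_num) hUo ((convex_Ioo _ _).prod convex_stateBox) hUb hVo hVb hΨ hΨs
    (fun m => (unifSmooth_id hVo hVb Unit m).fst.prodMk
      ((unifSmooth_id hVo hVb Unit m).snd.prodMk
        ((UnifSmooth.const (fun _ => hVo) 0).congr fun _ p hp => by
          rw [mul_zero]; exact h.init p.2 hp.2)))
    (fun p hp t ht => ⟨hp.1, h.mem_stateBox hp.2 (hJ _ (hprod t (hI t ht) p.1 hp.1))⟩)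
    (fun p hp t ht => by
      refine (hasDerivWithinAt_const t _ p.1).prodMk ((hasDerivWithinAt_const t _ p.2).prodMk ?_)
      have h1 := h.hasDerivAt p.2 hp.2 _ (hJ _ (hprod t (hI t ht) p.1 hp.1))
      have h2 : HasDerivAt (fun t => p.1 * t) p.1 t := by
        simpa using (hasDerivAt_id t).const_mul p.1
      exact (h1.scomp t h2).hasDerivWithinAt)
  have hM : M ∈ Ico (0 : ℝ) 1 := ⟨by linarith, hM1⟩
  have h1 := (key.snd.snd).contDiffOn ⟨M, hM⟩
  have hMpos : 0 < M := by linarith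
  have hdiv : τ₀ / M ∈ J := by
    refine ⟨?_, ?_⟩
    · rw [lt_div_iff₀ hMpos]
      linarith [hτ₀.1]
    · rw [div_lt_iff₀ hMpos]
      nlinarith [sq_nonneg (1 - τ₀), hτ₀.2, hτ₀.1]
  have h2 : ContDiffAt ℝ n (fun p : ℝ × Scaled d => v (p.1 * M) p.2) (τ₀ / M, q₀) :=
    h1.contDiffAt (hVo.mem_nhds ⟨hdiv, hq₀⟩)
  have h3 : ContDiffAt ℝ n (fun p : ℝ × Scaled d => (p.1 / M, p.2)) (τ₀, q₀) := by fun_prop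
  have h4 := h2.comp (τ₀, q₀) h3
  refine h4.congr_of_eventuallyEq (Eventually.of_forall fun p => ?_)
  simp only [Function.comp_apply]
  rw [div_mul_cancel₀ _ hMpos.ne']

end Smoothness


/-! ### The Hamiltonian flow expressed through the displacement -/

section FlowFormula

open Filter Topology

variable {d : ℕ} {g : Base d → QuadraticForm ℝ (Base d)}
  {gt : ℝ → Base d → QuadraticForm ℝ (Base d)} {x₀ Y κ C : ℝ} {v : ℝ → Scaled d → Phase d}

/-- The rescaled Hamiltonian function, with reference point `(r, ε)`, around which
`p_ε = ρ² + u² G`. -/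
noncomputable def referencePoint (σ r ε : ℝ) (z : Phase d) : MetricPoint d :=
  (Real.exp (-r), ε * Real.exp (-r), Real.exp (-(z.1 - r)), z.2.1, (σ * Real.exp (-r)) • z.2.2.2)

/-- The factor e^{-2r} is absorbed into ξ = σ e^{-r} η by homogeneity, which leaves u²; the sign
disappears since σ² = 1. -/
theorem phaseHam_eq_scaledMetric {σ : ℝ} (hσ : σ ^ 2 = 1) (r ε : ℝ) (z : Phase d) :
    phaseHam g gt ε z = z.2.2.1 ^ 2 + (referencePoint σ r ε z).2.2.1 ^ 2 *
      scaledMetric g gt (referencePoint σ r ε z) := by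
  have h1 : Real.exp (-r) * Real.exp (-(z.1 - r)) = Real.exp (-z.1) := by
    rw [← Real.exp_add]; ring_nf
  have h2 : Real.exp (-2 * z.1) = Real.exp (-z.1) ^ 2 := by
    rw [← Real.exp_nat_mul]; congr 1; push_cast; ring
  simp only [phaseHam, ham, gEps, scaledMetric, referencePoint, h1, h2, QuadraticMap.map_smul,
    smul_eq_mul]
  have h3 : ε * Real.exp (-r) * Real.exp (-(z.1 - r)) = ε * Real.exp (-z.1) := by
    rw [mul_assoc, h1]
  rw [h3]
  have h4 : Real.exp (-(z.1 - r)) ^ 2 * (σ * Real.exp (-r) * (σ * Real.exp (-r))) =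
      Real.exp (-z.1) ^ 2 := by
    rw [← h1]
    linear_combination (Real.exp (-r) * Real.exp (-(z.1 - r))) ^ 2 * hσ
  linear_combination (-(g z.2.1 z.2.2.2 + ε * Real.exp (-z.1) *
    gt (Real.exp (-z.1)) z.2.1 z.2.2.2)) * h4

/-- Since ∂_r u = -u, the r-derivative of u² G produces the force 2G + u ∂_u G with factor u². The
reference point r is held fixed while differentiating. -/
theorem hamVF_eq_scaled (hg : Admissible g gt) {σ : ℝ} (hσ : σ ^ 2 = 1) (r ε : ℝ) {z : Phase d}
    (hz : referencePoint σ r ε z ∈ metricBox d Y) :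
    hamVF (phaseHam g gt ε) z =
      (2 * z.2.2.1,
        ((referencePoint σ r ε z).2.2.1 ^ 2 * (σ * Real.exp (-r))) •
          metricGradXi g gt (referencePoint σ r ε z),
        (referencePoint σ r ε z).2.2.1 ^ 2 * metricForce g gt (referencePoint σ r ε z),
        -((referencePoint σ r ε z).2.2.1 ^ 2 • metricGradY g gt (referencePoint σ r ε z))) := by
  set p := referencePoint σ r ε z with hp
  have hG : HasFDerivAt (scaledMetric g gt) (fderiv ℝ (scaledMetric g gt) p) p :=
    ((unifSmooth_scaledMetric hg Y (0 + 1)).differentiableAt (i := ()) hz).hasFDerivAt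
  have hP : HasFDerivAt (phaseHam g gt ε) (fderiv ℝ (phaseHam g gt ε) z) z :=
    ((contDiff_phaseHam hg ε).differentiable (by simp) _).hasFDerivAt
  have hu : p.2.2.1 = Real.exp (-(z.1 - r)) := rfl
  have key : ∀ w : Phase d, fderiv ℝ (phaseHam g gt ε) z w = 2 * z.2.2.1 * w.2.2.1 -
      2 * p.2.2.1 ^ 2 * w.1 * scaledMetric g gt p + p.2.2.1 ^ 2 * fderiv ℝ (scaledMetric g gt) p
        (0, 0, -(p.2.2.1 * w.1), w.2.1, (σ * Real.exp (-r)) • w.2.2.2) := by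
    intro w
    have hl : HasDerivAt (fun t : ℝ => z + t • w) w 0 := by
      simpa using ((hasDerivAt_id (0 : ℝ)).smul_const w).const_add z
    have h1 : HasDerivAt (fun t : ℝ => phaseHam g gt ε (z + t • w))
        (fderiv ℝ (phaseHam g gt ε) z w) 0 :=
      HasFDerivAt.comp_hasDerivAt (l := phaseHam g gt ε) (0 : ℝ) (by simpa using hP) hl
    have hr : HasDerivAt (fun t : ℝ => Real.exp (-(z.1 + t * w.1 - r))) (-(p.2.2.1 * w.1)) 0 := by
      have := ((((hasDerivAt_id (0 : ℝ)).mul_const w.1).const_add z.1).sub_const r).neg.exp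
      rw [hu]
      simpa using this
    have hy : HasDerivAt (fun t : ℝ => z.2.1 + t • w.2.1) w.2.1 0 := by
      simpa using ((hasDerivAt_id (0 : ℝ)).smul_const w.2.1).const_add z.2.1
    have hρ : HasDerivAt (fun t : ℝ => z.2.2.1 + t * w.2.2.1) w.2.2.1 0 := by
      simpa using ((hasDerivAt_id (0 : ℝ)).mul_const w.2.2.1).const_add z.2.2.1
    have hη : HasDerivAt (fun t : ℝ => (σ * Real.exp (-r)) • (z.2.2.2 + t • w.2.2.2))
        ((σ * Real.exp (-r)) • w.2.2.2) 0 := by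
      exact ((((hasDerivAt_id (0 : ℝ)).smul_const w.2.2.2).const_add z.2.2.2).const_smul
        (σ * Real.exp (-r))).congr_deriv (by simp)
    have hm : HasDerivAt (fun t : ℝ => referencePoint σ r ε (z + t • w))
        (0, 0, -(p.2.2.1 * w.1), w.2.1, (σ * Real.exp (-r)) • w.2.2.2) 0 :=
      (hasDerivAt_const _ _).prodMk ((hasDerivAt_const _ _).prodMk (hr.prodMk (hy.prodMk hη)))
    have hGm := HasFDerivAt.comp_hasDerivAt (l := scaledMetric g gt)
      (f := fun t : ℝ => referencePoint σ r ε (z + t • w)) (0 : ℝ) (by simpa [← hp] using hG) hm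
    have h2 := (hρ.pow 2).add ((hr.pow 2).mul hGm)
    have h3 : HasDerivAt (fun t : ℝ => phaseHam g gt ε (z + t • w)) _ 0 :=
      h2.congr_of_eventuallyEq (Eventually.of_forall fun t =>
        phaseHam_eq_scaledMetric hσ r ε (z + t • w))
    rw [h1.unique h3]
    simp only [Function.comp_apply, zero_smul, add_zero, zero_mul, ← hp, ← hu, Pi.pow_apply]
    norm_num
    ring
  refine Prod.ext ?_ (Prod.ext ?_ (Prod.ext ?_ ?_))
  · simp only [hamVF, key]
    simp
    exact Or.inr (map_zero _)
  · simp only [hamVF, metricGradXi, ← riesz_apply, ← map_smul]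
    congr 1
    refine ContinuousLinearMap.ext fun w => ?_
    simp only [ContinuousLinearMap.comp_apply, inclEta_apply, key, smul_apply, inclMetricXi_apply,
      mul_zero, zero_mul, neg_zero, sub_zero, zero_add, smul_eq_mul]
    have h1 : ((0, 0, 0, 0, (σ * Real.exp (-r)) • w) : MetricPoint d) =
      (σ * Real.exp (-r)) • (0, 0, 0, 0, w) := by simp
    rw [h1, map_smul, smul_eq_mul]
    ring
  · simp only [hamVF, key, metricForce]
    have h1 : ((0, 0, -(p.2.2.1 * 1), 0, (σ * Real.exp (-r)) • 0) : MetricPoint d) =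
      (-p.2.2.1) • (0, 0, 1, 0, 0) := by simp
    rw [h1, map_smul, smul_eq_mul]
    ring
  · simp only [hamVF, metricGradY, ← riesz_apply, ← map_smul]
    congr 2
    refine ContinuousLinearMap.ext fun w => ?_
    simp only [ContinuousLinearMap.comp_apply, inclY_apply, key, smul_apply, inclMetricY_apply,
      mul_zero, zero_mul, neg_zero, sub_zero, zero_add, smul_eq_mul, smul_zero]

/-- The solution of the rescaled equations as a function of the time `s`. -/
noncomputable def unscale (v : ℝ → Scaled d → Phase d) (s : ℝ) (q : Scaled d) : Phase d :=
  v (1 - Real.exp (-s)) q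

theorem unscaledTime_one_sub_exp (s : ℝ) : unscaledTime (1 - Real.exp (-s)) = s := by
  simp [unscaledTime]

/-- The interval of times in which the rescaled solutions are used. -/
def timeDomain : Set ℝ := {s | -(1 / 20) < 1 - Real.exp (-s)}

theorem isOpen_timeDomain : IsOpen timeDomain :=
  isOpen_lt continuous_const (by fun_prop)

theorem mem_timeDomain {s : ℝ} (hs : s ∈ timeDomain) :
    1 - Real.exp (-s) ∈ Ioo (-(1 / 20) : ℝ) 1 ∧ 1 - Real.exp (-s) ∈ Ioo (-(1 / 10) : ℝ) 1 := by
  have h1 : -(1 / 20) < 1 - Real.exp (-s) := hs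
  have h2 := Real.exp_pos (-s)
  exact ⟨⟨h1, by linarith⟩, ⟨by linarith, by linarith⟩⟩

theorem timeDomain_of_nonneg {s : ℝ} (hs : 0 ≤ s) : s ∈ timeDomain := by
  have : Real.exp (-s) ≤ 1 := Real.exp_le_one_iff.2 (by linarith)
  simp only [timeDomain, mem_ofPred_eq]
  linarith

theorem timeDomain_mono {s s' : ℝ} (hs : s ∈ timeDomain) (h : s ≤ s') : s' ∈ timeDomain := by
  have h1 : -(1 / 20) < 1 - Real.exp (-s) := hs
  have : Real.exp (-s') ≤ Real.exp (-s) := Real.exp_le_exp.2 (by linarith)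
  simp only [timeDomain, mem_ofPred_eq]
  linarith

theorem IsScaledFlow.hasDerivAt_unscale (h : IsScaledFlow g gt x₀ Y κ C v) {q : Scaled d}
    (hq : q ∈ box d x₀ Y (1 / 4) κ) {s : ℝ} (hs : s ∈ timeDomain) :
    HasDerivAt (fun s => unscale v s q) (scaledField g gt (weightU s q (unscale v s q))
      (weightU s q (unscale v s q) ^ 2) (s * weightU s q (unscale v s q) ^ 2) q
        (unscale v s q)) s := by
  have h1 : HasDerivAt (fun s : ℝ => 1 - Real.exp (-s)) (Real.exp (-s)) s := by
    simpa using ((hasDerivAt_id s).neg.exp).const_sub 1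
  have h2 := (h.hasDerivAt q hq _ (mem_timeDomain hs).2).scomp s h1
  refine h2.congr_deriv ?_
  simp only [timeField, unscaledTime_one_sub_exp, scaledField, Prod.smul_mk, smul_eq_mul, smul_neg,
    smul_smul]
  have h3 : ∀ a : ℝ, Real.exp (-s) * (Real.exp s * a) = a := fun a => by
    rw [← mul_assoc, ← Real.exp_add]; simp
  simp only [unscale]
  refine Prod.ext ?_ (Prod.ext ?_ (Prod.ext ?_ ?_))
  · simp only
    linear_combination (-2 * metricForce g gt (metricPoint (weightU s q (v (1 - Real.exp (-s)) q)) q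
      (v (1 - Real.exp (-s)) q)) * s) * h3 (weightU s q (v (1 - Real.exp (-s)) q) ^ 2)
  · simp only [h3]
  · simp only
    rw [← mul_assoc, h3]
  · simp only [h3]

/-- The Hamiltonian flow in terms of the solution of the rescaled equations. -/
noncomputable def flowFormula (v : ℝ → Scaled d → Phase d) (σ ε t : ℝ) (z : Phase d) : Phase d :=
  (z.1 + (unscale v (σ * t) (scaling σ (z, ε))).1 + 2 * (σ * t) *
      (σ * z.2.2.1 + (unscale v (σ * t) (scaling σ (z, ε))).2.2.1),
    z.2.1 + Real.exp (-z.1) • (unscale v (σ * t) (scaling σ (z, ε))).2.1,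
    z.2.2.1 + σ * (unscale v (σ * t) (scaling σ (z, ε))).2.2.1,
    z.2.2.2 + σ • (unscale v (σ * t) (scaling σ (z, ε))).2.2.2)

theorem referencePoint_flowFormula {σ : ℝ} (hσ : σ ^ 2 = 1) (ε t : ℝ) (z : Phase d) :
    referencePoint σ z.1 ε (flowFormula v σ ε t z) =
      metricPoint (weightU (σ * t) (scaling σ (z, ε)) (unscale v (σ * t) (scaling σ (z, ε))))
        (scaling σ (z, ε)) (unscale v (σ * t) (scaling σ (z, ε))) := by
  refine Prod.ext rfl (Prod.ext rfl (Prod.ext ?_ (Prod.ext rfl ?_)))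
  · simp only [referencePoint, metricPoint, weightU, flowFormula]
    congr 1
    simp only [scaling]
    ring
  · simp only [referencePoint, metricPoint, flowFormula]
    simp only [scaling, smul_add, smul_smul]
    congr 2
    linear_combination Real.exp (-z.1) * hσ

/-- In r_t = r + v.1 + 2s(σρ + v.ρ), the term 2s v.ρ' is compensated by v.1' = -2s v.ρ', so that the
velocity of r is exactly twice the current momentum. -/
theorem IsScaledFlow.hasDerivAt_flowFormula (hg : Admissible g gt)
    (h : IsScaledFlow g gt x₀ Y κ C v) (hx : x₀ ≤ 1 / 2) (hκ : κ ≤ 1 / 2) {σ : ℝ} (hσ : σ ^ 2 = 1)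
    {ε t : ℝ} {z : Phase d} (hq : scaling σ (z, ε) ∈ box d x₀ Y (1 / 4) κ)
    (ht : σ * t ∈ timeDomain) :
    HasDerivAt (fun t => flowFormula v σ ε t z) (hamField g gt ε (flowFormula v σ ε t z)) t := by
  set q := scaling σ (z, ε) with hq'
  set w := unscale v (σ * t) q with hw
  set u := weightU (σ * t) q w with hu
  have hs : -(1 / 10) ≤ σ * t := by
    have := unscaledTime_lower (mem_timeDomain ht).2
    rwa [unscaledTime_one_sub_exp] at this
  have hp : metricPoint u q w ∈ metricBox d (Y + 1) :=
    metricPoint_mem hx hκ (h.mem_stateBox hq (mem_timeDomain ht).2) hs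
  have href := referencePoint_flowFormula (v := v) hσ ε t z
  rw [← hq', ← hw, ← hu] at href
  have h1 : HasDerivAt (fun t => unscale v (σ * t) q)
      (σ • scaledField g gt u (u ^ 2) (σ * t * u ^ 2) q w) t := by
    have h2 : HasDerivAt (fun t => σ * t) σ t := by simpa using (hasDerivAt_id t).const_mul σ
    exact (h.hasDerivAt_unscale hq ht).scomp t h2
  rw [hamField_eq_hamVF hg, hamVF_eq_scaled hg hσ z.1 ε (by rw [href]; exact hp), href]
  have hc : ∀ {F : Type} [NormedAddCommGroup F] [NormedSpace ℝ F] (L : Phase d →L[ℝ] F),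
      HasDerivAt (fun t => L (unscale v (σ * t) q))
        (L (σ • scaledField g gt u (u ^ 2) (σ * t * u ^ 2) q w)) t := fun L =>
    L.hasFDerivAt.comp_hasDerivAt t h1
  have hb : HasDerivAt (fun t => (unscale v (σ * t) q).1) _ t :=
    hc (ContinuousLinearMap.fst ℝ ℝ _)
  have hy : HasDerivAt (fun t => (unscale v (σ * t) q).2.1) _ t :=
    hc ((ContinuousLinearMap.fst ℝ (Base d) _).comp (ContinuousLinearMap.snd ℝ ℝ _))
  have hρ : HasDerivAt (fun t => (unscale v (σ * t) q).2.2.1) _ t :=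
    hc ((ContinuousLinearMap.fst ℝ ℝ _).comp
      ((ContinuousLinearMap.snd ℝ (Base d) _).comp (ContinuousLinearMap.snd ℝ ℝ _)))
  have hη : HasDerivAt (fun t => (unscale v (σ * t) q).2.2.2) _ t :=
    hc ((ContinuousLinearMap.snd ℝ ℝ _).comp
      ((ContinuousLinearMap.snd ℝ (Base d) _).comp (ContinuousLinearMap.snd ℝ ℝ _)))
  have ht2 : HasDerivAt (fun t => 2 * (σ * t)) (2 * σ) t := by
    simpa using ((hasDerivAt_id t).const_mul σ).const_mul 2
  have hfin := ((hb.const_add z.1).add (ht2.mul (hρ.const_add (σ * z.2.2.1)))).prodMk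
    ((((hy.const_smul (Real.exp (-z.1)))).const_add z.2.1).prodMk
      (((hρ.const_mul σ).const_add z.2.2.1).prodMk ((hη.const_smul σ).const_add z.2.2.2)))
  refine hfin.congr_deriv ?_
  simp only [ContinuousLinearMap.comp_apply, ContinuousLinearMap.coe_fst',
    ContinuousLinearMap.coe_snd', Prod.smul_fst, Prod.smul_snd, scaledField, smul_eq_mul,
    ← hw, flowFormula, ← hq', smul_neg, smul_smul]
  have hσ' : σ * σ = 1 := by rw [← sq]; exact hσ
  refine Prod.ext ?_ (Prod.ext ?_ (Prod.ext ?_ ?_))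
  · simp only
    linear_combination (2 * z.2.2.1) * hσ'
  · simp only [metricPoint]
    congr 1
    ring
  · simp only [metricPoint]
    rw [← mul_assoc, hσ', one_mul]
  · simp only [metricPoint]
    rw [← mul_assoc, hσ', one_mul]

/-- Uniqueness of integral curves on an open interval containing 0 and all t with σt ≥ 0. -/
theorem IsScaledFlow.flow_eq (hg : Admissible g gt) (h : IsScaledFlow g gt x₀ Y κ C v)
    (hx : x₀ ≤ 1 / 2) (hκ : κ ≤ 1 / 2) {φ : ℝ → ℝ → Phase d → Phase d} (hφ : IsHamFlow g gt φ)
    {σ : ℝ} (hσ : σ = 1 ∨ σ = -1) {ε t : ℝ} (hε : ε ∈ Icc (0 : ℝ) 1) {z : Phase d}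
    (hq : scaling σ (z, ε) ∈ box d x₀ Y (1 / 4) κ) (ht : σ * t ∈ timeDomain) :
    φ ε t z = flowFormula v σ ε t z := by
  have hσ2 : σ ^ 2 = 1 := by rcases hσ with rfl | rfl <;> norm_num
  let I : Set ℝ := {t | σ * t ∈ timeDomain}
  have hIo : IsOpen I := isOpen_timeDomain.preimage (by fun_prop)
  have hI : I.OrdConnected := ⟨fun a ha b hb c hc => by
    rcases hσ with rfl | rfl
    · exact timeDomain_mono ha (by linarith [hc.1])
    · exact timeDomain_mono hb (by linarith [hc.2])⟩
  have h0 : (0 : ℝ) ∈ I := by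
    simp only [I, mem_ofPred_eq, mul_zero]
    exact timeDomain_of_nonneg le_rfl
  have h1 := hφ.eq_of_hasDerivAt hg hε (γ := fun t => flowFormula v σ ε t z) hI
    (by rwa [hIo.interior_eq]) (fun s hs => h.hasDerivAt_flowFormula hg hx hκ hσ2 hq hs)
    (t := t) (by rwa [hIo.interior_eq])
  have h2 : flowFormula v σ ε 0 z = z := by
    have h3 : unscale v (σ * 0) (scaling σ (z, ε)) = 0 := by
      simp only [unscale, mul_zero, neg_zero, Real.exp_zero, sub_self]
      exact h.init _ hq
    simp only [flowFormula, h3]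
    simp
  simp only [h2] at h1
  exact h1

end FlowFormula


/-! ### Inversion of the momentum map in scaled variables -/

section Inversion

open Filter Topology

/-- A fixed point of x ↦ p - n x. -/
theorem exists_add_eq_of_contracting {E : Type*} [NormedAddCommGroup E] [CompleteSpace E]
    {n : E → E} {p : E} {ε : ℝ} (hε : 0 ≤ ε) (hb : ∀ x ∈ Metric.closedBall p ε, ‖n x‖ ≤ ε)
    (hL : ∀ x ∈ Metric.closedBall p ε, ∀ y ∈ Metric.closedBall p ε,
      ‖n x - n y‖ ≤ 1 / 4 * ‖x - y‖) : ∃ x ∈ Metric.closedBall p ε, x + n x = p := by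
  have hmaps : MapsTo (fun x => p - n x) (Metric.closedBall p ε) (Metric.closedBall p ε) :=
    fun x hx => by
      rw [Metric.mem_closedBall, dist_eq_norm]
      simpa using hb x hx
  have hcon : ContractingWith (1 / 4 : NNReal) (hmaps.restrict _ _ _) := by
    refine ⟨by rw [← NNReal.coe_lt_coe]; norm_num, LipschitzWith.of_dist_le_mul fun x y => ?_⟩
    rw [Subtype.dist_eq, Subtype.dist_eq, dist_eq_norm, dist_eq_norm]
    simp only [MapsTo.val_restrict_apply, sub_sub_sub_cancel_left]
    rw [norm_sub_rev]
    simpa using hL x x.2 y y.2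
  obtain ⟨x, hx, hfix, -⟩ := hcon.exists_fixedPoint' (Metric.isClosed_closedBall.isComplete) hmaps
    (Metric.mem_closedBall_self hε) (edist_ne_top _ _)
  refine ⟨x, hx, ?_⟩
  have : p - n x = x := hfix
  rw [← this]
  nth_rw 2 [this]
  abel

variable {d : ℕ} {g : Base d → QuadraticForm ℝ (Base d)}
  {gt : ℝ → Base d → QuadraticForm ℝ (Base d)} {x₀ Y κ C : ℝ} {v : ℝ → Scaled d → Phase d}

theorem one_sub_exp_mem {s : ℝ} (hs : 0 ≤ s) : 1 - Real.exp (-s) ∈ Ico (0 : ℝ) 1 := by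
  have h1 : Real.exp (-s) ≤ 1 := Real.exp_le_one_iff.2 (by linarith)
  exact ⟨by linarith, by linarith [Real.exp_pos (-s)]⟩

theorem IsScaledFlow.unifSmoothBox_unscale (hg : Admissible g gt)
    (h : IsScaledFlow g gt x₀ Y κ C v) (hx : x₀ ≤ 1 / 2) (hκ : κ ≤ 1 / 2) :
    UnifSmoothBox x₀ Y (1 / 4) κ (unscale v) := fun n =>
  (h.unifSmooth hg hx hκ n).reindex fun s : Ici (0 : ℝ) =>
    (⟨1 - Real.exp (-s), one_sub_exp_mem s.2⟩ : Ico (0 : ℝ) 1)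

/-- The displacement of the momenta in rescaled variables. -/
noncomputable def momentumShift (v : ℝ → Scaled d → Phase d) (s : ℝ) (q : Scaled d) : Scaled d :=
  (0, 0, 0, (unscale v s q).2.2.1, q.1 • (unscale v s q).2.2.2)

theorem IsScaledFlow.norm_momentumShift_le (h : IsScaledFlow g gt x₀ Y κ C v) (hx : x₀ ≤ 1 / 2)
    {q : Scaled d} (hq : q ∈ box d x₀ Y (1 / 4) κ) {s : ℝ} (hs : 0 ≤ s) :
    ‖momentumShift v s q‖ ≤ C * ‖q.2.2.2.2‖ ^ 2 := by
  obtain ⟨-, -, -, h3, h4⟩ := h.estimates q hq _ (one_sub_exp_mem hs)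
  have hC : 0 ≤ C * ‖q.2.2.2.2‖ ^ 2 := (abs_nonneg _).trans h3
  obtain ⟨⟨h1, h2⟩, -⟩ := mem_box.1 hq
  refine norm_prod_le_iff.2 ⟨by simpa [momentumShift] using hC, norm_prod_le_iff.2
    ⟨by simpa [momentumShift] using hC, norm_prod_le_iff.2 ⟨by simpa [momentumShift] using hC,
      norm_prod_le_iff.2 ⟨h3, ?_⟩⟩⟩⟩
  simp only [momentumShift]
  rw [norm_smul, Real.norm_of_nonneg h1.le]
  exact (mul_le_of_le_one_left (norm_nonneg _) (by linarith)).trans h4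

/-- The inverse of the momentum maps in rescaled variables. -/
structure IsMomentumInverse (x₀ Y κ₁ κ₂ : ℝ) (v : ℝ → Scaled d → Phase d)
    (K : ℝ → Scaled d → Scaled d) : Prop where
  fderiv_le : ∀ s, 0 ≤ s → ∀ q ∈ box d x₀ Y (1 / 4) κ₁, ‖fderiv ℝ (momentumShift v s) q‖ ≤ 1 / 4
  isOpen_image : ∀ s, 0 ≤ s → IsOpen ((fun q => q + momentumShift v s q) '' box d x₀ Y (1 / 4) κ₁)
  left_inv : ∀ s, 0 ≤ s → ∀ q ∈ box d x₀ Y (1 / 4) κ₁, K s (q + momentumShift v s q) = q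
  unifSmooth : ∀ n, UnifSmooth n (fun s : Ici (0 : ℝ) =>
    (fun q => q + momentumShift v s q) '' box d x₀ Y (1 / 4) κ₁) (fun s => K s)
  surj : ∀ s, 0 ≤ s → ∀ q' ∈ box d x₀ Y (1 / 8) κ₂, ∃ q ∈ box d x₀ Y (1 / 4) κ₁,
    q + momentumShift v s q = q' ∧ ‖q.2.2.2.2‖ ≤ 2 * ‖q'.2.2.2.2‖ ∧
      |q.2.2.2.1 - q'.2.2.2.1| ≤ ‖q.2.2.2.2‖

/-- The momentum shift is quadratic in ξ, so its derivative vanishes at ξ = 0 and is small where |ξ|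
< κ₁. Surjectivity onto a smaller box comes from the contraction principle in the momenta alone,
since x, μ and y are not moved. -/
theorem exists_isMomentumInverse (hg : Admissible g gt) (h : IsScaledFlow g gt x₀ Y κ C v)
    (hC0 : 0 ≤ C) (hx : x₀ ≤ 1 / 2) (hκ0 : 0 < κ) (hκ : κ ≤ 1 / 2) :
    ∃ κ₁ κ₂ K, 0 < κ₁ ∧ κ₁ ≤ κ ∧ 0 < κ₂ ∧ κ₂ ≤ κ₁ ∧ IsMomentumInverse (d := d) x₀ Y κ₁ κ₂ v K := by
  have hb := h.unifSmoothBox_unscale hg hx hκ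
  have hN : UnifSmoothBox x₀ Y (1 / 4) κ (momentumShift v) := fun n => by
    have hc : ∀ {F : Type} [NormedAddCommGroup F] [NormedSpace ℝ F] (c : F),
        UnifSmooth n (fun _ : Ici (0 : ℝ) => box d x₀ Y (1 / 4) κ) (fun _ _ => c) := fun c =>
      UnifSmooth.const (fun _ => isOpen_box) c
    exact (hc 0).prodMk ((hc 0).prodMk ((hc 0).prodMk ((hb n).snd.snd.fst.prodMk
      (((unifSmooth_id isOpen_box isBounded_box _ n).fst).smul (hb n).snd.snd.snd))))
  have hNv : VanishAt x₀ Y (1 / 4) κ 2 (momentumShift v) :=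
    UnifSmoothBox.vanishAt_two fun s hs q hq => h.norm_momentumShift_le hx hq hs
  have hD : UnifSmoothBox x₀ Y (1 / 4) κ (fun s => fderiv ℝ (momentumShift v s)) := fun n =>
    (hN (n + 1)).fderiv
  obtain ⟨C₁, hC₁0, hC₁⟩ := hD.norm_le_of_vanishAt fun s hs q hq h0 =>
    ⟨fun _ => (hNv s hs q hq h0).2 le_rfl, fun h => by omega⟩
  have hpos : 0 < 4 * (C + C₁ + 1) := by positivity
  -- Makes C|ξ| and C₁|ξ| at most 1/4: the first bounds the shift by |ξ| / 4, the second its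
  -- derivative by 1/4.
  let κ₁ := min κ (1 / (4 * (C + C₁ + 1)))
  have hκ₁ : 0 < κ₁ := lt_min hκ0 (by positivity)
  have hκ₁κ : κ₁ ≤ κ := min_le_left _ _
  have hκ₁' : (C + C₁ + 1) * κ₁ ≤ 1 / 4 := by
    have : κ₁ ≤ 1 / (4 * (C + C₁ + 1)) := min_le_right _ _
    rw [le_div_iff₀ hpos] at this
    linarith
  have hCκ : C * κ₁ ≤ 1 / 4 := by nlinarith
  have hC₁κ : C₁ * κ₁ ≤ 1 / 4 := by nlinarith
  have hsub : box d x₀ Y (1 / 4) κ₁ ⊆ box d x₀ Y (1 / 4) κ := fun q hq => by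
    obtain ⟨h1, h2, h3, h4, h5⟩ := mem_box.1 hq
    exact mem_box.2 ⟨h1, h2, h3, h4, h5.trans_le hκ₁κ⟩
  have hfd : ∀ s, 0 ≤ s → ∀ q ∈ box d x₀ Y (1 / 4) κ₁,
      ‖fderiv ℝ (momentumShift v s) q‖ ≤ 1 / 4 := fun s hs q hq => by
    refine (hC₁ s hs q (hsub hq)).trans (le_trans ?_ hC₁κ)
    exact mul_le_mul_of_nonneg_left (mem_box.1 hq).2.2.2.2.le hC₁0
  obtain ⟨K, hK1, hK2, hK3⟩ := exists_unifSmooth_inverse (ι := Ici (0 : ℝ))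
    (V := box d x₀ Y (1 / 4) κ₁) isOpen_box convex_box isBounded_box
    (N := fun s => momentumShift v s)
    (fun n => (hN n).mono (fun _ => isOpen_box) fun _ => hsub)
    (fun s q hq => hfd s s.2 q hq)
  -- The value at negative times is arbitrary; max s 0 makes the inverse a function on all of ℝ.
  refine ⟨κ₁, κ₁ / 2, fun s => K ⟨max s 0, mem_Ici.2 (le_max_right _ _)⟩, hκ₁, hκ₁κ, by positivity,
    by linarith, ⟨hfd, fun s hs => hK1 ⟨s, hs⟩, fun s hs q hq => ?_, fun n => ?_, ?_⟩⟩
  · have h1 : (⟨max s 0, mem_Ici.2 (le_max_right _ _)⟩ : Ici (0 : ℝ)) = ⟨s, hs⟩ :=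
      Subtype.ext (max_eq_left hs)
    simp only [h1]
    exact hK2 ⟨s, hs⟩ q hq
  · refine (hK3 n).congr fun s q _ => ?_
    have h1 : (⟨max (s : ℝ) 0, mem_Ici.2 (le_max_right _ _)⟩ : Ici (0 : ℝ)) = s :=
      Subtype.ext (max_eq_left s.2)
    rw [h1]
  · rintro s hs ⟨x, μ, y, ρ', ξ'⟩ hq'
    obtain ⟨h1, h2, h3, h4, h5⟩ := mem_box.1 hq'
    simp only at h1 h2 h3 h4 h5
    -- A ball of radius κ₁ / 4 about momenta with |ρ' - 1| < 1/8 and |ξ'| < κ₁ / 2 stays in the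
    -- larger box.
    have hκ4 : κ₁ / 4 ≤ 1 / 8 := by linarith
    have hmem : ∀ p ∈ Metric.closedBall (ρ', ξ') (κ₁ / 4),
        (x, μ, y, p.1, p.2) ∈ box d x₀ Y (1 / 4) κ₁ := fun p hp => by
      rw [Metric.mem_closedBall, Prod.dist_eq, max_le_iff, Real.dist_eq, dist_eq_norm] at hp
      obtain ⟨hp1, hp2⟩ := hp
      refine mem_box.2 ⟨h1, h2, h3, ?_, ?_⟩
      · simp only
        have := abs_add_le (p.1 - ρ') (ρ' - 1)
        rw [sub_add_sub_cancel] at this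
        linarith
      · simp only
        have := norm_add_le (p.2 - ξ') ξ'
        rw [sub_add_cancel] at this
        linarith
    have hN0 : ∀ q ∈ box d x₀ Y (1 / 4) κ₁, ‖momentumShift v s q‖ ≤ 1 / 4 * ‖q.2.2.2.2‖ :=
      fun q hq => by
        refine (h.norm_momentumShift_le hx (hsub hq) hs).trans ?_
        have h6 := (mem_box.1 hq).2.2.2.2.le
        have h7 : C * ‖q.2.2.2.2‖ ≤ 1 / 4 := (mul_le_mul_of_nonneg_left h6 hC0).trans hCκ
        rw [sq, ← mul_assoc]
        exact mul_le_mul_of_nonneg_right h7 (norm_nonneg _)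
    obtain ⟨p, hp, hpe⟩ := exists_add_eq_of_contracting (p := (ρ', ξ')) (ε := κ₁ / 4)
      (n := fun p => (momentumShift v s (x, μ, y, p.1, p.2)).2.2.2) (by positivity)
      (fun p hp => by
        have h6 := hN0 _ (hmem p hp)
        have h7 := (mem_box.1 (hmem p hp)).2.2.2.2.le
        refine (((norm_snd_le _).trans (norm_snd_le _)).trans (norm_snd_le _)).trans
          (h6.trans ?_)
        linarith)
      (fun p hp p' hp' => by
        have h6 := norm_sub_le_of_fderiv_le convex_box
          (fun q hq => hN.differentiableAt hs (hsub hq)) (hfd s hs) (hmem p' hp') (hmem p hp)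
        have h7 : ‖((x, μ, y, p.1, p.2) : Scaled d) - (x, μ, y, p'.1, p'.2)‖ = ‖p - p'‖ := by
          simp [Prod.norm_def]
        rw [h7] at h6
        refine le_trans ?_ h6
        exact ((norm_snd_le _).trans (norm_snd_le _)).trans (norm_snd_le
          (momentumShift v s (x, μ, y, p.1, p.2) - momentumShift v s (x, μ, y, p'.1, p'.2))))
    have hq := hmem p hp
    have h6 := hN0 _ hq
    have h7 : p.1 + (momentumShift v s (x, μ, y, p.1, p.2)).2.2.2.1 = ρ' := congrArg Prod.fst hpe
    have h8 : p.2 + (momentumShift v s (x, μ, y, p.1, p.2)).2.2.2.2 = ξ' := congrArg Prod.snd hpe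
    have h9 : ‖(momentumShift v s (x, μ, y, p.1, p.2)).2.2.2‖ ≤ 1 / 4 * ‖p.2‖ :=
      (((norm_snd_le _).trans (norm_snd_le _)).trans (norm_snd_le _)).trans h6
    refine ⟨(x, μ, y, p.1, p.2), hq, ?_, ?_, ?_⟩
    · refine Prod.ext (add_zero _) (Prod.ext (add_zero _) (Prod.ext (add_zero _)
        (Prod.ext h7 h8)))
    · simp only
      have h10 : p.2 = ξ' - (momentumShift v s (x, μ, y, p.1, p.2)).2.2.2.2 := by
        rw [← h8, add_sub_cancel_right]
      have h11 : ‖p.2‖ ≤ ‖ξ'‖ + ‖(momentumShift v s (x, μ, y, p.1, p.2)).2.2.2.2‖ := by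
        nth_rw 1 [h10]
        exact norm_sub_le _ _
      have h12 := (norm_snd_le _).trans h9
      linarith [norm_nonneg ξ']
    · simp only
      have h10 : p.1 - ρ' = -(momentumShift v s (x, μ, y, p.1, p.2)).2.2.2.1 := by
        rw [← h7]; ring
      rw [h10, abs_neg]
      exact ((norm_fst_le _).trans h9).trans (by linarith [norm_nonneg p.2])

end Inversion


/-! ### Joint smoothness in time of the inverse and of the action -/

section JointSmoothness

open Filter Topology

/-- Near f a, and on s, the given left inverse coincides with the smooth local inverse. The set s is
needed because the inverse of the momentum map is controlled only for s ≥ 0, while the map is smooth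
across s = 0. -/
theorem contDiffWithinAt_of_leftInverse {E : Type*} [NormedAddCommGroup E] [NormedSpace ℝ E]
    [FiniteDimensional ℝ E] {f k : E → E} {a : E} {s : Set E} (hf : ContDiffAt ℝ ∞ f a)
    (hinj : Function.Injective (fderiv ℝ f a)) (hk : ∀ᶠ x in 𝓝 a, f x ∈ s → k (f x) = x)
    (ha : f a ∈ s) : ContDiffWithinAt ℝ ∞ k s (f a) := by
  have hn : (∞ : WithTop ℕ∞) ≠ 0 := by simp
  let e : E ≃L[ℝ] E := (LinearEquiv.ofInjectiveEndo (fderiv ℝ f a : E →ₗ[ℝ] E)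
    hinj).toContinuousLinearEquiv
  have he : (e : E →L[ℝ] E) = fderiv ℝ f a := ContinuousLinearMap.ext fun _ => rfl
  have hd : HasFDerivAt f (e : E →L[ℝ] E) a := by
    rw [he]
    exact (hf.differentiableAt hn).hasFDerivAt
  have hsd := hf.hasStrictFDerivAt' hd hn
  have h1 := hf.to_localInverse hd hn
  have h2 := hsd.eventually_right_inverse
  have h3 := hsd.localInverse_tendsto.eventually hk
  have h4 : ∀ᶠ y in 𝓝[s] f a, k y = hf.localInverse hd hn y := by
    filter_upwards [nhdsWithin_le_nhds h2, nhdsWithin_le_nhds h3, self_mem_nhdsWithin]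
      with y hy1 hy2 hy3
    rw [hy1] at hy2
    exact hy2 hy3
  exact h1.contDiffWithinAt.congr_of_eventuallyEq h4 (h4.self_of_nhdsWithin ha)

variable {d : ℕ} {g : Base d → QuadraticForm ℝ (Base d)}
  {gt : ℝ → Base d → QuadraticForm ℝ (Base d)} {x₀ Y κ κ₁ κ₂ C : ℝ} {v : ℝ → Scaled d → Phase d}
  {K : ℝ → Scaled d → Scaled d}

theorem box_mono {c c' κ' : ℝ} (hc : c ≤ c') (hκ : κ ≤ κ') :
    box d x₀ Y c κ ⊆ box d x₀ Y c' κ' := fun q hq => by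
  obtain ⟨h1, h2, h3, h4, h5⟩ := mem_box.1 hq
  exact mem_box.2 ⟨h1, h2, h3, h4.trans_le hc, h5.trans_le hκ⟩

theorem IsScaledFlow.contDiffOn_unscale (hg : Admissible g gt) (h : IsScaledFlow g gt x₀ Y κ C v)
    (hx : x₀ ≤ 1 / 2) (hκ : κ ≤ 1 / 2) :
    ContDiffOn ℝ ∞ (fun z : ℝ × Scaled d => unscale v z.1 z.2)
      (timeDomain ×ˢ box d x₀ Y (1 / 4) κ) :=
  (h.contDiffOn hg hx hκ).comp (f := fun z : ℝ × Scaled d => (1 - Real.exp (-z.1), z.2))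
    (by fun_prop) fun _ hz => ⟨(mem_timeDomain hz.1).1, hz.2⟩

theorem IsScaledFlow.contDiffOn_momentumShift (hg : Admissible g gt)
    (h : IsScaledFlow g gt x₀ Y κ C v) (hx : x₀ ≤ 1 / 2) (hκ : κ ≤ 1 / 2) :
    ContDiffOn ℝ ∞ (fun z : ℝ × Scaled d => momentumShift v z.1 z.2)
      (timeDomain ×ˢ box d x₀ Y (1 / 4) κ) := by
  have h1 := h.contDiffOn_unscale hg hx hκ
  exact contDiffOn_const.prodMk (contDiffOn_const.prodMk (contDiffOn_const.prodMk
    (h1.snd.snd.fst.prodMk (contDiffOn_snd.fst.smul h1.snd.snd.snd))))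

namespace IsMomentumInverse

variable (hK : IsMomentumInverse x₀ Y κ₁ κ₂ v K)
include hK

theorem inverse_spec {s : ℝ} (hs : 0 ≤ s) {q' : Scaled d} (hq' : q' ∈ box d x₀ Y (1 / 8) κ₂) :
    K s q' ∈ box d x₀ Y (1 / 4) κ₁ ∧ K s q' + momentumShift v s (K s q') = q' ∧
      ‖(K s q').2.2.2.2‖ ≤ 2 * ‖q'.2.2.2.2‖ ∧
      |(K s q').2.2.2.1 - q'.2.2.2.1| ≤ ‖(K s q').2.2.2.2‖ := by
  obtain ⟨q, hq, he, h1, h2⟩ := hK.surj s hs q' hq'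
  have : K s q' = q := by rw [← he]; exact hK.left_inv s hs q hq
  rw [this]
  exact ⟨hq, he, h1, h2⟩

theorem unifSmoothBox : UnifSmoothBox x₀ Y (1 / 8) κ₂ K := fun n =>
  (hK.unifSmooth n).mono (fun _ => isOpen_box) fun s q' hq' =>
    ⟨K s q', (hK.inverse_spec s.2 hq').1, (hK.inverse_spec s.2 hq').2.1⟩

/-- Applied to (s, q) ↦ (s, q + shift): its differential is triangular, with diagonal blocks 1 and 1
+ D(shift), and is injective since the norm of the second term is at most 1/4. -/
theorem contDiffOn (hg : Admissible g gt) (h : IsScaledFlow g gt x₀ Y κ C v) (hx : x₀ ≤ 1 / 2)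
    (hκ : κ ≤ 1 / 2) (hκ₁ : κ₁ ≤ κ) :
    ContDiffOn ℝ ∞ (fun z : ℝ × Scaled d => K z.1 z.2) (Ici 0 ×ˢ box d x₀ Y (1 / 8) κ₂) := by
  rintro ⟨s, q'⟩ ⟨hs, hq'⟩
  obtain ⟨hq, he, -⟩ := hK.inverse_spec hs hq'
  set q := K s q' with hqd
  let O : Set (ℝ × Scaled d) := timeDomain ×ˢ box d x₀ Y (1 / 4) κ₁
  have hO : IsOpen O := isOpen_timeDomain.prod isOpen_box
  have hsq : (s, q) ∈ O := ⟨timeDomain_of_nonneg hs, hq⟩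
  have hN : ContDiffAt ℝ ∞ (fun z : ℝ × Scaled d => momentumShift v z.1 z.2) (s, q) :=
    ((h.contDiffOn_momentumShift hg hx hκ).mono
      (prod_mono_right (box_mono le_rfl hκ₁))).contDiffAt (hO.mem_nhds hsq)
  let f : ℝ × Scaled d → ℝ × Scaled d := fun z => (z.1, z.2 + momentumShift v z.1 z.2)
  have hf : ContDiffAt ℝ ∞ f (s, q) := contDiffAt_fst.prodMk (contDiffAt_snd.add hN)
  have hNd := (hN.differentiableAt (by simp)).hasFDerivAt
  have hfd : HasFDerivAt f _ (s, q) := hasFDerivAt_fst.prodMk (hasFDerivAt_snd.add hNd)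
  have hfa : f (s, q) = (s, q') := Prod.ext rfl he
  have hpart : ∀ δ, fderiv ℝ (fun z : ℝ × Scaled d => momentumShift v z.1 z.2) (s, q) (0, δ) =
      fderiv ℝ (momentumShift v s) q δ := fun δ => by
    have h1 : HasFDerivAt (fun q => momentumShift v s q) _ q :=
      HasFDerivAt.comp (g := fun z : ℝ × Scaled d => momentumShift v z.1 z.2) q hNd
        ((hasFDerivAt_const s q).prodMk (hasFDerivAt_id q))
    exact (congrArg (fun L => L δ) h1.fderiv).symm
  have hinj : Function.Injective (fderiv ℝ f (s, q)) := by
    rw [hfd.fderiv, injective_iff_map_eq_zero]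
    rintro ⟨τ, δ⟩ h0
    have h1 : τ = 0 := congrArg Prod.fst h0
    have h2 : δ + fderiv ℝ (fun z : ℝ × Scaled d => momentumShift v z.1 z.2) (s, q) (τ, δ) = 0 :=
      congrArg Prod.snd h0
    rw [h1, hpart] at h2
    have h3 := (fderiv ℝ (momentumShift v s) q).le_of_opNorm_le (hK.fderiv_le s hs q hq) δ
    rw [← norm_neg, ← eq_neg_of_add_eq_zero_left h2] at h3
    have h4 : ‖δ‖ = 0 := by linarith [norm_nonneg δ]
    rw [h1, norm_eq_zero.1 h4]
    rfl
  have hk : ∀ᶠ x in 𝓝 (s, q), f x ∈ Ici (0 : ℝ) ×ˢ (univ : Set (Scaled d)) →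
      ((fun z : ℝ × Scaled d => (z.1, K z.1 z.2)) (f x)) = x := by
    filter_upwards [hO.mem_nhds hsq] with x hx hfx
    exact Prod.ext rfl (hK.left_inv _ hfx.1 _ hx.2)
  have key := (contDiffWithinAt_of_leftInverse (k := fun z : ℝ × Scaled d => (z.1, K z.1 z.2))
    (s := Ici (0 : ℝ) ×ˢ univ) hf hinj hk ⟨hs, trivial⟩).snd
  rw [hfa] at key
  exact key.mono (prod_mono_right (subset_univ _))

theorem unifSmoothBox_comp {V : Type*} [NormedAddCommGroup V] [NormedSpace ℝ V]
    {H : ℝ → Scaled d → V} (hH : UnifSmoothBox x₀ Y (1 / 4) κ H) (hκ₁ : κ₁ ≤ κ) :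
    UnifSmoothBox x₀ Y (1 / 8) κ₂ (fun s q' => H s (K s q')) := fun n =>
  (hH n).comp (hK.unifSmoothBox n) fun s _ hq' =>
    box_mono le_rfl hκ₁ (hK.inverse_spec s.2 hq').1

/-- The inverse at most doubles |ξ|, so quadratic bounds persist. -/
theorem vanishAt_comp {V : Type*} [NormedAddCommGroup V] [NormedSpace ℝ V]
    {H : ℝ → Scaled d → V} (hC : 0 ≤ C) (hκ₁ : κ₁ ≤ κ)
    (hH : ∀ s, 0 ≤ s → ∀ q ∈ box d x₀ Y (1 / 4) κ, ‖H s q‖ ≤ C * ‖q.2.2.2.2‖ ^ 2) :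
    VanishAt x₀ Y (1 / 8) κ₂ 2 (fun s q' => H s (K s q')) :=
  UnifSmoothBox.vanishAt_two (C := C * 4) fun s hs q' hq' => by
    obtain ⟨hq, -, h1, -⟩ := hK.inverse_spec hs hq'
    refine (hH s hs _ (box_mono le_rfl hκ₁ hq)).trans ?_
    rw [mul_assoc]
    refine mul_le_mul_of_nonneg_left ?_ hC
    have := pow_le_pow_left₀ (norm_nonneg _) h1 2
    linarith

theorem contDiffOn_comp {V : Type*} [NormedAddCommGroup V] [NormedSpace ℝ V]
    {H : ℝ → Scaled d → V} (hg : Admissible g gt) (h : IsScaledFlow g gt x₀ Y κ C v)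
    (hx : x₀ ≤ 1 / 2) (hκ : κ ≤ 1 / 2) (hκ₁ : κ₁ ≤ κ)
    (hH : ContDiffOn ℝ ∞ (fun z : ℝ × Scaled d => H z.1 z.2)
      (timeDomain ×ˢ box d x₀ Y (1 / 4) κ)) :
    ContDiffOn ℝ ∞ (fun z : ℝ × Scaled d => H z.1 (K z.1 z.2))
      (Ici 0 ×ˢ box d x₀ Y (1 / 8) κ₂) :=
  hH.comp (contDiffOn_fst.prodMk (hK.contDiffOn hg h hx hκ hκ₁)) fun _ hz =>
    ⟨timeDomain_of_nonneg hz.1, box_mono le_rfl hκ₁ (hK.inverse_spec hz.1 hz.2).1⟩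

end IsMomentumInverse

/-- The remainder of the generating function in rescaled variables, as a function of the initial
point and of the solution of the rescaled equations. -/
noncomputable def actionRemainder (g : Base d → QuadraticForm ℝ (Base d))
    (gt : ℝ → Base d → QuadraticForm ℝ (Base d)) (s : ℝ) (w : Scaled d × Phase d) : ℝ :=
  (w.1.2.2.2.1 + w.2.2.2.1) * w.2.1 + ⟪w.1.2.2.2.2 + w.1.1 • w.2.2.2.2, w.2.2.1⟫ -
    s * weightU s w.1 w.2 ^ 2 * scaledMetric g gt (metricPoint (weightU s w.1 w.2) w.1 w.2)

/-- The factors u and s u² are bounded with all derivatives by the exponential decay, with rates 2σρ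
and 4σρ both greater than 1. -/
theorem unifSmooth_actionRemainder (hg : Admissible g gt) (hx : x₀ ≤ 1 / 2) (hκ : κ ≤ 1 / 2)
    (n : ℕ) : UnifSmooth n (fun _ : Ici (0 : ℝ) => stateBox d x₀ Y κ)
      (fun s => actionRemainder g gt s) := by
  have hid := unifSmooth_id (isOpen_stateBox (d := d) (x₀ := x₀) (Y := Y) (κ := κ))
    isBounded_stateBox (Ici (0 : ℝ)) n
  have hU : ∀ _ : Ici (0 : ℝ), IsOpen (stateBox d x₀ Y κ) := fun _ => isOpen_stateBox
  have hexp : ∀ c : ℝ, UnifSmooth n (fun _ : Ici (0 : ℝ) => stateBox d x₀ Y κ)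
      (fun _ w => Real.exp (c * w.2.1)) := fun c =>
    unifSmooth_of_contDiffOn isOpen_univ (by fun_prop) isOpen_stateBox isBounded_stateBox
      (subset_univ _) n
  have hrho := hid.fst.snd.snd.snd.fst.add hid.snd.snd.snd.fst
  have hA : ∀ (j : ℕ) (c : ℝ), 2 ≤ c → UnifSmooth n (fun _ : Ici (0 : ℝ) => stateBox d x₀ Y κ)
      fun s w => (s : ℝ) ^ j * Real.exp (-(s * (c * (w.1.2.2.2.1 + w.2.2.2.1)))) := fun j c hc =>
    (unifSmooth_pow_mul_exp n j).comp ((UnifSmooth.const hU c).mul hrho) fun s w hw => by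
      have := (rho_mem_of_mem_stateBox hw).2.1
      rw [mem_Ioi]; norm_num at *; nlinarith
  have hu : UnifSmooth n (fun _ : Ici (0 : ℝ) => stateBox d x₀ Y κ)
      fun s w => weightU s w.1 w.2 := ((hexp (-1)).mul (hA 0 2 le_rfl)).congr fun s w hw => by
    rw [weightU, pow_zero, one_mul, ← Real.exp_add]
    congr 1
    ring
  have hu2 : UnifSmooth n (fun _ : Ici (0 : ℝ) => stateBox d x₀ Y κ)
      fun s w => s * weightU s w.1 w.2 ^ 2 :=
    ((hexp (-2)).mul (hA 1 4 (by norm_num))).congr fun s w hw => by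
      rw [weightU, pow_one, ← Real.exp_nat_mul, mul_left_comm (Real.exp _), ← Real.exp_add]
      congr 2
      push_cast
      ring
  have hG := ((unifSmooth_scaledMetric hg (Y + 1) n).reindex fun _ : Ici (0 : ℝ) => ()).comp
    (unifSmooth_metricPoint hu hid.fst hid.snd) fun s w hw =>
      metricPoint_mem hx hκ hw (by linarith [mem_Ici.1 s.2])
  exact ((hrho.mul hid.snd.fst).add ((hid.fst.snd.snd.snd.snd.add
    (hid.fst.fst.smul hid.snd.snd.snd.snd)).bilin
      (isBoundedBilinearMap_inner (𝕜 := ℝ) (E := Base d)).toContinuousLinearMap hid.snd.snd.fst)).sub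
      (hu2.mul hG)

theorem contDiffOn_actionRemainder (hg : Admissible g gt) (hx : x₀ ≤ 1 / 2) (hκ : κ ≤ 1 / 2) :
    ContDiffOn ℝ ∞ (fun z : ℝ × Scaled d × Phase d => actionRemainder g gt z.1 z.2)
      (Ici (-(1 / 10)) ×ˢ stateBox d x₀ Y κ) := by
  have hu : ContDiff ℝ ∞ (fun z : ℝ × Scaled d × Phase d => weightU z.1 z.2.1 z.2.2) := by
    unfold weightU
    fun_prop
  have hp : ContDiff ℝ ∞ (fun z : ℝ × Scaled d × Phase d =>
      metricPoint (weightU z.1 z.2.1 z.2.2) z.2.1 z.2.2) := by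
    unfold metricPoint
    fun_prop
  have hG : ContDiffOn ℝ ∞ (scaledMetric g gt) (metricBox d (Y + 1)) :=
    contDiffOn_infty.2 fun n => (unifSmooth_scaledMetric hg (Y + 1) n).contDiffOn ()
  have hG' := hG.comp (hp.contDiffOn (s := Ici (-(1 / 10)) ×ˢ stateBox d x₀ Y κ)) fun z hz =>
    metricPoint_mem hx hκ hz.2 hz.1
  have h1 : ContDiff ℝ ∞ (fun z : ℝ × Scaled d × Phase d =>
      (z.2.1.2.2.2.1 + z.2.2.2.2.1) * z.2.2.1) := by fun_prop
  have h2 : ContDiff ℝ ∞ (fun z : ℝ × Scaled d × Phase d =>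
      z.2.1.2.2.2.2 + z.2.1.1 • z.2.2.2.2.2) := by fun_prop
  have h3 : ContDiff ℝ ∞ (fun z : ℝ × Scaled d × Phase d => z.2.2.2.1) := by fun_prop
  exact (h1.add (h2.inner ℝ h3)).contDiffOn.sub ((contDiff_fst.mul (hu.pow 2)).contDiffOn.mul hG')

/-- Each term is quadratic in ξ: the first through v.1, the second as a product of two linear
quantities, the third through the metric. -/
theorem IsScaledFlow.exists_bound_actionRemainder (hg : Admissible g gt)
    (h : IsScaledFlow g gt x₀ Y κ C v) (hC : 0 ≤ C) (hx : x₀ ≤ 1 / 2) (hκ : κ ≤ 1 / 2) :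
    ∃ B, 0 ≤ B ∧ ∀ s, 0 ≤ s → ∀ q ∈ box d x₀ Y (1 / 4) κ,
      ‖actionRemainder g gt s (q, unscale v s q)‖ ≤ B * ‖q.2.2.2.2‖ ^ 2 := by
  obtain ⟨M, hM0, hM⟩ := exists_bound_metric hg (Y + 1)
  refine ⟨2 * C + C ^ 2 + 3 * (M * C ^ 2), by positivity, fun s hs q hq => ?_⟩
  have hτ := one_sub_exp_mem hs
  obtain ⟨h1, h2, h3, h4, h5⟩ := h.estimates q hq _ hτ
  have hw : (q, unscale v s q) ∈ stateBox d x₀ Y κ :=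
    h.mem_stateBox hq ⟨by linarith [hτ.1], hτ.2⟩
  have hs' : -(1 / 10) ≤ s := by linarith
  have hρ := (rho_mem_of_mem_stateBox hw).2
  have hG := (hM _ (metricPoint_mem hx hκ hw hs')).1
  have hsu : |s * weightU s q (unscale v s q) ^ 2| ≤ 3 := by
    have h6 := (weights_le hw hs').2
    have h7 : s * weightU s q (unscale v s q) ^ 2 ≤
        s * (Real.exp s * weightU s q (unscale v s q) ^ 2) :=
      mul_le_mul_of_nonneg_left
        (le_mul_of_one_le_left (sq_nonneg _) (Real.one_le_exp hs)) hs
    rw [abs_of_nonneg (by positivity)] at h6 ⊢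
    exact h7.trans h6
  have e1 : |(q.2.2.2.1 + (unscale v s q).2.2.1) * (unscale v s q).1| ≤
      2 * (C * ‖q.2.2.2.2‖ ^ 2) := by
    rw [abs_mul]
    have h6 : |q.2.2.2.1 + (unscale v s q).2.2.1| ≤ 2 := by
      rw [abs_le]
      have := hρ.1
      have := hρ.2
      norm_num at *
      constructor <;> linarith
    exact mul_le_mul h6 h2 (abs_nonneg _) (by norm_num)
  have e2 : |⟪q.2.2.2.2 + q.1 • (unscale v s q).2.2.2, (unscale v s q).2.1⟫| ≤
      (C * ‖q.2.2.2.2‖) * (C * ‖q.2.2.2.2‖) :=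
    (abs_real_inner_le_norm _ _).trans (mul_le_mul h1 h3 (norm_nonneg _) (by positivity))
  have e3 : |s * weightU s q (unscale v s q) ^ 2 * scaledMetric g gt
      (metricPoint (weightU s q (unscale v s q)) q (unscale v s q))| ≤
      3 * (M * (C * ‖q.2.2.2.2‖) ^ 2) := by
    rw [abs_mul]
    refine mul_le_mul hsu (hG.trans ?_) (abs_nonneg _) (by norm_num)
    gcongr
    exact h1
  rw [Real.norm_eq_abs]
  refine (abs_sub _ _).trans ((add_le_add ((abs_add_le _ _).trans (add_le_add e1 e2)) e3).trans
    (le_of_eq ?_))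
  ring

theorem IsScaledFlow.unifSmoothBox_actionRemainder (hg : Admissible g gt)
    (h : IsScaledFlow g gt x₀ Y κ C v) (hx : x₀ ≤ 1 / 2) (hκ : κ ≤ 1 / 2) :
    UnifSmoothBox x₀ Y (1 / 4) κ (fun s q => actionRemainder g gt s (q, unscale v s q)) := fun n =>
  (unifSmooth_actionRemainder (Y := Y) hg hx hκ n).comp
    ((unifSmooth_id isOpen_box isBounded_box _ n).prodMk (h.unifSmoothBox_unscale hg hx hκ n))
    fun s q hq => by
      have hτ := one_sub_exp_mem s.2
      exact h.mem_stateBox hq ⟨by linarith [hτ.1], hτ.2⟩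

theorem IsScaledFlow.contDiffOn_actionRemainder (hg : Admissible g gt)
    (h : IsScaledFlow g gt x₀ Y κ C v) (hx : x₀ ≤ 1 / 2) (hκ : κ ≤ 1 / 2) :
    ContDiffOn ℝ ∞ (fun z : ℝ × Scaled d => actionRemainder g gt z.1 (z.2, unscale v z.1 z.2))
      (timeDomain ×ˢ box d x₀ Y (1 / 4) κ) :=
  (HypEikonal.contDiffOn_actionRemainder (Y := Y) hg hx hκ).comp
    (contDiffOn_fst.prodMk (contDiffOn_snd.prodMk (h.contDiffOn_unscale hg hx hκ))) fun z hz => by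
      have h1 := mem_timeDomain hz.1
      refine ⟨?_, h.mem_stateBox hz.2 h1.2⟩
      have := unscaledTime_lower h1.2
      rwa [unscaledTime_one_sub_exp] at this

end JointSmoothness


/-! ### The momentum map in the original variables -/

section MomentumDiffeo

open Filter Topology

variable {d : ℕ} {g : Base d → QuadraticForm ℝ (Base d)}
  {gt : ℝ → Base d → QuadraticForm ℝ (Base d)} {x₀ Y κ κ₁ κ₂ C : ℝ} {v : ℝ → Scaled d → Phase d}
  {K : ℝ → Scaled d → Scaled d} {φ : ℝ → ℝ → Phase d → Phase d} {σ : ℝ} {D₀ D₁ : Set (Phase d)}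

/-- The inverse of the momentum map in the original variables. -/
noncomputable def momentumInv (K : ℝ → Scaled d → Scaled d) (σ ε t : ℝ) (z : Phase d) : Phase d :=
  (z.1, z.2.1, σ * (K (σ * t) (scaling σ (z, ε))).2.2.2.1,
    (σ * Real.exp z.1) • (K (σ * t) (scaling σ (z, ε))).2.2.2.2)

theorem momentumMap_eq (hg : Admissible g gt) (h : IsScaledFlow g gt x₀ Y κ C v) (hx : x₀ ≤ 1 / 2)
    (hκ : κ ≤ 1 / 2) (hφ : IsHamFlow g gt φ) (hσ : σ = 1 ∨ σ = -1) {ε t : ℝ}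
    (hε : ε ∈ Icc (0 : ℝ) 1) {z : Phase d} (hq : scaling σ (z, ε) ∈ box d x₀ Y (1 / 4) κ)
    (ht : 0 ≤ σ * t) : momentumMap φ ε t z = (z.1, z.2.1,
      z.2.2.1 + σ * (unscale v (σ * t) (scaling σ (z, ε))).2.2.1,
      z.2.2.2 + σ • (unscale v (σ * t) (scaling σ (z, ε))).2.2.2) := by
  simp only [momentumMap, h.flow_eq hg hx hκ hφ hσ hε hq (timeDomain_of_nonneg ht), flowFormula]

theorem mul_self_of_sign (hσ : σ = 1 ∨ σ = -1) : σ * σ = 1 := by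
  rcases hσ with rfl | rfl <;> norm_num

theorem scaling_add_momentumShift (hσ : σ * σ = 1) (ε s : ℝ) (z : Phase d) :
    scaling σ ((z.1, z.2.1, z.2.2.1 + σ * (unscale v s (scaling σ (z, ε))).2.2.1,
      z.2.2.2 + σ • (unscale v s (scaling σ (z, ε))).2.2.2), ε) =
      scaling σ (z, ε) + momentumShift v s (scaling σ (z, ε)) := by
  generalize hw : unscale v s (scaling σ (z, ε)) = w
  simp only [momentumShift, hw]
  simp only [scaling]
  refine Prod.ext (add_zero _).symm (Prod.ext (add_zero _).symm (Prod.ext (add_zero _).symm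
    (Prod.ext ?_ ?_)))
  · simp only [Prod.fst_add, Prod.snd_add]
    linear_combination w.2.2.1 * hσ
  · simp only [Prod.snd_add, smul_add, smul_smul]
    congr 2
    linear_combination Real.exp (-z.1) * hσ

/-- The shift leaves x, μ, y unchanged, so the scaled inverse lies over the same base point as z and
can be scaled back. -/
theorem scaling_momentumInv (hσ : σ * σ = 1) {ε t : ℝ} {z : Phase d}
    (h : K (σ * t) (scaling σ (z, ε)) + momentumShift v (σ * t) (K (σ * t) (scaling σ (z, ε))) =
      scaling σ (z, ε)) :
    scaling σ (momentumInv K σ ε t z, ε) = K (σ * t) (scaling σ (z, ε)) := by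
  set q := K (σ * t) (scaling σ (z, ε)) with hq
  have h1 := congrArg Prod.fst h
  have h2 := congrArg (fun p => p.2.1) h
  have h3 := congrArg (fun p => p.2.2.1) h
  simp only [momentumShift, Prod.fst_add, Prod.snd_add, add_zero] at h1 h2 h3
  simp only [scaling] at h1 h2 h3
  simp only [momentumInv, ← hq]
  simp only [scaling]
  refine Prod.ext h1.symm (Prod.ext h2.symm (Prod.ext h3.symm (Prod.ext ?_ ?_)))
  · simp only
    linear_combination q.2.2.2.1 * hσ
  · simp only [smul_smul]
    have : σ * Real.exp (-z.1) * (σ * Real.exp z.1) = 1 := by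
      have h4 : Real.exp (-z.1) * Real.exp z.1 = 1 := by rw [← Real.exp_add]; simp
      linear_combination Real.exp (-z.1) * Real.exp z.1 * hσ + h4
    rw [this, one_smul]

theorem scaling_injective (hσ : σ * σ = 1) {ε : ℝ} {z z' : Phase d}
    (h : scaling σ (z, ε) = scaling σ (z', ε)) : z = z' := by
  have hσ0 : σ ≠ 0 := fun h0 => by simp [h0] at hσ
  simp only [scaling, Prod.mk.injEq, Real.exp_eq_exp, neg_inj] at h
  obtain ⟨h1, -, h2, h3, h4⟩ := h
  rw [h1] at h4
  have h5 : σ * Real.exp (-z'.1) ≠ 0 := mul_ne_zero hσ0 (Real.exp_ne_zero _)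
  exact Prod.ext h1 (Prod.ext h2 (Prod.ext (mul_left_cancel₀ hσ0 h3)
    (smul_right_injective _ h5 h4)))

/-- Shows that ρ̃ - ρ and η̃ - η are the displacements at the inverse point, up to the factor -σ;
the symbol estimates apply to this form. -/
theorem momentumInv_components (hσ : σ * σ = 1) {ε t : ℝ} {z : Phase d}
    (h : K (σ * t) (scaling σ (z, ε)) + momentumShift v (σ * t) (K (σ * t) (scaling σ (z, ε))) =
      scaling σ (z, ε)) :
    (momentumInv K σ ε t z).2.2.1 - z.2.2.1 =
        -σ * (unscale v (σ * t) (K (σ * t) (scaling σ (z, ε)))).2.2.1 ∧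
      (momentumInv K σ ε t z).2.2.2 - z.2.2.2 =
        (-σ) • (unscale v (σ * t) (K (σ * t) (scaling σ (z, ε)))).2.2.2 := by
  have h0 := scaling_momentumInv hσ h
  have h1 := scaling_add_momentumShift (v := v) hσ ε (σ * t) (momentumInv K σ ε t z)
  rw [h0, h] at h1
  have h2 := scaling_injective hσ h1
  refine ⟨?_, ?_⟩
  · have h3 := congrArg (fun p : Phase d => p.2.2.1) h2
    simp only at h3
    linarith
  · have h3 := congrArg (fun p : Phase d => p.2.2.2) h2
    simp only at h3
    rw [neg_smul, ← h3]
    abel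

/-- The scaling is injective for fixed ε and conjugates the momentum map to q ↦ q + shift, whose
inverse is known. -/
theorem isDiffeoOntoRange_momentumMap (hg : Admissible g gt) (h : IsScaledFlow g gt x₀ Y κ C v)
    (hx : x₀ ≤ 1 / 2) (hκ : κ ≤ 1 / 2) (hκ₁ : κ₁ ≤ κ) (hK : IsMomentumInverse x₀ Y κ₁ κ₂ v K)
    (hφ : IsHamFlow g gt φ) (hσ : σ = 1 ∨ σ = -1) {ε t : ℝ} (hε : ε ∈ Icc (0 : ℝ) 1)
    (ht : 0 ≤ σ * t) (hD₀ : IsOpen D₀)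
    (hD₀s : ∀ z ∈ D₀, scaling σ (z, ε) ∈ box d x₀ Y (1 / 4) κ₁)
    (hD₁s : ∀ z ∈ D₁, scaling σ (z, ε) ∈ box d x₀ Y (1 / 8) κ₂)
    (hD₁₀ : ∀ z ∈ D₁, momentumInv K σ ε t z ∈ D₀) :
    IsDiffeoOntoRange (momentumMap φ ε t) (momentumInv K σ ε t) D₀ ∧
      D₁ ⊆ momentumMap φ ε t '' D₀ := by
  have hσ2 := mul_self_of_sign hσ
  let M : Scaled d → Scaled d := fun q => q + momentumShift v (σ * t) q
  have hbox : ∀ z ∈ D₀, scaling σ (z, ε) ∈ box d x₀ Y (1 / 4) κ := fun z hz =>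
    box_mono le_rfl hκ₁ (hD₀s z hz)
  have hmap : ∀ z ∈ D₀, momentumMap φ ε t z = (z.1, z.2.1,
      z.2.2.1 + σ * (unscale v (σ * t) (scaling σ (z, ε))).2.2.1,
      z.2.2.2 + σ • (unscale v (σ * t) (scaling σ (z, ε))).2.2.2) := fun z hz =>
    momentumMap_eq hg h hx hκ hφ hσ hε (hbox z hz) ht
  have hscal : ∀ z ∈ D₀, scaling σ (momentumMap φ ε t z, ε) = M (scaling σ (z, ε)) := fun z hz => by
    rw [hmap z hz]
    exact scaling_add_momentumShift hσ2 ε (σ * t) z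
  have hleft : ∀ z ∈ D₀, momentumInv K σ ε t (momentumMap φ ε t z) = z := fun z hz => by
    have h1 : K (σ * t) (scaling σ (momentumMap φ ε t z, ε)) = scaling σ (z, ε) := by
      rw [hscal z hz]
      exact hK.left_inv _ ht _ (hD₀s z hz)
    refine scaling_injective hσ2 (ε := ε) ?_
    rw [scaling_momentumInv (v := v) hσ2, h1]
    rw [h1]
    exact (hscal z hz).symm
  have hright : ∀ z, scaling σ (z, ε) ∈ M '' box d x₀ Y (1 / 4) κ₁ → momentumInv K σ ε t z ∈ D₀ →
      momentumMap φ ε t (momentumInv K σ ε t z) = z := fun z hz hz' => by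
    obtain ⟨q, hq, he⟩ := hz
    have h1 : K (σ * t) (scaling σ (z, ε)) = q := by
      rw [← he]
      exact hK.left_inv _ ht _ hq
    refine scaling_injective hσ2 (ε := ε) ?_
    rw [hscal _ hz', scaling_momentumInv (v := v) hσ2 (by rw [h1]; exact he), h1, he]
  have hscd : ContDiff ℝ ∞ (fun z : Phase d => scaling σ (z, ε)) :=
    (contDiff_scaling σ).comp (contDiff_id.prodMk contDiff_const)
  let R : Set (Phase d) := (fun z => scaling σ (z, ε)) ⁻¹' (M '' box d x₀ Y (1 / 4) κ₁)
  have hR : IsOpen R := (hK.isOpen_image _ ht).preimage hscd.continuous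
  have hinv : ContDiffOn ℝ ∞ (momentumInv K σ ε t) R := by
    have h1 : ContDiffOn ℝ ∞ (K (σ * t)) (M '' box d x₀ Y (1 / 4) κ₁) :=
      contDiffOn_infty.2 fun n => (hK.unifSmooth n).contDiffOn ⟨σ * t, ht⟩
    have h2 : ContDiffOn ℝ ∞ (fun z : Phase d => K (σ * t) (scaling σ (z, ε))) R :=
      h1.comp hscd.contDiffOn fun z hz => hz
    have h3 : ContDiff ℝ ∞ (fun z : Phase d => σ * Real.exp z.1) := by fun_prop
    exact contDiffOn_fst.prodMk (contDiffOn_snd.fst.prodMk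
      ((contDiffOn_const.mul h2.snd.snd.snd.fst).prodMk (h3.contDiffOn.smul h2.snd.snd.snd.snd)))
  -- The range is described as the preimage of an open set under the inverse, which proves it open.
  have himage : momentumMap φ ε t '' D₀ = R ∩ momentumInv K σ ε t ⁻¹' D₀ := by
    refine Subset.antisymm ?_ fun z hz => ⟨_, hz.2, hright z hz.1 hz.2⟩
    rintro _ ⟨z, hz, rfl⟩
    refine ⟨⟨_, hD₀s z hz, (hscal z hz).symm⟩, ?_⟩
    rw [mem_preimage, hleft z hz]
    exact hz
  refine ⟨⟨hD₀, ?_, hleft, ?_, ?_⟩, ?_⟩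
  · rw [himage]
    exact hinv.continuousOn.isOpen_inter_preimage hR hD₀
  · have h1 : ContDiffOn ℝ ∞ (unscale v (σ * t)) (box d x₀ Y (1 / 4) κ) :=
      contDiffOn_infty.2 fun n => (h.unifSmoothBox_unscale hg hx hκ n).contDiffOn ⟨σ * t, ht⟩
    have h2 : ContDiffOn ℝ ∞ (fun z : Phase d => unscale v (σ * t) (scaling σ (z, ε))) D₀ :=
      h1.comp hscd.contDiffOn hbox
    refine ContDiffOn.congr ?_ hmap
    exact contDiffOn_fst.prodMk (contDiffOn_snd.fst.prodMk
      ((contDiffOn_snd.snd.fst.add (contDiffOn_const.mul h2.snd.snd.fst)).prodMk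
        (contDiffOn_snd.snd.snd.add (h2.snd.snd.snd.const_smul σ))))
  · rw [himage]
    exact hinv.mono inter_subset_left
  · intro z hz
    rw [himage]
    obtain ⟨h1, h2, -⟩ := hK.inverse_spec ht (hD₁s z hz)
    exact ⟨⟨_, h1, h2⟩, hD₁₀ z hz⟩

theorem UnifSmoothBox.const_smul {V : Type*} [NormedAddCommGroup V] [NormedSpace ℝ V] {c : ℝ}
    {H : ℝ → Scaled d → V} (hH : UnifSmoothBox x₀ Y c κ H) (a : ℝ) :
    UnifSmoothBox x₀ Y c κ (fun s q => a • H s q) := fun n =>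
  (hH n).clm_comp (a • ContinuousLinearMap.id ℝ V)

theorem expEstimates_of_initial {V : Type*} [NormedAddCommGroup V] [NormedSpace ℝ V]
    {H : ℝ → Scaled d → V} (hK : IsMomentumInverse x₀ Y κ₁ κ₂ v K) (hx : x₀ ≤ 1 / 2) (hκ₁ : κ₁ ≤ κ)
    (hσ : σ = 1 ∨ σ = -1) (hD₁ : IsOpen D₁)
    (hD₁s : MapsTo (scaling σ) (D₁ ×ˢ Ioo (-1) 2) (box d x₀ Y (1 / 8) κ₂))
    (hH : UnifSmoothBox x₀ Y (1 / 4) κ H) {B : ℝ} (hB : 0 ≤ B)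
    (hb : ∀ s, 0 ≤ s → ∀ q ∈ box d x₀ Y (1 / 4) κ, ‖H s q‖ ≤ B * ‖q.2.2.2.2‖ ^ 2) (a : ℝ)
    {F : ℝ → Phase d × ℝ → V} (hF : ∀ t, 0 ≤ σ * t → ∀ p ∈ D₁ ×ˢ Icc (0 : ℝ) 1,
      F t p = a • H (σ * t) (K (σ * t) (scaling σ p))) : ExpEstimates σ D₁ F := by
  have hσ1 : |σ| = 1 := by rcases hσ with rfl | rfl <;> simp
  refine ExpEstimates.congr (expEstimates_of_scaled (H := fun s q' => a • H s (K s q')) hσ1 hD₁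
    hD₁s (by linarith) (hK.unifSmoothBox_comp (hH.const_smul a) hκ₁)
    (hK.vanishAt_comp (H := fun s q => a • H s q) (C := |a| * B) (by positivity) hκ₁
      fun s hs q hq => ?_)) fun t ht p hp => ?_
  · rw [norm_smul, Real.norm_eq_abs, mul_assoc]
    exact mul_le_mul_of_nonneg_left (hb s hs q hq) (abs_nonneg _)
  · exact hF t ht p hp

end MomentumDiffeo


/-! ### The generating function and its derivatives -/

section Generating

open Filter Topology

variable {d : ℕ} {g : Base d → QuadraticForm ℝ (Base d)}
  {gt : ℝ → Base d → QuadraticForm ℝ (Base d)} {x₀ Y κ κ₁ κ₂ C : ℝ} {v : ℝ → Scaled d → Phase d}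
  {K : ℝ → Scaled d → Scaled d} {φ : ℝ → ℝ → Phase d → Phase d} {σ : ℝ} {D₀ D₁ : Set (Phase d)}

/-- The generating function of the inverse momentum maps. -/
noncomputable def generatingFun (g : Base d → QuadraticForm ℝ (Base d))
    (gt : ℝ → Base d → QuadraticForm ℝ (Base d)) (v : ℝ → Scaled d → Phase d)
    (K : ℝ → Scaled d → Scaled d) (σ t : ℝ) (p : Phase d × ℝ) : ℝ :=
  p.1.1 * p.1.2.2.1 + ⟪p.1.2.1, p.1.2.2.2⟫ + t * p.1.2.2.1 ^ 2 +
    σ * actionRemainder g gt (σ * t) (K (σ * t) (scaling σ p),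
      unscale v (σ * t) (K (σ * t) (scaling σ p)))

theorem flowFormula_momentumInv (hσ : σ * σ = 1) {ε t : ℝ} {z : Phase d}
    (h : K (σ * t) (scaling σ (z, ε)) + momentumShift v (σ * t) (K (σ * t) (scaling σ (z, ε))) =
      scaling σ (z, ε)) :
    (flowFormula v σ ε t (momentumInv K σ ε t z)).2.2.1 = z.2.2.1 ∧
      (flowFormula v σ ε t (momentumInv K σ ε t z)).2.2.2 = z.2.2.2 := by
  obtain ⟨h1, h2⟩ := momentumInv_components hσ h
  simp only [flowFormula, scaling_momentumInv hσ h]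
  refine ⟨by linarith, ?_⟩
  rw [neg_smul] at h2
  rw [← sub_eq_zero, add_sub_right_comm, h2, neg_add_cancel]

/-- With final momenta (ρ, η), the free motion contributes rρ + y·η + 2tρ² to the pairing and the
energy takes away tρ² and t u² G; the rest is σ times the remainder because ρ = σ(σρ) and t = σs.
This form exhibits the part that is quadratically small in ξ. -/
theorem pairing_flowFormula_sub (hσ : σ * σ = 1) {ε t : ℝ} {z : Phase d}
    (h : K (σ * t) (scaling σ (z, ε)) + momentumShift v (σ * t) (K (σ * t) (scaling σ (z, ε))) =
      scaling σ (z, ε)) :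
    pairing (flowFormula v σ ε t (momentumInv K σ ε t z))
        (flowFormula v σ ε t (momentumInv K σ ε t z)) -
      t * phaseHam g gt ε (flowFormula v σ ε t (momentumInv K σ ε t z)) =
      generatingFun g gt v K σ t (z, ε) := by
  obtain ⟨h1, h2⟩ := flowFormula_momentumInv hσ h
  have hs := scaling_momentumInv hσ h
  have hP := phaseHam_eq_scaledMetric (g := g) (gt := gt) (σ := σ) (by rw [sq, hσ]) z.1 ε
    (flowFormula v σ ε t (momentumInv K σ ε t z))
  have href := referencePoint_flowFormula (v := v) (σ := σ) (by rw [sq, hσ]) ε t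
    (momentumInv K σ ε t z)
  have hz1 : (momentumInv K σ ε t z).1 = z.1 := rfl
  rw [hz1, hs] at href
  rw [h1, href] at hP
  rw [hP, pairing, h1, h2]
  simp only [flowFormula, hs, generatingFun, actionRemainder]
  set q := K (σ * t) (scaling σ (z, ε)) with hq
  set w := unscale v (σ * t) q with hw
  have e1 : q.2.2.2.1 + w.2.2.1 = σ * z.2.2.1 := by
    have := congrArg (fun p => p.2.2.2.1) h
    simp only [momentumShift, Prod.fst_add, Prod.snd_add] at this
    exact this
  have e2 : q.2.2.2.2 + q.1 • w.2.2.2 = (σ * Real.exp (-z.1)) • z.2.2.2 := by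
    have := congrArg (fun p => p.2.2.2.2) h
    simp only [momentumShift, Prod.snd_add] at this
    exact this
  have e3 : σ * (momentumInv K σ ε t z).2.2.1 = q.2.2.2.1 := by
    simp only [momentumInv, ← hq]
    linear_combination q.2.2.2.1 * hσ
  rw [e3, e1, e2]
  simp only [metricPoint, momentumInv, inner_add_right, inner_smul_right, real_inner_smul_left]
  rw [real_inner_comm z.2.2.2 z.2.1]
  linear_combination (-(z.2.2.1 * w.1) - Real.exp (-z.1) * ⟪z.2.2.2, w.2.1⟫ +
    t * weightU (σ * t) q w ^ 2 * scaledMetric g gt (q.1, q.2.1, weightU (σ * t) q w,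
      q.2.2.1 + q.1 • w.2.1, q.2.2.2.2 + q.1 • w.2.2.2) + 2 * t * z.2.2.1 ^ 2) * hσ

/-- The explicit flow is smooth on an open set of times containing the closed half line, so the
general identities for homogeneous Hamiltonians apply to it. -/
theorem hasFDerivAt_generating_flowFormula (hg : Admissible g gt)
    (h : IsScaledFlow g gt x₀ Y κ C v) (hx : x₀ ≤ 1 / 2) (hκ : κ ≤ 1 / 2)
    (hσ : σ = 1 ∨ σ = -1) {ε t : ℝ} (ht : 0 ≤ σ * t) (hD₀ : IsOpen D₀)
    (hD₀s : ∀ z ∈ D₀, scaling σ (z, ε) ∈ box d x₀ Y (1 / 4) κ) {z : Phase d} (hz : z ∈ D₀) :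
    phaseHam g gt ε (flowFormula v σ ε t z) = phaseHam g gt ε z ∧
    ∃ Z' : ℝ × Phase d →L[ℝ] Phase d, ∃ L : ℝ × Phase d →L[ℝ] ℝ,
      HasFDerivAt (fun p : ℝ × Phase d => flowFormula v σ ε p.1 p.2) Z' (t, z) ∧
      HasFDerivAt (fun p : ℝ × Phase d => pairing (flowFormula v σ ε p.1 p.2)
        (flowFormula v σ ε p.1 p.2) - p.1 * phaseHam g gt ε p.2) L (t, z) ∧
      ∀ w, L w = pairing (Z' w) (flowFormula v σ ε t z) + w.1 * phaseHam g gt ε z +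
        pairing z w.2 := by
  have hσ2 := mul_self_of_sign hσ
  let I : Set ℝ := {t | σ * t ∈ timeDomain}
  have hIo : IsOpen I := isOpen_timeDomain.preimage (by fun_prop)
  have hIc : Convex ℝ I := by
    refine Set.OrdConnected.convex ⟨fun a ha b hb c hc => ?_⟩
    rcases hσ with rfl | rfl
    · exact timeDomain_mono ha (by linarith [hc.1])
    · exact timeDomain_mono hb (by linarith [hc.2])
  have h0 : (0 : ℝ) ∈ I := by
    simp only [I, mem_ofPred_eq, mul_zero]
    exact timeDomain_of_nonneg le_rfl
  have htI : t ∈ I := timeDomain_of_nonneg ht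
  have hopen : IsOpen (I ×ˢ D₀) := hIo.prod hD₀
  have hsc : ContDiff ℝ ∞ (fun p : ℝ × Phase d => (σ * p.1, scaling σ (p.2, ε))) :=
    (contDiff_const.mul contDiff_fst).prodMk
      ((contDiff_scaling σ).comp (contDiff_snd.prodMk contDiff_const))
  have hv : ContDiffOn ℝ ∞ (fun p : ℝ × Phase d => unscale v (σ * p.1) (scaling σ (p.2, ε)))
      (I ×ˢ D₀) :=
    (h.contDiffOn_unscale hg hx hκ).comp hsc.contDiffOn fun p hp => ⟨hp.1, hD₀s p.2 hp.2⟩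
  have hZ : ContDiffOn ℝ ∞ (fun p : ℝ × Phase d => flowFormula v σ ε p.1 p.2) (I ×ˢ D₀) := by
    have a1 : ContDiff ℝ ∞ (fun p : ℝ × Phase d => 2 * (σ * p.1)) := by fun_prop
    have a2 : ContDiff ℝ ∞ (fun p : ℝ × Phase d => σ * p.2.2.2.1) := by fun_prop
    have a3 : ContDiff ℝ ∞ (fun p : ℝ × Phase d => Real.exp (-p.2.1)) := by fun_prop
    exact ((contDiffOn_snd.fst.add hv.fst).add (a1.contDiffOn.mul
      (a2.contDiffOn.add hv.snd.snd.fst))).prodMk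
      ((contDiffOn_snd.snd.fst.add (a3.contDiffOn.smul hv.snd.fst)).prodMk
        ((contDiffOn_snd.snd.snd.fst.add (contDiffOn_const.mul hv.snd.snd.fst)).prodMk
          (contDiffOn_snd.snd.snd.snd.add (hv.snd.snd.snd.const_smul σ))))
  have hZ0 : ∀ z ∈ D₀, flowFormula v σ ε 0 z = z := fun z hz => by
    have h3 : unscale v (σ * 0) (scaling σ (z, ε)) = 0 := by
      simp only [unscale, mul_zero, neg_zero, Real.exp_zero, sub_self]
      exact h.init _ (hD₀s z hz)
    simp only [flowFormula, h3]
    simp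
  have hZd : ∀ t ∈ I, ∀ z ∈ D₀, HasFDerivAt (fun p : ℝ × Phase d => flowFormula v σ ε p.1 p.2)
      (fderiv ℝ (fun p : ℝ × Phase d => flowFormula v σ ε p.1 p.2) (t, z)) (t, z) :=
    fun t ht z hz => ((hZ.contDiffAt (hopen.mem_nhds ⟨ht, hz⟩)).differentiableAt
      (by simp)).hasFDerivAt
  have hZt : ∀ t ∈ I, ∀ z ∈ D₀, fderiv ℝ (fun p : ℝ × Phase d => flowFormula v σ ε p.1 p.2)
      (t, z) (1, 0) = hamVF (phaseHam g gt ε) (flowFormula v σ ε t z) := fun t ht z hz => by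
    have h1 := h.hasDerivAt_flowFormula hg hx hκ (σ := σ) (by rw [sq, hσ2]) (hD₀s z hz) ht
    have h2 : HasDerivAt (fun t => flowFormula v σ ε t z) _ t :=
      HasFDerivAt.comp_hasDerivAt (l := fun p : ℝ × Phase d => flowFormula v σ ε p.1 p.2) t
        (hZd t ht z hz) ((hasDerivAt_id t).prodMk (hasDerivAt_const t z))
    rw [← hamField_eq_hamVF hg]
    exact h2.unique h1
  have hP := contDiff_phaseHam hg ε
  have hE := pairing_hamVF_phaseHam hg ε
  obtain ⟨L, hL1, hL2⟩ := hasFDerivAt_generating hP hE hIo hIc h0 hD₀ hZ hZ0 hZt htI hz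
  exact ⟨(pairing_fderiv_flow hP hE hIo hIc h0 hD₀ hZ hZ0 hZt).1 t htI z hz,
    _, L, hZd t htI z hz, hL1, hL2⟩

/-- The spatial derivatives of the generating function. -/
theorem hasFDerivAt_generatingFun (hg : Admissible g gt)
    (h : IsScaledFlow g gt x₀ Y κ C v) (hx : x₀ ≤ 1 / 2) (hκ : κ ≤ 1 / 2) (hκ₁ : κ₁ ≤ κ)
    (hK : IsMomentumInverse x₀ Y κ₁ κ₂ v K)
    (hσ : σ = 1 ∨ σ = -1) {ε t : ℝ} (ht : 0 ≤ σ * t) (hD₀ : IsOpen D₀) (hD₁ : IsOpen D₁)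
    (hD₀s : ∀ z ∈ D₀, scaling σ (z, ε) ∈ box d x₀ Y (1 / 4) κ₁)
    (hD₁s : ∀ z ∈ D₁, scaling σ (z, ε) ∈ box d x₀ Y (1 / 8) κ₂)
    (hD₁₀ : ∀ t, 0 ≤ σ * t → ∀ z ∈ D₁, momentumInv K σ ε t z ∈ D₀) {z : Phase d} (hz : z ∈ D₁) :
    (∃ S' : Phase d →L[ℝ] ℝ, HasFDerivAt (fun z => generatingFun g gt v K σ t (z, ε)) S' z ∧
      ∀ δ : Phase d, δ.2.2 = 0 → S' δ = pairing (momentumInv K σ ε t z) δ) ∧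
    HasDerivWithinAt (fun τ => generatingFun g gt v K σ τ (z, ε))
      (phaseHam g gt ε (momentumInv K σ ε t z)) {τ | 0 ≤ σ * τ} t := by
  have hσ2 := mul_self_of_sign hσ
  have hbox : ∀ z ∈ D₀, scaling σ (z, ε) ∈ box d x₀ Y (1 / 4) κ := fun z hz =>
    box_mono le_rfl hκ₁ (hD₀s z hz)
  have hspec : ∀ τ, 0 ≤ σ * τ → ∀ z ∈ D₁,
      K (σ * τ) (scaling σ (z, ε)) + momentumShift v (σ * τ) (K (σ * τ) (scaling σ (z, ε))) =
        scaling σ (z, ε) := fun τ hτ z hz => (hK.inverse_spec hτ (hD₁s z hz)).2.1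
  have hS : ∀ τ, 0 ≤ σ * τ → ∀ z ∈ D₁, generatingFun g gt v K σ τ (z, ε) =
      pairing (flowFormula v σ ε τ (momentumInv K σ ε τ z))
        (flowFormula v σ ε τ (momentumInv K σ ε τ z)) -
        τ * phaseHam g gt ε (momentumInv K σ ε τ z) := fun τ hτ z hz => by
    rw [← pairing_flowFormula_sub hσ2 (hspec τ hτ z hz), (hasFDerivAt_generating_flowFormula hg h
      hx hκ hσ hτ hD₀ hbox (hD₁₀ τ hτ z hz)).1]
  obtain ⟨-, Z', L, hZ', hL, hLw⟩ := hasFDerivAt_generating_flowFormula hg h hx hκ hσ ht hD₀ hbox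
    (hD₁₀ t ht z hz)
  have hKs := hK.contDiffOn hg h hx hκ hκ₁
  have hinv : ContDiffOn ℝ ∞ (fun p : ℝ × Phase d => momentumInv K σ ε p.1 p.2)
      ({τ | 0 ≤ σ * τ} ×ˢ D₁) := by
    have h1 : ContDiff ℝ ∞ (fun p : ℝ × Phase d => (σ * p.1, scaling σ (p.2, ε))) :=
      (contDiff_const.mul contDiff_fst).prodMk
        ((contDiff_scaling σ).comp (contDiff_snd.prodMk contDiff_const))
    have h2 : ContDiffOn ℝ ∞ (fun p : ℝ × Phase d => K (σ * p.1) (scaling σ (p.2, ε)))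
        ({τ | 0 ≤ σ * τ} ×ˢ D₁) :=
      hKs.comp h1.contDiffOn fun p hp => ⟨hp.1, hD₁s _ hp.2⟩
    have h3 : ContDiff ℝ ∞ (fun p : ℝ × Phase d => σ * Real.exp p.2.1) := by fun_prop
    exact contDiffOn_snd.fst.prodMk (contDiffOn_snd.snd.fst.prodMk
      ((contDiffOn_const.mul h2.snd.snd.snd.fst).prodMk (h3.contDiffOn.smul h2.snd.snd.snd.snd)))
  constructor
  · have hΨ : HasFDerivAt (momentumInv K σ ε t) (fderiv ℝ (momentumInv K σ ε t) z) z := by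
      have h1 : ContDiffOn ℝ ∞ (fun z => momentumInv K σ ε t z) D₁ :=
        hinv.comp (f := fun z : Phase d => (t, z)) (by fun_prop) fun z hz => ⟨ht, hz⟩
      exact ((h1.contDiffAt (hD₁.mem_nhds hz)).differentiableAt (by simp)).hasFDerivAt
    set Ψ' := fderiv ℝ (momentumInv K σ ε t) z
    have hpair : HasFDerivAt (fun z => (t, momentumInv K σ ε t z)) _ z :=
      (hasFDerivAt_const t z).prodMk hΨ
    have hcomp := HasFDerivAt.comp (f := fun z => (t, momentumInv K σ ε t z)) z hL hpair
    have hZc : HasFDerivAt (fun z => flowFormula v σ ε t (momentumInv K σ ε t z)) _ z :=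
      HasFDerivAt.comp (g := fun p : ℝ × Phase d => flowFormula v σ ε p.1 p.2)
        (f := fun z => (t, momentumInv K σ ε t z)) z hZ' hpair
    refine ⟨_, hcomp.congr_of_eventuallyEq ?_, fun δ hδ => ?_⟩
    · filter_upwards [hD₁.mem_nhds hz] with z hz
      exact hS t ht z hz
    -- The final momenta at the inverse point are the prescribed (ρ, η). They do not change when
    -- only r and y vary, so the term with the differential of the flow disappears.
    · have hnhds : (fun z => (flowFormula v σ ε t (momentumInv K σ ε t z)).2.2) =ᶠ[𝓝 z]
          fun z => z.2.2 := by
        filter_upwards [hD₁.mem_nhds hz] with z hz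
        obtain ⟨h1, h2⟩ := flowFormula_momentumInv hσ2 (hspec t ht z hz)
        exact Prod.ext h1 h2
      have h3 := hZc.snd.snd.unique ((hasFDerivAt_id z).snd.snd.congr_of_eventuallyEq hnhds)
      have h4 : (Z' (0, Ψ' δ)).2.2 = δ.2.2 := congrArg (fun L => L δ) h3
      have h5 : (Ψ' δ).1 = δ.1 :=
        congrArg (fun L => L δ) (hΨ.fst.unique (hasFDerivAt_fst (p := z)))
      have hy : HasFDerivAt (fun z : Phase d => z.2.1) _ z := (hasFDerivAt_id (𝕜 := ℝ) z).snd.fst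
      have h6 : (Ψ' δ).2.1 = δ.2.1 := congrArg (fun L => L δ) (hΨ.snd.fst.unique hy)
      have h7 : L (0, Ψ' δ) = _ := hLw (0, Ψ' δ)
      refine Eq.trans (h7 : _) ?_
      simp only [pairing, h4, hδ, h5, h6]
      simp
  -- The half line is convex with interior point σ, so one-sided time derivatives at t = 0 are well
  -- defined.
  · have hu : UniqueDiffWithinAt ℝ {τ | 0 ≤ σ * τ} t := by
      have h1 : Convex ℝ {τ | 0 ≤ σ * τ} := by
        refine Set.OrdConnected.convex ⟨fun a ha b hb c hc => ?_⟩
        rcases hσ with rfl | rfl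
        · have : 0 ≤ 1 * a := ha
          simp only [mem_ofPred_eq]; linarith [hc.1]
        · have : 0 ≤ -1 * b := hb
          simp only [mem_ofPred_eq]; linarith [hc.2]
      refine uniqueDiffWithinAt_convex h1 ⟨σ, ?_⟩ (subset_closure ht)
      refine mem_interior.2 ⟨{τ | 0 < σ * τ}, fun τ hτ => (show 0 < σ * τ from hτ).le,
        isOpen_lt continuous_const (by fun_prop), ?_⟩
      simp only [mem_ofPred_eq, hσ2]
      norm_num
    have hΨ : HasDerivWithinAt (fun τ => momentumInv K σ ε τ z)
        (derivWithin (fun τ => momentumInv K σ ε τ z) {τ | 0 ≤ σ * τ} t) {τ | 0 ≤ σ * τ} t := by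
      have h1 : ContDiffOn ℝ ∞ (fun τ => momentumInv K σ ε τ z) {τ | 0 ≤ σ * τ} :=
        hinv.comp (f := fun τ : ℝ => (τ, z)) (by fun_prop) fun τ hτ => ⟨hτ, hz⟩
      exact ((h1 t ht).differentiableWithinAt (by simp)).hasDerivWithinAt
    set Ψ' := derivWithin (fun τ => momentumInv K σ ε τ z) {τ | 0 ≤ σ * τ} t
    have hpair : HasDerivWithinAt (fun τ => (τ, momentumInv K σ ε τ z)) (1, Ψ') {τ | 0 ≤ σ * τ} t :=
      (hasDerivWithinAt_id t _).prodMk hΨ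
    have hcomp := HasFDerivAt.comp_hasDerivWithinAt (f := fun τ => (τ, momentumInv K σ ε τ z)) t hL
      hpair
    have hZc : HasDerivWithinAt (fun τ => flowFormula v σ ε τ (momentumInv K σ ε τ z)) _
        {τ | 0 ≤ σ * τ} t := HasFDerivAt.comp_hasDerivWithinAt
      (l := fun p : ℝ × Phase d => flowFormula v σ ε p.1 p.2)
      (f := fun τ => (τ, momentumInv K σ ε τ z)) t hZ' hpair
    have h3 := (hcomp.congr (fun τ hτ => hS τ hτ z hz) (hS t ht z hz))
    refine h3.congr_deriv ?_
    -- Along t with the target momenta fixed, the final momenta are constant, and only the energy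
    -- term survives.
    have h4 : (Z' (1, Ψ')).2.2 = 0 := by
      refine hu.eq_deriv _ (hZc.snd.snd) ((hasDerivWithinAt_const t _ z.2.2).congr
        (fun τ hτ => ?_) ?_)
      · obtain ⟨h1, h2⟩ := flowFormula_momentumInv hσ2 (hspec τ hτ z hz)
        exact Prod.ext h1 h2
      · obtain ⟨h1, h2⟩ := flowFormula_momentumInv hσ2 (hspec t ht z hz)
        exact Prod.ext h1 h2
    have h5 : Ψ'.1 = 0 := hu.eq_deriv _ hΨ.fst (hasDerivWithinAt_const t _ z.1)
    have h6 : Ψ'.2.1 = 0 := hu.eq_deriv _ hΨ.snd.fst (hasDerivWithinAt_const t _ z.2.1)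
    rw [hLw]
    simp only [pairing, h4, h5, h6]
    simp

end Generating


/-! ### The eikonal equation and the regions in phase space -/

section Regions

open Filter Topology

variable {d : ℕ} {g : Base d → QuadraticForm ℝ (Base d)}
  {gt : ℝ → Base d → QuadraticForm ℝ (Base d)} {x₀ Y κ κ₁ κ₂ C : ℝ} {v : ℝ → Scaled d → Phase d}
  {K : ℝ → Scaled d → Scaled d} {φ : ℝ → ℝ → Phase d → Phase d} {σ : ℝ} {D₀ D₁ : Set (Phase d)}

theorem isEikonalSolution_generatingFun (hg : Admissible g gt)
    (h : IsScaledFlow g gt x₀ Y κ C v) (hx : x₀ ≤ 1 / 2) (hκ : κ ≤ 1 / 2) (hκ₁ : κ₁ ≤ κ)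
    (hK : IsMomentumInverse x₀ Y κ₁ κ₂ v K) (hσ : σ = 1 ∨ σ = -1) (hD₀ : IsOpen D₀)
    (hD₁ : IsOpen D₁)
    (hD₀s : ∀ ε ∈ Icc (0 : ℝ) 1, ∀ z ∈ D₀, scaling σ (z, ε) ∈ box d x₀ Y (1 / 4) κ₁)
    (hD₁s : ∀ ε ∈ Icc (0 : ℝ) 1, ∀ z ∈ D₁, scaling σ (z, ε) ∈ box d x₀ Y (1 / 8) κ₂)
    (hD₁₀ : ∀ ε ∈ Icc (0 : ℝ) 1, ∀ t, 0 ≤ σ * t → ∀ z ∈ D₁, momentumInv K σ ε t z ∈ D₀) :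
    IsEikonalSolution g gt σ D₁ (generatingFun g gt v K σ) := by
  refine ⟨?_, fun t ht ε hε r y ρ η hz => ?_, fun ε hε r y ρ η hz => ?_⟩
  · have h1 : ContDiff ℝ ∞ (fun p : ℝ × Phase d × ℝ => (σ * p.1, scaling σ p.2)) :=
      (contDiff_const.mul contDiff_fst).prodMk ((contDiff_scaling σ).comp contDiff_snd)
    have h2 := (hK.contDiffOn_comp
      (H := fun s q => actionRemainder g gt s (q, unscale v s q)) hg h hx hκ hκ₁
      (h.contDiffOn_actionRemainder hg hx hκ)).comp (h1.contDiffOn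
        (s := {t : ℝ | 0 ≤ σ * t} ×ˢ D₁ ×ˢ Icc (0 : ℝ) 1))
      fun p hp => ⟨hp.1, hD₁s _ hp.2.2 _ hp.2.1⟩
    have e1 : ContDiff ℝ ∞ (fun p : ℝ × Phase d × ℝ => p.2.1.1 * p.2.1.2.2.1) := by fun_prop
    have e2 : ContDiff ℝ ∞ (fun p : ℝ × Phase d × ℝ => p.2.1.2.1) := by fun_prop
    have e3 : ContDiff ℝ ∞ (fun p : ℝ × Phase d × ℝ => p.2.1.2.2.2) := by fun_prop
    have e4 : ContDiff ℝ ∞ (fun p : ℝ × Phase d × ℝ => p.1 * p.2.1.2.2.1 ^ 2) := by fun_prop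
    exact ((e1.add (e2.inner ℝ e3)).add e4).contDiffOn.add (contDiffOn_const.mul h2)
  · obtain ⟨⟨S', hS', hδ⟩, hd⟩ := hasFDerivAt_generatingFun hg h hx hκ hκ₁ hK hσ ht hD₀ hD₁
      (hD₀s ε hε) (hD₁s ε hε) (hD₁₀ ε hε) hz
    have hr : deriv (fun r' => generatingFun g gt v K σ t ((r', y, ρ, η), ε)) r =
        (momentumInv K σ ε t (r, y, ρ, η)).2.2.1 := by
      have h1 : HasDerivAt (fun r' : ℝ => ((r', y, ρ, η) : Phase d)) (1, 0) r :=
        (hasDerivAt_id r).prodMk (hasDerivAt_const r _)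
      have h2 := HasFDerivAt.comp_hasDerivAt (f := fun r' : ℝ => ((r', y, ρ, η) : Phase d)) r hS' h1
      refine h2.deriv.trans ((hδ _ rfl).trans ?_)
      simp [pairing]
    have hy : gradient (fun y' => generatingFun g gt v K σ t ((r, y', ρ, η), ε)) y =
        (momentumInv K σ ε t (r, y, ρ, η)).2.2.2 := by
      refine HasGradientAt.gradient (hasGradientAt_iff_hasFDerivAt.2 ?_)
      have h1 : HasFDerivAt (fun y' : Base d => ((r, y', ρ, η) : Phase d)) _ y :=
        (hasFDerivAt_const r y).prodMk ((hasFDerivAt_id (𝕜 := ℝ) y).prodMk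
          (hasFDerivAt_const (ρ, η) y))
      have h2 := HasFDerivAt.comp (f := fun y' : Base d => ((r, y', ρ, η) : Phase d)) y hS' h1
      refine h2.congr_fderiv (ContinuousLinearMap.ext fun w => ?_)
      refine (hδ _ rfl).trans ?_
      simp [pairing]
    rw [hr, hy]
    exact hd
  · have hq := (hK.inverse_spec (s := σ * 0) (by simp) (hD₁s ε hε _ hz)).1
    have h3 : unscale v (σ * 0) (K (σ * 0) (scaling σ ((r, y, ρ, η), ε))) = 0 := by
      simp only [unscale, mul_zero, neg_zero, Real.exp_zero, sub_self] at hq ⊢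
      exact h.init _ (box_mono le_rfl hκ₁ hq)
    simp only [generatingFun, h3, actionRemainder]
    simp

theorem mem_region {R k w : ℝ} {Ω : Set (Base d)} {z : Phase d} : z ∈ region g gt σ R k w Ω ↔
    phaseHam g gt 0 z ∈ Ioo (1 - w) (1 + w) ∧ R < z.1 ∧ 0 < σ * z.2.2.1 ∧ z.2.1 ∈ Ω ∧
      Real.exp (-2 * z.1) * g z.2.1 z.2.2.2 < k := Iff.rfl

theorem phaseHam_zero (z : Phase d) : phaseHam g gt 0 z =
    z.2.2.1 ^ 2 + Real.exp (-2 * z.1) * g z.2.1 z.2.2.2 := by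
  simp [phaseHam, ham, gEps]

theorem isOpen_region (hg : Admissible g gt) {R k w : ℝ} {Ω : Set (Base d)} (hΩ : IsOpen Ω) :
    IsOpen (region g gt σ R k w Ω) := by
  have h1 : Continuous (phaseHam g gt 0) := (contDiff_phaseHam hg 0).continuous
  have h2 : Continuous fun z : Phase d => Real.exp (-2 * z.1) * g z.2.1 z.2.2.2 := by
    have : (fun z : Phase d => Real.exp (-2 * z.1) * g z.2.1 z.2.2.2) =
        fun z => phaseHam g gt 0 z - z.2.2.1 ^ 2 := by
      funext z
      rw [phaseHam_zero]
      ring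
    rw [this]
    fun_prop
  have h3 : IsOpen {z : Phase d | z.2.1 ∈ Ω} := hΩ.preimage (by fun_prop)
  have h4 : IsOpen {z : Phase d | 0 < σ * z.2.2.1} := isOpen_lt continuous_const (by fun_prop)
  exact (isOpen_Ioo.preimage h1).inter ((isOpen_lt continuous_const continuous_fst).inter
    (h4.inter (h3.inter (isOpen_lt h2 continuous_const))))

theorem norm_scaling_xi (hσ : |σ| = 1) (ε : ℝ) (z : Phase d) :
    ‖(scaling σ (z, ε)).2.2.2.2‖ = Real.exp (-z.1) * ‖z.2.2.2‖ := by
  simp [scaling, norm_smul, hσ]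

theorem exp_mul_form_bounds {C₀ : ℝ} (hC₀ : 0 < C₀)
    (hell : ∀ y η : Base d, C₀⁻¹ * ‖η‖ ^ 2 ≤ g y η ∧ g y η ≤ C₀ * ‖η‖ ^ 2) (z : Phase d) :
    (Real.exp (-z.1) * ‖z.2.2.2‖) ^ 2 ≤ C₀ * (Real.exp (-2 * z.1) * g z.2.1 z.2.2.2) ∧
      Real.exp (-2 * z.1) * g z.2.1 z.2.2.2 ≤ C₀ * (Real.exp (-z.1) * ‖z.2.2.2‖) ^ 2 := by
  obtain ⟨h1, h2⟩ := hell z.2.1 z.2.2.2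
  have h3 : Real.exp (-2 * z.1) = Real.exp (-z.1) ^ 2 := by
    rw [← Real.exp_nat_mul]; congr 1; push_cast; ring
  have h4 : ‖z.2.2.2‖ ^ 2 ≤ C₀ * g z.2.1 z.2.2.2 := by
    rwa [inv_mul_le_iff₀ hC₀] at h1
  rw [h3, mul_pow]
  constructor
  · calc _ ≤ Real.exp (-z.1) ^ 2 * (C₀ * g z.2.1 z.2.2.2) := by gcongr
      _ = _ := by ring
  · calc _ ≤ Real.exp (-z.1) ^ 2 * (C₀ * ‖z.2.2.2‖ ^ 2) := by gcongr
      _ = _ := by ring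

/-- The energy window and the bound on the angular part place ρ² in (1 - w - k, 1 + w), which lies
in ((1 - c)², (1 + c)²); ellipticity converts the angular bound into |ξ| < κ. For ε ∈ (-1, 2) one
has |ε x| < 1 since x < 1/2. -/
theorem scaling_mem_box {C₀ R k w c : ℝ} {Ω : Set (Base d)} (hC₀ : 0 < C₀)
    (hell : ∀ y η : Base d, C₀⁻¹ * ‖η‖ ^ 2 ≤ g y η ∧ g y η ≤ C₀ * ‖η‖ ^ 2)
    (hσ : σ = 1 ∨ σ = -1) (hx : x₀ ≤ 1 / 2) (hR : Real.exp (-R) ≤ x₀)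
    (hΩ : Ω ⊆ Metric.ball 0 Y) (hκ : 0 < κ) (hk : C₀ * k ≤ κ ^ 2)
    (hc : 0 ≤ c) (hw₁ : (1 - c) ^ 2 ≤ 1 - w - k) (hw₂ : 1 + w ≤ (1 + c) ^ 2) {ε : ℝ} (hε : ε ∈ Ioo (-1 : ℝ) 2)
    {z : Phase d} (hz : z ∈ region g gt σ R k w Ω) : scaling σ (z, ε) ∈ box d x₀ Y c κ := by
  obtain ⟨⟨h1, h2⟩, h3, h4, h5, h6⟩ := mem_region.1 hz
  rw [phaseHam_zero] at h1 h2
  have hσ2 := mul_self_of_sign hσ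
  have hσ1 : |σ| = 1 := by rcases hσ with rfl | rfl <;> simp
  obtain ⟨e1, -⟩ := exp_mul_form_bounds hC₀ hell z
  have hnn : 0 ≤ Real.exp (-2 * z.1) * g z.2.1 z.2.2.2 :=
    nonneg_of_mul_nonneg_right ((sq_nonneg _).trans e1) hC₀
  have hexp : Real.exp (-z.1) < x₀ := (Real.exp_lt_exp.2 (by linarith)).trans_le hR
  have hx0 := Real.exp_pos (-z.1)
  have hsq : (σ * z.2.2.1) ^ 2 = z.2.2.1 ^ 2 := by linear_combination z.2.2.1 ^ 2 * hσ2
  refine mem_box.2 ⟨⟨hx0, hexp⟩, ?_, mem_ball_zero_iff.1 (hΩ h5), ?_, ?_⟩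
  · simp only [scaling]
    rw [abs_lt]
    constructor <;> nlinarith [hε.1, hε.2]
  · simp only [scaling]
    rw [abs_lt]
    constructor
    · have : 1 - c < σ * z.2.2.1 := lt_of_pow_lt_pow_left₀ 2 h4.le (by rw [hsq]; linarith)
      linarith
    · have : σ * z.2.2.1 < 1 + c :=
        lt_of_pow_lt_pow_left₀ 2 (add_nonneg zero_le_one hc) (by rw [hsq]; linarith)
      linarith
  · rw [norm_scaling_xi hσ1]
    refine lt_of_pow_lt_pow_left₀ 2 hκ.le (e1.trans_lt (lt_of_lt_of_le ?_ hk))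
    exact mul_lt_mul_of_pos_left h6 hC₀

/-- The inverse at most doubles |ξ|, and |ξ|² < C₀ k₁ ≤ 1/40000, so the new |ξ| is at most 1/100 and
σρ moves by at most that. From σρ ∈ (24/25, 103/100) the energy stays within 1/5 of 1. -/
theorem momentumInv_mem_region {C₀ R k₀ k₁ : ℝ} {Ω₀ Ω₁ : Set (Base d)} (hC₀ : 0 < C₀)
    (hell : ∀ y η : Base d, C₀⁻¹ * ‖η‖ ^ 2 ≤ g y η ∧ g y η ≤ C₀ * ‖η‖ ^ 2)
    (hσ : σ = 1 ∨ σ = -1) (hK : IsMomentumInverse x₀ Y κ₁ κ₂ v K) (hΩ : Ω₁ ⊆ Ω₀)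
    (hk₀ : k₀ ≤ 1 / 100) (hk₁ : k₁ ≤ 1 / 100) (hk₁' : C₀ * k₁ ≤ 1 / 40000)
    (hk₁₀ : C₀ ^ 2 * k₁ ≤ k₀ / 4) {ε t : ℝ} (ht : 0 ≤ σ * t) {z : Phase d}
    (hz : z ∈ region g gt σ R k₁ (1 / 20) Ω₁) (hzs : scaling σ (z, ε) ∈ box d x₀ Y (1 / 8) κ₂) :
    momentumInv K σ ε t z ∈ region g gt σ R k₀ (1 / 5) Ω₀ := by
  obtain ⟨⟨h1, h2⟩, h3, h4, h5, h6⟩ := mem_region.1 hz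
  obtain ⟨-, hKe, hK1, hK2⟩ := hK.inverse_spec ht hzs
  have hσ2 := mul_self_of_sign hσ
  have hσ1 : |σ| = 1 := by rcases hσ with rfl | rfl <;> simp
  have hs := scaling_momentumInv hσ2 hKe
  rw [← hs, norm_scaling_xi hσ1, norm_scaling_xi hσ1] at hK1
  rw [← hs, norm_scaling_xi hσ1] at hK2
  set z' := momentumInv K σ ε t z with hz'
  have hz1 : z'.1 = z.1 := rfl
  have hz2 : z'.2.1 = z.2.1 := rfl
  change |σ * z'.2.2.1 - σ * z.2.2.1| ≤ _ at hK2
  rw [phaseHam_zero] at h1 h2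
  obtain ⟨e1, -⟩ := exp_mul_form_bounds hC₀ hell z
  obtain ⟨e1', e2'⟩ := exp_mul_form_bounds hC₀ hell z'
  set a := Real.exp (-2 * z.1) * g z.2.1 z.2.2.2
  set a' := Real.exp (-2 * z'.1) * g z'.2.1 z'.2.2.2
  set b := Real.exp (-z.1) * ‖z.2.2.2‖
  set b' := Real.exp (-z'.1) * ‖z'.2.2.2‖
  have hb' : 0 ≤ b' := by positivity
  have ha : 0 ≤ a := nonneg_of_mul_nonneg_right ((sq_nonneg _).trans e1) hC₀
  have ha' : 0 ≤ a' := nonneg_of_mul_nonneg_right ((sq_nonneg _).trans e1') hC₀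
  have hbb : b' ^ 2 ≤ 4 * b ^ 2 := by nlinarith
  have hb2 : b ^ 2 < C₀ * k₁ := e1.trans_lt (mul_lt_mul_of_pos_left h6 hC₀)
  have hak : a' < k₀ := by
    have h7 : C₀ * b' ^ 2 < C₀ * (4 * (C₀ * k₁)) := by
      refine mul_lt_mul_of_pos_left ?_ hC₀
      linarith
    have h8 : C₀ * (4 * (C₀ * k₁)) = 4 * (C₀ ^ 2 * k₁) := by ring
    linarith
  have hb1 : b' ≤ 1 / 100 := by
    refine le_of_pow_le_pow_left₀ two_ne_zero (by norm_num) ?_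
    norm_num
    linarith
  have hsq : (σ * z.2.2.1) ^ 2 = z.2.2.1 ^ 2 := by linear_combination z.2.2.1 ^ 2 * hσ2
  have hsq' : (σ * z'.2.2.1) ^ 2 = z'.2.2.1 ^ 2 := by linear_combination z'.2.2.1 ^ 2 * hσ2
  rw [abs_le] at hK2
  have hl : 24 / 25 < σ * z.2.2.1 := lt_of_pow_lt_pow_left₀ 2 h4.le (by rw [hsq]; linarith)
  have hu : σ * z.2.2.1 < 103 / 100 :=
    lt_of_pow_lt_pow_left₀ 2 (by norm_num) (by rw [hsq]; linarith)
  have hl' : 19 / 20 < σ * z'.2.2.1 := by linarith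
  have hu' : σ * z'.2.2.1 < 26 / 25 := by linarith
  have hpos : 0 < σ * z'.2.2.1 := by linarith
  have hl2 : (19 / 20) ^ 2 < (σ * z'.2.2.1) ^ 2 := pow_lt_pow_left₀ hl' (by norm_num) two_ne_zero
  have hu2 : (σ * z'.2.2.1) ^ 2 < (26 / 25) ^ 2 := pow_lt_pow_left₀ hu' hpos.le two_ne_zero
  refine mem_region.2 ⟨?_, h3, hpos, hΩ h5, hak⟩
  rw [phaseHam_zero, ← hsq']
  exact ⟨by linarith, by linarith⟩

end Regions

end HypEikonal

/-! ### Choice of the constants and conclusion -/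

open HypEikonal in
theorem mainTheorem5 (d : ℕ) (hd : 1 ≤ d)
    (g : Base d → QuadraticForm ℝ (Base d)) (gt : ℝ → Base d → QuadraticForm ℝ (Base d))
    (hg : Admissible g gt) (Ω₀ Ω₁ : Set (Base d))
    (hΩ₀_open : IsOpen Ω₀) (hΩ₁_open : IsOpen Ω₁)
    (hΩ₀_bdd : Bornology.IsBounded Ω₀) (hΩ₁_bdd : Bornology.IsBounded Ω₁)
    (hΩ₀_conn : IsConnected Ω₀) (hΩ₁_conn : IsConnected Ω₁)
    (hΩ : closure Ω₁ ⊆ Ω₀) :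
    ∃ φ : ℝ → ℝ → Phase d → Phase d, IsHamFlow g gt φ ∧
      ∃ R₀ R₁ w₀ w₁ κ₀ κ₁ : ℝ, 0 < R₀ ∧ 0 < R₁ ∧ 0 < w₀ ∧ w₀ < 1 / 2 ∧ 0 < w₁ ∧ w₁ < 1 / 2 ∧
        0 < κ₀ ∧ 0 < κ₁ ∧
        ∀ σ : ℝ, σ = 1 ∨ σ = -1 →
          (∃ Ψ : ℝ → ℝ → Phase d → Phase d,
            (∀ ε ∈ Icc (0 : ℝ) 1, ∀ t : ℝ, 0 ≤ σ * t →
              IsDiffeoOntoRange (momentumMap φ ε t) (Ψ ε t) (region g gt σ R₀ κ₀ w₀ Ω₀) ∧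
              region g gt σ R₁ κ₁ w₁ Ω₁ ⊆
                momentumMap φ ε t '' region g gt σ R₀ κ₀ w₀ Ω₀) ∧
            ExpEstimates σ (region g gt σ R₁ κ₁ w₁ Ω₁)
              (fun t q => (Ψ q.2 t q.1).2.2.1 - q.1.2.2.1) ∧
            ExpEstimates σ (region g gt σ R₁ κ₁ w₁ Ω₁)
              (fun t q => (Ψ q.2 t q.1).2.2.2 - q.1.2.2.2)) ∧
          ∃ S : ℝ → Phase d × ℝ → ℝ,
            IsEikonalSolution g gt σ (region g gt σ R₁ κ₁ w₁ Ω₁) S ∧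
            ExpEstimates σ (region g gt σ R₁ κ₁ w₁ Ω₁)
              (fun t q => S t q - q.1.1 * q.1.2.2.1 - ⟪q.1.2.1, q.1.2.2.2⟫
                - t * q.1.2.2.1 ^ 2) := by
  obtain ⟨φ, hφ⟩ := exists_isHamFlow hg
  obtain ⟨C₀, hC₀, hell'⟩ := hg.elliptic
  have hell : ∀ y η : Base d, C₀⁻¹ * ‖η‖ ^ 2 ≤ g y η ∧ g y η ≤ C₀ * ‖η‖ ^ 2 := fun y η => by
    simpa [gEps] using hell' 0 ⟨le_rfl, zero_le_one⟩ 0 y η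
  obtain ⟨Y, hY⟩ := hΩ₀_bdd.subset_ball 0
  have hΩ₁₀ : Ω₁ ⊆ Ω₀ := subset_closure.trans hΩ
  obtain ⟨x₀, κ, C, v, hx0, hx, hκ0, hκ, hC0, h⟩ := exists_isScaledFlow hg Y
  obtain ⟨κ₁, κ₂, K, hκ₁0, hκ₁, hκ₂0, hκ₂, hK⟩ := exists_isMomentumInverse hg h hC0 hx hκ0 hκ
  obtain ⟨B, hB0, hB⟩ := h.exists_bound_actionRemainder hg hC0 hx hκ
  -- The witness works since 1, C₀ and C₀² are all at most (1 + C₀)².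
  have hsmall : ∀ m : ℝ, 0 < m → ∃ k, 0 < k ∧ k ≤ m ∧ C₀ * k ≤ m ∧ C₀ ^ 2 * k ≤ m := fun m hm => by
    have h1 : 0 < (1 + C₀) ^ 2 := by positivity
    refine ⟨m / (1 + C₀) ^ 2, by positivity, ?_, ?_, ?_⟩
    · exact div_le_self hm.le (by nlinarith)
    · rw [← mul_div_assoc, div_le_iff₀ h1, mul_comm]
      exact mul_le_mul_of_nonneg_left (by nlinarith) hm.le
    · rw [← mul_div_assoc, div_le_iff₀ h1, mul_comm]
      exact mul_le_mul_of_nonneg_left (by nlinarith) hm.le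
  -- C₀ k₀ ≤ κ₁² puts the large region into the domain of the momentum shift; k₁ is then chosen
  -- relative to κ₂ and k₀, so that the inverse is defined on the small region and maps it into the
  -- large one.
  obtain ⟨k₀, hk₀, hk₀1, hk₀2, -⟩ := hsmall (min (1 / 100) (κ₁ ^ 2)) (by positivity)
  obtain ⟨k₁, hk₁, hk₁1, hk₁2, hk₁3⟩ :=
    hsmall (min (1 / 40000) (min (κ₂ ^ 2) (k₀ / 4))) (by positivity)
  simp only [le_min_iff] at hk₀1 hk₀2 hk₁1 hk₁2 hk₁3
  have hR : Real.exp (-(-Real.log x₀)) ≤ x₀ := by rw [neg_neg, Real.exp_log hx0]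
  have hR0 : 0 < -Real.log x₀ := neg_pos.2 (Real.log_neg hx0 (by linarith))
  -- R = -log x₀ means x < x₀. The widths 1/5 and 1/20 fit the momentum windows 1/4 and 1/8.
  refine ⟨φ, hφ, -Real.log x₀, -Real.log x₀, 1 / 5, 1 / 20, k₀, k₁, hR0, hR0, by norm_num,
    by norm_num, by norm_num, by norm_num, hk₀, hk₁, fun σ hσ => ?_⟩
  have hsub : ∀ ε ∈ Icc (0 : ℝ) 1, ε ∈ Ioo (-1 : ℝ) 2 := fun ε hε =>
    ⟨by linarith [hε.1], by linarith [hε.2]⟩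
  set D₀ := region g gt σ (-Real.log x₀) k₀ (1 / 5) Ω₀
  set D₁ := region g gt σ (-Real.log x₀) k₁ (1 / 20) Ω₁
  have hD₀ : IsOpen D₀ := isOpen_region hg hΩ₀_open
  have hD₁ : IsOpen D₁ := isOpen_region hg hΩ₁_open
  have hD₀s : ∀ ε ∈ Icc (0 : ℝ) 1, ∀ z ∈ D₀, scaling σ (z, ε) ∈ box d x₀ Y (1 / 4) κ₁ :=
    fun ε hε z hz => scaling_mem_box hC₀ hell hσ hx hR hY hκ₁0 hk₀2.2 (by norm_num)
      (by linarith [hk₀1.1]) (by norm_num) (hsub ε hε) hz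
  have hD₁s : MapsTo (scaling σ) (D₁ ×ˢ Ioo (-1) 2) (box d x₀ Y (1 / 8) κ₂) :=
    fun p hp => scaling_mem_box hC₀ hell hσ hx hR (hΩ₁₀.trans hY) hκ₂0 hk₁2.2.1 (by norm_num)
      (by linarith [hk₁1.1]) (by norm_num) hp.2 hp.1
  have hD₁s' : ∀ ε ∈ Icc (0 : ℝ) 1, ∀ z ∈ D₁, scaling σ (z, ε) ∈ box d x₀ Y (1 / 8) κ₂ :=
    fun ε hε z hz => hD₁s ⟨hz, hsub ε hε⟩
  have hD₁₀ : ∀ ε ∈ Icc (0 : ℝ) 1, ∀ t, 0 ≤ σ * t → ∀ z ∈ D₁, momentumInv K σ ε t z ∈ D₀ :=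
    fun ε hε t ht z hz => momentumInv_mem_region hC₀ hell hσ hK hΩ₁₀ hk₀1.1
      (by linarith [hk₁1.1]) hk₁2.1 hk₁3.2.2 ht hz (hD₁s' ε hε z hz)
  have hspec : ∀ t, 0 ≤ σ * t → ∀ p ∈ D₁ ×ˢ Icc (0 : ℝ) 1, _ := fun t ht p hp =>
    momentumInv_components (K := K) (v := v) (mul_self_of_sign hσ) (ε := p.2) (t := t) (z := p.1)
      (hK.inverse_spec ht (hD₁s' p.2 hp.2 p.1 hp.1)).2.1
  have hest : ∀ s : ℝ, 0 ≤ s → ∀ q ∈ box d x₀ Y (1 / 4) κ, _ := fun s hs q hq =>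
    h.estimates q hq _ (one_sub_exp_mem hs)
  refine ⟨⟨fun ε t => momentumInv K σ ε t, fun ε hε t ht => isDiffeoOntoRange_momentumMap hg h hx hκ
    hκ₁ hK hφ hσ hε ht hD₀ (hD₀s ε hε) (hD₁s' ε hε) (hD₁₀ ε hε t ht), ?_, ?_⟩,
    generatingFun g gt v K σ, isEikonalSolution_generatingFun hg h hx hκ hκ₁ hK hσ hD₀ hD₁ hD₀s
      hD₁s' hD₁₀, ?_⟩
  · exact expEstimates_of_initial hK hx hκ₁ hσ hD₁ hD₁s
      (fun n => (h.unifSmoothBox_unscale hg hx hκ n).snd.snd.fst) hC0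
      (fun s hs q hq => (hest s hs q hq).2.2.2.1) (-σ) fun t ht p hp => (hspec t ht p hp).1
  · exact expEstimates_of_initial hK hx hκ₁ hσ hD₁ hD₁s
      (fun n => (h.unifSmoothBox_unscale hg hx hκ n).snd.snd.snd) hC0
      (fun s hs q hq => (hest s hs q hq).2.2.2.2) (-σ) fun t ht p hp => (hspec t ht p hp).2
  · refine expEstimates_of_initial hK hx hκ₁ hσ hD₁ hD₁s
      (h.unifSmoothBox_actionRemainder hg hx hκ) hB0 hB σ fun t ht p hp => ?_
    simp only [generatingFun, smul_eq_mul]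
    ring
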